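/- Let $G$ be a finite group. We consider in parallel the topological setting (topological spaces, étale maps = local homeomorphisms) and the algebraic setting (schemes over $\mathbb{C}$ and étale morphisms). **Gerbe.** Let the $G$-gerbe $\mathcal{Y}\to\mathcal{B}$ be presented by an extension of étale groupoids over the same object $M$, $$M\times G\ \xrightarrow{\ i\ }\ \mathfrak{H}\ \xrightarrow{\ j\ }\ \mathfrak{Q},$$ where $i,j$ are morphisms of groupoids that are the identity on $M$, $i$ identifies the constant group bundle $M\times G$ with the kernel of $j$, and $j$ has a section $\sigma:\mathfrak{Q}\to\mathfrak{H}$ (a morphism of spaces or schemes, not necessarily multiplicative) that is the identity on $M$. Thus $\mathcal{Y}=[M/\mathfrak{H}]$ and $\mathcal{B}=[M/\mathfrak{Q}]$. Arrows are composed from left to right. **Dual.** Let $\widehat{G}$ be the set of isomorphism classes of irreducible complex representations of $G$, and choose for each class $\rho$ a unitary representation $\rho: G\to U(V_\rho)$. For $\nu\in\mathrm{Aut}(G)$ let $\nu[\rho]$ be the class of $\rho\circ\nu$, and choose a unitary map $T^{\rho}_\nu: V_\rho\to V_{\nu[\rho]}$ with $\rho(\nu(g))=(T^\rho_\nu)^{-1}\circ\nu[\rho](g)\circ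 T^\rho_\nu$ and $T^\rho_{1}=\mathrm{id}$. For $q\in\mathfrak{Q}$ let $\mathrm{Ad}_{\sigma(q)}\in \mathrm{Aut}(G)$ be $g\mapsto\sigma(q)g\sigma(q)^{-1}$, and put $q[\rho]=\mathrm{Ad}_{\sigma(q)}[\rho]$ and $T^\rho_q=T^\rho_{\mathrm{Ad}_{\sigma(q)}}$. The dual of $\mathcal{Y}$ is $\widehat{\mathcal{Y}}=[(M\times\widehat{G})/\mathfrak{Q}]$. With $\tau(q_1,q_2)=\sigma(q_1)\sigma(q_2)\sigma(q_1q_2)^{-1}\in G$, the locally constant $U(1)$-valued cocycle $c$ on the groupoid $\widehat{\mathfrak{Q}}=\widehat{G}\rtimes\mathfrak{Q}$ is defined by $$T^{q_1[\rho]}_{q_2}\,T^{\rho}_{q_1}=c^{\rho}(q_1,q_2)\;T^{\rho}_{q_1q_2}\,\rho(\tau(q_1,q_2))^{-1}.$$ **Sheaves.** A sheaf means a sheaf of $\mathbb{C}$-vector spaces on the small étale site. A $c$-twisted sheaf on $\widehat{\mathcal{Y}}$ is a sheaf of weight one on the $U(1)$-gerbe over $\widehat{\mathcal{Y}}$ defined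 by $c$; equivalently, it is a sheaf $\mathcal{W}'$ on $M\times\widehat{G}$ with isomorphisms $\Gamma_{(\rho,q)}$, for the arrows $(\rho,q)$ of $\widehat{\mathfrak{Q}}$, from the fibre at the target to the fibre at the source, such that $\Gamma_{(\rho,q_1)}\circ\Gamma_{(q_1[\rho],q_2)}=c^\rho(q_1,q_2)\,\Gamma_{(\rho,q_1q_2)}$. **Theorem.** 1. In the topological and in the algebraic setting, there is an equivalence from the category of $c$-twisted sheaves on $\widehat{\mathcal{Y}}$ to the category of sheaves on $\mathcal{Y}$, given by tensoring with the sheaf $\mathcal{V}_G$ on $M\times\widehat{G}$ whose restriction to $M\times\{\rho\}$ is the constant sheaf $V_\rho$. That is, naturally in $\mathcal{W}'$, it sends $\mathcal{W}'$ to the $\mathfrak{H}$-sheaf $$\bigoplus_{\rho\in\widehat{G}}\mathcal{W}'|_{M\times\{\rho\}}\otimes_{\mathbb{C}}V_\rho$$ on $M$, on which an arrow $h=g\,\sigma(q)$ with $g\in G$, $q=j(h)$, acts, from the $q[\rho]$-summand at its target to the $\rho$-summand at its source, by $\Gamma_{(\rho,q)}\otimes\rho(g)(T^\rho_q)^{-1}$.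 (So $\mathcal{W}'|_{M\times\{\rho\}}\otimes V_\rho$ is the $\rho$-isotypic part of the image for the action of $G$.) 2. In the algebraic setting, in particular for $G$-gerbes over Deligne–Mumford stacks over $\mathbb{C}$ presented as above, the same formula gives, for modules over the structure sheaf, an equivalence from the category of $c$-twisted quasi-coherent sheaves on $\widehat{\mathcal{Y}}$ to the category of quasi-coherent sheaves on $\mathcal{Y}$, and an equivalence from the category of $c$-twisted coherent sheaves on $\widehat{\mathcal{Y}}$ to the category of coherent sheaves on $\mathcal{Y}$. Here a sheaf of modules is quasi-coherent if restriction between affine étale charts is base change, and coherent if in addition its sections over every affine étale chart form a coherent module (a finitely generated module whose finitely generated submodules are finitely presented). -/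

import Mathlib

open CategoryTheory AlgebraicGeometry Opposite
noncomputable section
namespace GerbeDuality

/-- The dual `Ĝ` of a group `G` with a chosen unitary representative `V i` of every class:
`V i`, `i : Idx`, are irreducible finite-dimensional unitary representations, pairwise
inequivalent, and every finite-dimensional irreducible complex representation is equivalent to
one of them. -/
structure UnitaryDual (G : Type) [Group G] where
  Idx : Type
  V : Idx → Type
  [normedAddCommGroup : ∀ i, NormedAddCommGroup (V i)]
  [innerProductSpace : ∀ i, InnerProductSpace ℂ (V i)]
  [finiteDimensional : ∀ i, FiniteDimensional ℂ (V i)]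
  rep : ∀ i, Representation ℂ G (V i)
  norm_rep : ∀ i g v, ‖rep i g v‖ = ‖v‖
  irreducible : ∀ i, (rep i).IsIrreducible
  eq_of_equiv : ∀ i k, Nonempty ((rep i).Equiv (rep k)) → i = k
  exists_equiv : ∀ (W : Type) [AddCommGroup W] [Module ℂ W] [FiniteDimensional ℂ W]
    (σ : Representation ℂ G W), σ.IsIrreducible → ∃ i, Nonempty (σ.Equiv (rep i))

attribute [instance] UnitaryDual.normedAddCommGroup UnitaryDual.innerProductSpace
  UnitaryDual.finiteDimensional

namespace UnitaryDual
variable {G : Type} [Group G] (D : UnitaryDual G)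

/-- The disjoint union of the spaces `V i`; working in it avoids transports along `i = k`. -/
abbrev Total : Type := Σ i, D.V i
/-- Scalar multiplication on the disjoint union of the `V i`. -/
def smul (z : ℂ) (x : D.Total) : D.Total := ⟨x.1, z • x.2⟩
/-- The action of `G` on the disjoint union of the `V i`. -/
def rot (g : G) (x : D.Total) : D.Total := ⟨x.1, D.rep x.1 g x.2⟩

lemma exists_ne_zero (i : D.Idx) : ∃ v : D.V i, v ≠ 0 := by
  by_contra! h
  have := D.irreducible i
  obtain ⟨a, b, hab⟩ := (inferInstance : Nontrivial (Subrepresentation (D.rep i)))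
  apply hab
  apply SetLike.ext
  intro x
  rw [h x]
  exact ⟨fun _ => zero_mem b.toSubmodule, fun _ => zero_mem a.toSubmodule⟩

/-- Schur's lemma. -/
lemma schur (i : D.Idx) (A : D.V i →ₗ[ℂ] D.V i)
    (hA : ∀ g v, A (D.rep i g v) = D.rep i g (A v)) : ∃ z : ℂ, ∀ v, A v = z • v := by
  have := D.irreducible i
  obtain ⟨z, hz⟩ := (Representation.IsIrreducible.algebraMap_intertwiningMap_bijective_of_isAlgClosed
    (ρ := D.rep i)).2 ⟨A, fun g => LinearMap.ext (hA g)⟩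
  exact ⟨z, fun v => (congrArg (fun f => f v) hz).symm⟩

end UnitaryDual

/-- For every automorphism `ν` of `G` and every class `i`, the class `act ν i` of `ρ_i ∘ ν` together
with a unitary intertwiner `T ν i : V i → V (act ν i)`, that is
`ρ_i (ν g) = T⁻¹ ∘ ρ_{act ν i} (g) ∘ T`; for `ν = 1` the intertwiner is the identity. No
compatibility with composition is required: its failure is measured by a scalar. -/
structure Intertwiners {G : Type} [Group G] (D : UnitaryDual G) where
  act : MulAut G → D.Idx → D.Idx
  T : ∀ (ν : MulAut G) (i : D.Idx), D.V i ≃ₗᵢ[ℂ] D.V (act ν i)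
  T_rep : ∀ ν i (g : G) (v : D.V i), T ν i (D.rep i (ν g) v) = D.rep (act ν i) g (T ν i v)
  T_one : ∀ i (v : D.V i), (⟨act 1 i, T 1 i v⟩ : D.Total) = ⟨i, v⟩


namespace Intertwiners
variable {G : Type} [Group G] {D : UnitaryDual G} (T : Intertwiners D)

/-- All the intertwiners of `ν` together. -/
def map (ν : MulAut G) (x : D.Total) : D.Total := ⟨T.act ν x.1, T.T ν x.1 x.2⟩

lemma map_smul (ν : MulAut G) (z : ℂ) (x : D.Total) :
    T.map ν (D.smul z x) = D.smul z (T.map ν x) := by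
  exact congrArg (Sigma.mk (T.act ν x.1)) ((T.T ν x.1).map_smul z x.2)

lemma map_rot (ν : MulAut G) (g : G) (x : D.Total) :
    T.map ν (D.rot (ν g) x) = D.rot g (T.map ν x) := by
  exact congrArg (Sigma.mk (T.act ν x.1)) (T.T_rep ν x.1 g x.2)

lemma map_one (x : D.Total) : T.map 1 x = x := T.T_one x.1 x.2

/-- If `ν₁ ν₂ = Ad_τ ν₁₂`, the isometries `T_{ν₂} T_{ν₁}` and `T_{ν₁₂} ρ_i(τ)⁻¹` differ by a scalar
of absolute value one. -/
theorem exists_scalar (i : D.Idx) (ν₁ ν₂ ν₁₂ : MulAut G) (τ : G)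
    (h : ν₁ * ν₂ = MulAut.conj τ * ν₁₂) :
    ∃ z : Circle, ∀ v : D.V i, T.map ν₂ (T.map ν₁ ⟨i, v⟩) =
      D.smul z (T.map ν₁₂ (D.rot τ⁻¹ ⟨i, v⟩)) := by
  let R : D.V i ≃ₗ[ℂ] D.V i :=
    { toLinearMap := D.rep i τ⁻¹
      invFun := D.rep i τ
      left_inv := fun v => by simp
      right_inv := fun v => by simp }
  let A : D.V i ≃ₗ[ℂ] D.V (T.act ν₂ (T.act ν₁ i)) :=
    (T.T ν₁ i).toLinearEquiv.trans (T.T ν₂ (T.act ν₁ i)).toLinearEquiv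
  let B : D.V i ≃ₗ[ℂ] D.V (T.act ν₁₂ i) := R.trans (T.T ν₁₂ i).toLinearEquiv
  have hA : ∀ g v, A (D.rep i ((ν₁ * ν₂) g) v) = D.rep _ g (A v) := fun g v => by
    change T.T ν₂ _ (T.T ν₁ i (D.rep i (ν₁ (ν₂ g)) v)) = _
    rw [T.T_rep, T.T_rep]; rfl
  have hB : ∀ g v, B (D.rep i ((ν₁ * ν₂) g) v) = D.rep _ g (B v) := fun g v => by
    change T.T ν₁₂ i (D.rep i τ⁻¹ (D.rep i ((ν₁ * ν₂) g) v)) =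
      D.rep _ g (T.T ν₁₂ i (D.rep i τ⁻¹ v))
    rw [← T.T_rep, h]
    simp only [MulAut.mul_apply, MulAut.conj_apply, ← Module.End.mul_apply, ← _root_.map_mul]
    congr 3
    group
  have hAn : ∀ v, ‖A v‖ = ‖v‖ := fun v => by
    change ‖T.T ν₂ _ (T.T ν₁ i v)‖ = _
    simp
  have hBn : ∀ v, ‖B v‖ = ‖v‖ := fun v => by
    change ‖T.T ν₁₂ i (D.rep i τ⁻¹ v)‖ = _
    simp [D.norm_rep]
  suffices H : ∃ z : Circle, ∀ v, (⟨_, A v⟩ : D.Total) = D.smul z ⟨_, B v⟩ from H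
  clear_value A B
  have hk : T.act ν₂ (T.act ν₁ i) = T.act ν₁₂ i := by
    refine D.eq_of_equiv _ _ ⟨.mk (A.symm.trans B) fun g => LinearMap.ext fun v => ?_⟩
    obtain ⟨w, rfl⟩ := A.surjective v
    change B (A.symm (D.rep _ g (A w))) = D.rep _ g (B (A.symm (A w)))
    rw [← hA, A.symm_apply_apply, A.symm_apply_apply, hB]
  generalize T.act ν₂ (T.act ν₁ i) = k at A hA hAn hk
  subst hk
  obtain ⟨z, hz⟩ := D.schur i (A.trans B.symm).toLinearMap fun g v => by
    obtain ⟨g, rfl⟩ := (ν₁ * ν₂).surjective g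
    apply B.injective
    change B (B.symm (A (D.rep i _ v))) = B (D.rep i _ (B.symm (A v)))
    rw [hA, hB, B.apply_symm_apply, B.apply_symm_apply]
  have hz' : ∀ v, A v = z • B v := fun v => by
    have := congrArg B (hz v)
    simpa using this
  have hz1 : ‖z‖ = 1 := by
    obtain ⟨v, hv⟩ := D.exists_ne_zero i
    have := congrArg norm (hz' v)
    rw [norm_smul, hAn, hBn] at this
    exact mul_right_cancel₀ (norm_ne_zero_iff.2 hv) (by rw [← this, one_mul])
  exact ⟨⟨z, mem_sphere_zero_iff_norm.2 hz1⟩, fun v => by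
    change _ = (⟨_, z • B v⟩ : D.Total)
    rw [hz']⟩

open Classical in
/-- The scalar `z` in `T_{ν₂} T_{ν₁} = z • T_{ν₁₂} ρ_i(τ)⁻¹` on `V i`, for `ν₁ ν₂ = Ad_τ ν₁₂`. -/
def scalar (i : D.Idx) (ν₁ ν₂ ν₁₂ : MulAut G) (τ : G) : Circle :=
  if h : ν₁ * ν₂ = MulAut.conj τ * ν₁₂ then (T.exists_scalar i ν₁ ν₂ ν₁₂ τ h).choose else 1

lemma scalar_spec {ν₁ ν₂ ν₁₂ : MulAut G} {τ : G}
    (h : ν₁ * ν₂ = MulAut.conj τ * ν₁₂) (x : D.Total) :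
    T.map ν₂ (T.map ν₁ x) =
      D.smul (T.scalar x.1 ν₁ ν₂ ν₁₂ τ) (T.map ν₁₂ (D.rot τ⁻¹ x)) := by
  rw [scalar, dif_pos h]
  exact (T.exists_scalar x.1 ν₁ ν₂ ν₁₂ τ h).choose_spec x.2

lemma act_act {ν₁ ν₂ ν₁₂ : MulAut G} {τ : G}
    (h : ν₁ * ν₂ = MulAut.conj τ * ν₁₂) (i : D.Idx) :
    T.act ν₂ (T.act ν₁ i) = T.act ν₁₂ i :=
  congrArg Sigma.fst (T.scalar_spec h ⟨i, 0⟩)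

lemma smul_left_injective {x : D.Total} (hx : x.2 ≠ 0) {z z' : Circle}
    (h : D.smul z x = D.smul z' x) : z = z' := by
  have := eq_of_heq (Sigma.mk.inj h).2
  exact Subtype.ext (_root_.smul_left_injective ℂ hx this)

lemma map_ne_zero {x : D.Total} (hx : x.2 ≠ 0) (ν : MulAut G) : (T.map ν x).2 ≠ 0 :=
  (T.T ν x.1).map_eq_zero_iff.not.2 hx

lemma rot_ne_zero {x : D.Total} (hx : x.2 ≠ 0) (g : G) : (D.rot g x).2 ≠ 0 := by
  change D.rep x.1 g x.2 ≠ 0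
  rw [← norm_ne_zero_iff, D.norm_rep]
  exact norm_ne_zero_iff.2 hx

lemma scalar_one_left (i : D.Idx) (ν : MulAut G) : T.scalar i 1 ν ν 1 = 1 := by
  obtain ⟨v, hv⟩ := D.exists_ne_zero i
  have := T.scalar_spec (ν₁ := 1) (ν₂ := ν) (ν₁₂ := ν) (τ := 1) (by simp) ⟨i, v⟩
  have hr : D.rot 1⁻¹ ⟨i, v⟩ = ⟨i, v⟩ := by simp [UnitaryDual.rot]
  rw [map_one, hr] at this
  refine (smul_left_injective (T.map_ne_zero (x := ⟨i, v⟩) hv ν) (?_ : _ = _)).symm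
  rw [← this]; simp [UnitaryDual.smul]

lemma scalar_one_right (i : D.Idx) (ν : MulAut G) : T.scalar i ν 1 ν 1 = 1 := by
  obtain ⟨v, hv⟩ := D.exists_ne_zero i
  have := T.scalar_spec (ν₁ := ν) (ν₂ := 1) (ν₁₂ := ν) (τ := 1) (by simp) ⟨i, v⟩
  have hr : D.rot 1⁻¹ ⟨i, v⟩ = ⟨i, v⟩ := by simp [UnitaryDual.rot]
  rw [map_one, hr] at this
  refine (smul_left_injective (T.map_ne_zero (x := ⟨i, v⟩) hv ν) (?_ : _ = _)).symm
  rw [← this]; simp [UnitaryDual.smul]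

/-- The scalars satisfy the cocycle identity. -/
theorem scalar_cocycle (i : D.Idx) {ν₁ ν₂ ν₃ ν₁₂ ν₂₃ ν₁₂₃ : MulAut G} {τ₁₂ τ₂₃ τ₁₂' τ₂₃' : G}
    (h₁₂ : ν₁ * ν₂ = MulAut.conj τ₁₂ * ν₁₂) (h₂₃ : ν₂ * ν₃ = MulAut.conj τ₂₃ * ν₂₃)
    (h₁₂' : ν₁₂ * ν₃ = MulAut.conj τ₁₂' * ν₁₂₃) (h₂₃' : ν₁ * ν₂₃ = MulAut.conj τ₂₃' * ν₁₂₃)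
    (hτ : τ₁₂ * τ₁₂' = ν₁ τ₂₃ * τ₂₃') :
    T.scalar (T.act ν₁ i) ν₂ ν₃ ν₂₃ τ₂₃ * T.scalar i ν₁ ν₂₃ ν₁₂₃ τ₂₃' =
      T.scalar i ν₁₂ ν₃ ν₁₂₃ τ₁₂' * T.scalar i ν₁ ν₂ ν₁₂ τ₁₂ := by
  obtain ⟨v, hv⟩ := D.exists_ne_zero i
  set x : D.Total := ⟨i, v⟩ with hx
  have hsm : ∀ (z w : ℂ) (y : D.Total), D.smul z (D.smul w y) = D.smul (z * w) y :=
    fun z w y => congrArg (Sigma.mk y.1) (smul_smul z w y.2)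
  have hrr : ∀ (g h : G) (y : D.Total), D.rot g (D.rot h y) = D.rot (g * h) y :=
    fun g h y => congrArg (Sigma.mk y.1) (by
      rw [_root_.map_mul]; rfl)
  have e₁ := T.scalar_spec h₂₃ (T.map ν₁ x)
  rw [← T.map_rot, T.scalar_spec h₂₃', hsm, hrr] at e₁
  have e₂ := congrArg (T.map ν₃) (T.scalar_spec h₁₂ x)
  rw [T.map_smul, T.scalar_spec h₁₂', hsm, hrr, e₁] at e₂
  rw [show τ₂₃'⁻¹ * ν₁ τ₂₃⁻¹ = τ₁₂'⁻¹ * τ₁₂⁻¹ by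
    rw [map_inv, ← mul_inv_rev, ← mul_inv_rev, hτ]] at e₂
  have := smul_left_injective (z := _ * _) (z' := _ * _)
    (T.map_ne_zero (rot_ne_zero (x := x) hv _) _)
    (by simpa only [Circle.coe_mul] using e₂)
  rw [mul_comm (T.scalar i ν₁₂ _ _ _)]
  exact this

end Intertwiners


universe v u

/-- A category of geometric objects with a class of étale morphisms, a functor to underlying spaces,
and enough open subobjects. It is used only for `topological` and `algebraic` below. -/
structure Geometry (C : Type u) [Category.{v} C] where
  isEtale : MorphismProperty C
  space : C ⥤ TopCat.{v}
  exists_nhd : ∀ (U : C) (x : space.obj U) (N : Set (space.obj U)), IsOpen N → x ∈ N →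
    ∃ (V : C) (f : V ⟶ U), isEtale f ∧ x ∈ Set.range (space.map f) ∧
      Set.range (space.map f) ⊆ N

/-- An étale groupoid `arr ⇉ M` in `C`. Multiplication is given on `U`-valued points, naturally in `U`
(equivalently, on the fibre product `arr ×_M arr`). Arrows are composed diagrammatically:
`mul a b` is defined when the target of `a` is the source of `b`. -/
structure EtaleGroupoid {C : Type u} [Category.{v} C] (𝒢 : Geometry C) (M : C) where
  arr : C
  src : arr ⟶ M
  tgt : arr ⟶ M
  one : M ⟶ arr
  inv : arr ⟶ arr
  mul : ∀ {U : C} (a b : U ⟶ arr), a ≫ tgt = b ≫ src → (U ⟶ arr)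
  comp_mul : ∀ {U V : C} (f : V ⟶ U) (a b : U ⟶ arr) (h : a ≫ tgt = b ≫ src),
    f ≫ mul a b h = mul (f ≫ a) (f ≫ b) (by simp [h])
  mul_src : ∀ {U : C} (a b : U ⟶ arr) (h), mul a b h ≫ src = a ≫ src
  mul_tgt : ∀ {U : C} (a b : U ⟶ arr) (h), mul a b h ≫ tgt = b ≫ tgt
  one_src : one ≫ src = 𝟙 M
  one_tgt : one ≫ tgt = 𝟙 M
  inv_src : inv ≫ src = tgt
  inv_tgt : inv ≫ tgt = src
  one_mul : ∀ {U : C} (a : U ⟶ arr), mul ((a ≫ src) ≫ one) a (by simp [one_tgt]) = a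
  mul_one : ∀ {U : C} (a : U ⟶ arr), mul a ((a ≫ tgt) ≫ one) (by simp [one_src]) = a
  mul_assoc : ∀ {U : C} (a b c : U ⟶ arr) (h : a ≫ tgt = b ≫ src) (h' : b ≫ tgt = c ≫ src),
    mul (mul a b h) c (by rw [mul_tgt, h']) = mul a (mul b c h') (by rw [mul_src, h])
  mul_inv : ∀ {U : C} (a : U ⟶ arr), mul a (a ≫ inv) (by simp [inv_src]) = (a ≫ src) ≫ one
  inv_mul : ∀ {U : C} (a : U ⟶ arr), mul (a ≫ inv) a (by simp [inv_tgt]) = (a ≫ tgt) ≫ one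
  etale_src : 𝒢.isEtale src
  etale_tgt : 𝒢.isEtale tgt

namespace EtaleGroupoid
variable {C : Type u} [Category.{v} C] {𝒢 : Geometry C} {M : C} (X : EtaleGroupoid 𝒢 M)

lemma mul_congr {U : C} {a a' b b' : U ⟶ X.arr} (ha : a = a') (hb : b = b')
    (h : a ≫ X.tgt = b ≫ X.src) : X.mul a b h = X.mul a' b' (by rw [← ha, ← hb, h]) := by
  subst ha hb; rfl

lemma one_mul' {U : C} (u : U ⟶ M) (a : U ⟶ X.arr) (h : u = a ≫ X.src) :
    X.mul (u ≫ X.one) a (by simp [h, one_tgt]) = a := by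
  subst h; exact X.one_mul a

lemma mul_one' {U : C} (u : U ⟶ M) (a : U ⟶ X.arr) (h : u = a ≫ X.tgt) :
    X.mul a (u ≫ X.one) (by simp [h, one_src]) = a := by
  subst h; exact X.mul_one a

lemma mul_right_cancel {U : C} {a b c : U ⟶ X.arr} (h : a ≫ X.tgt = c ≫ X.src)
    (h' : b ≫ X.tgt = c ≫ X.src) (e : X.mul a c h = X.mul b c h') : a = b := by
  have := X.mul_congr e (rfl : c ≫ X.inv = c ≫ X.inv) (by rw [mul_tgt]; simp [X.inv_src])
  rw [X.mul_assoc _ _ _ h (by simp [X.inv_src]), X.mul_assoc _ _ _ h' (by simp [X.inv_src])] at this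
  rwa [X.mul_congr rfl (X.mul_inv c), X.mul_congr (rfl : b = b) (X.mul_inv c),
    X.mul_one' _ _ h.symm, X.mul_one' _ _ h'.symm] at this

lemma mul_left_cancel {U : C} {a b c : U ⟶ X.arr} (h : c ≫ X.tgt = a ≫ X.src)
    (h' : c ≫ X.tgt = b ≫ X.src) (e : X.mul c a h = X.mul c b h') : a = b := by
  have := X.mul_congr (rfl : c ≫ X.inv = c ≫ X.inv) e (by rw [mul_src]; simp [X.inv_tgt])
  rw [← X.mul_assoc _ _ _ (by simp [X.inv_tgt]) h,
    ← X.mul_assoc _ _ _ (by simp [X.inv_tgt]) h'] at this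
  rwa [X.mul_congr (X.inv_mul c) rfl, X.mul_congr (X.inv_mul c) (rfl : b = b),
    X.one_mul' _ _ h, X.one_mul' _ _ h'] at this

end EtaleGroupoid

/-- A presentation of a `G`-gerbe: étale groupoids `H` and `Q` over the same object `M` of objects, and
an extension `M × G → H → Q` of groupoids which are the identity on `M`. The group bundle `M × G` is
described by its `U`-valued points, which are pairs of a morphism `m : U ⟶ M` and a locally
constant map `g` from the space of `U` to `G`; `incl` identifies it with the kernel of `j`. The
morphism `sec : Q ⟶ H` is a section of `j` (not assumed to be multiplicative) which is the identity
on `M`; in particular `j` is surjective. -/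
structure GerbeExtension {C : Type u} [Category.{v} C] (𝒢 : Geometry C) (G : Type) [Group G]
    (M : C) where
  H : EtaleGroupoid 𝒢 M
  Q : EtaleGroupoid 𝒢 M
  j : H.arr ⟶ Q.arr
  j_src : j ≫ Q.src = H.src
  j_tgt : j ≫ Q.tgt = H.tgt
  one_j : H.one ≫ j = Q.one
  mul_j : ∀ {U : C} (a b : U ⟶ H.arr) (h : a ≫ H.tgt = b ≫ H.src),
    H.mul a b h ≫ j = Q.mul (a ≫ j) (b ≫ j) (by simp [j_src, j_tgt, h])
  incl : ∀ {U : C}, (U ⟶ M) → LocallyConstant (𝒢.space.obj U) G → (U ⟶ H.arr)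
  comp_incl : ∀ {U V : C} (f : V ⟶ U) (m : U ⟶ M) (g : LocallyConstant (𝒢.space.obj U) G),
    f ≫ incl m g = incl (f ≫ m) (g.comap (𝒢.space.map f).hom)
  incl_src : ∀ {U : C} (m : U ⟶ M) (g), incl m g ≫ H.src = m
  incl_tgt : ∀ {U : C} (m : U ⟶ M) (g), incl m g ≫ H.tgt = m
  incl_mul : ∀ {U : C} (m : U ⟶ M) (g g'),
    incl m (g * g') = H.mul (incl m g) (incl m g') (by rw [incl_tgt, incl_src])
  incl_injective : ∀ {U : C} (m : U ⟶ M), Function.Injective (incl m)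
  incl_j : ∀ {U : C} (m : U ⟶ M) (g), incl m g ≫ j = m ≫ Q.one
  exists_incl : ∀ {U : C} (m : U ⟶ M) (a : U ⟶ H.arr), a ≫ j = m ≫ Q.one → ∃ g, incl m g = a
  sec : Q.arr ⟶ H.arr
  sec_j : sec ≫ j = 𝟙 Q.arr
  one_sec : Q.one ≫ sec = H.one

namespace GerbeExtension
variable {C : Type u} [Category.{v} C] {𝒢 : Geometry C} {G : Type} [Group G] {M : C}
  (E : GerbeExtension 𝒢 G M)

lemma sec_src : E.sec ≫ E.H.src = E.Q.src := by
  rw [← E.j_src, ← Category.assoc, E.sec_j, Category.id_comp]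

lemma sec_tgt : E.sec ≫ E.H.tgt = E.Q.tgt := by
  rw [← E.j_tgt, ← Category.assoc, E.sec_j, Category.id_comp]

lemma incl_one {U : C} (m : U ⟶ M) : E.incl m 1 = m ≫ E.H.one := by
  have h := E.incl_mul m 1 1
  rw [_root_.mul_one] at h
  refine E.H.mul_right_cancel (c := E.incl m 1) ?_ ?_ ?_
  · rw [E.incl_src, E.incl_tgt]
  · simp [E.H.one_tgt, E.incl_src]
  · rw [← h, E.H.one_mul' _ _ (E.incl_src _ _).symm]

lemma exists_diff {U : C} (a b : U ⟶ E.H.arr) (hj : a ≫ E.j = b ≫ E.j) :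
    ∃ g, E.H.mul (E.incl (b ≫ E.H.src) g) b (by rw [E.incl_tgt]) = a := by
  have ht : a ≫ E.H.tgt = b ≫ E.H.tgt := by
    rw [← E.j_tgt, ← Category.assoc, hj, Category.assoc]
  obtain ⟨g, hg⟩ := E.exists_incl (b ≫ E.H.src)
    (E.H.mul a (b ≫ E.H.inv) (by simp [ht, E.H.inv_src])) (by
      rw [E.mul_j, E.Q.mul_congr hj rfl, ← E.mul_j _ _ (by simp [E.H.inv_src]), E.H.mul_inv,
        Category.assoc, E.one_j])
  refine ⟨g, ?_⟩
  rw [E.H.mul_congr hg rfl, E.H.mul_assoc _ _ _ _ (by simp [E.H.inv_tgt]),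
    E.H.mul_congr rfl (E.H.inv_mul b), E.H.mul_one' _ _ ht.symm]

lemma diff_unique {U : C} (m m' : U ⟶ M) (b : U ⟶ E.H.arr) {g g'} (h : m = m')
    (hm : E.incl m g ≫ E.H.tgt = b ≫ E.H.src) (hm' : E.incl m' g' ≫ E.H.tgt = b ≫ E.H.src)
    (e : E.H.mul (E.incl m g) b hm = E.H.mul (E.incl m' g') b hm') : g = g' := by
  subst h
  exact E.incl_injective _ (E.H.mul_right_cancel _ _ e)

/-- The conjugate `a g a⁻¹` of a point `g` of the group bundle by an arrow `a` of `H`. -/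
def conj {U : C} (a : U ⟶ E.H.arr) (g : LocallyConstant (𝒢.space.obj U) G) :
    LocallyConstant (𝒢.space.obj U) G :=
  (E.exists_diff (E.H.mul a (E.incl (a ≫ E.H.tgt) g) (by rw [E.incl_src])) a
    (by
      rw [E.mul_j, E.Q.mul_congr rfl (E.incl_j _ _), E.Q.mul_one' _ _ (by simp [E.j_tgt])])).choose

lemma conj_spec {U : C} (a : U ⟶ E.H.arr) (g : LocallyConstant (𝒢.space.obj U) G) :
    E.H.mul (E.incl (a ≫ E.H.src) (E.conj a g)) a (by rw [E.incl_tgt]) =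
      E.H.mul a (E.incl (a ≫ E.H.tgt) g) (by rw [E.incl_src]) :=
  (E.exists_diff (E.H.mul a (E.incl (a ≫ E.H.tgt) g) (by rw [E.incl_src])) a
    (by
      rw [E.mul_j, E.Q.mul_congr rfl (E.incl_j _ _),
        E.Q.mul_one' _ _ (by simp [E.j_tgt])])).choose_spec

lemma conj_eq {U : C} (a : U ⟶ E.H.arr) (g g' : LocallyConstant (𝒢.space.obj U) G)
    (m m' : U ⟶ M) (hm : m = a ≫ E.H.src) (hm' : m' = a ≫ E.H.tgt)
    (h : E.H.mul (E.incl m g') a (by rw [E.incl_tgt, hm]) =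
      E.H.mul a (E.incl m' g) (by rw [E.incl_src, hm'])) : E.conj a g = g' := by
  subst hm hm'
  exact E.diff_unique _ _ a rfl _ _ ((E.conj_spec a g).trans h.symm)

lemma conj_spec' {U : C} (a : U ⟶ E.H.arr) (g : LocallyConstant (𝒢.space.obj U) G)
    (m m' : U ⟶ M) (hm : m = a ≫ E.H.src) (hm' : m' = a ≫ E.H.tgt) :
    E.H.mul (E.incl m (E.conj a g)) a (by rw [E.incl_tgt, hm]) =
      E.H.mul a (E.incl m' g) (by rw [E.incl_src, hm']) := by
  subst hm hm'
  exact E.conj_spec a g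

lemma conj_comap {U V : C} (f : V ⟶ U) (a : U ⟶ E.H.arr)
    (g : LocallyConstant (𝒢.space.obj U) G) :
    E.conj (f ≫ a) (g.comap (𝒢.space.map f).hom) =
      (E.conj a g).comap (𝒢.space.map f).hom := by
  refine E.conj_eq _ _ _ (f ≫ a ≫ E.H.src) (f ≫ a ≫ E.H.tgt) (by simp) (by simp) ?_
  rw [E.H.mul_congr (E.comp_incl _ _ _).symm rfl, E.H.mul_congr rfl (E.comp_incl _ _ _).symm,
    ← E.H.comp_mul _ _ _ (by rw [E.incl_tgt]), ← E.H.comp_mul _ _ _ (by rw [E.incl_src]),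
    E.conj_spec]

lemma conj_mul {U : C} (a : U ⟶ E.H.arr) (g g' : LocallyConstant (𝒢.space.obj U) G) :
    E.conj a (g * g') = E.conj a g * E.conj a g' := by
  refine E.conj_eq _ _ _ _ _ rfl rfl ?_
  rw [E.H.mul_congr (E.incl_mul _ _ _) rfl, E.H.mul_congr rfl (E.incl_mul _ _ _),
    E.H.mul_assoc _ _ _ _ (by rw [E.incl_tgt]), E.H.mul_congr rfl (E.conj_spec a g'),
    ← E.H.mul_assoc _ _ _ (by rw [E.incl_tgt]), E.H.mul_congr (E.conj_spec a g) rfl,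
    E.H.mul_assoc]

lemma conj_mul_left {U : C} (a b : U ⟶ E.H.arr) (h : a ≫ E.H.tgt = b ≫ E.H.src)
    (g : LocallyConstant (𝒢.space.obj U) G) :
    E.conj (E.H.mul a b h) g = E.conj a (E.conj b g) := by
  refine E.conj_eq _ _ _ _ _ (E.H.mul_src _ _ _).symm (E.H.mul_tgt _ _ _).symm ?_
  rw [← E.H.mul_assoc _ _ _ (by rw [E.incl_tgt]), E.H.mul_congr (E.conj_spec _ _) rfl,
    E.H.mul_assoc _ _ _ _ (by rw [E.incl_tgt, h]), E.H.mul_assoc]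
  exact E.H.mul_congr rfl (E.conj_spec' _ _ _ _ h rfl) _

lemma conj_incl {U : C} (m : U ⟶ M) (k g : LocallyConstant (𝒢.space.obj U) G) :
    E.conj (E.incl m k) g = k * g * k⁻¹ := by
  refine E.conj_eq _ _ _ m m (E.incl_src _ _).symm (E.incl_tgt _ _).symm ?_
  rw [← E.incl_mul, ← E.incl_mul]; simp

lemma conj_injective {U : C} (a : U ⟶ E.H.arr) : Function.Injective (E.conj a) := by
  intro g g' h
  refine E.incl_injective _ (E.H.mul_left_cancel _ _
    ((E.conj_spec a g).symm.trans (Eq.trans ?_ (E.conj_spec a g'))))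
  rw [h]

lemma conj_apply {U : C} (a : U ⟶ E.H.arr) (g : LocallyConstant (𝒢.space.obj U) G)
    (x : 𝒢.space.obj U) : E.conj a g x = E.conj a (.const _ (g x)) x := by
  obtain ⟨V, f, -, ⟨y, rfl⟩, hf⟩ := 𝒢.exists_nhd U x (g ⁻¹' {g x}) (g.isLocallyConstant _) rfl
  have e : g.comap (𝒢.space.map f).hom =
      (LocallyConstant.const _ (g (𝒢.space.map f y))).comap (𝒢.space.map f).hom := by
    ext z
    exact hf ⟨z, rfl⟩
  have h₁ := congrArg (fun k => k y) (E.conj_comap f a g)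
  have h₂ := congrArg (fun k => k y) (E.conj_comap f a (.const _ (g (𝒢.space.map f y))))
  rw [e] at h₁
  exact h₁.symm.trans h₂

lemma conj_const_injective {U : C} (a : U ⟶ E.H.arr) (x : 𝒢.space.obj U) :
    Function.Injective fun g : G => E.conj a (.const _ g) x := by
  intro g g' h
  have ho : IsOpen {y | E.conj a (.const _ g) y = E.conj a (.const _ g') y} := by
    have := ((E.conj a (.const _ g)).isLocallyConstant.prodMk
      (E.conj a (.const _ g')).isLocallyConstant) {p | p.1 = p.2}
    exact this
  obtain ⟨V, f, -, ⟨y, rfl⟩, hf⟩ := 𝒢.exists_nhd U x _ ho h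
  have := E.conj_injective (f ≫ a)
    (a₁ := (LocallyConstant.const _ g).comap (𝒢.space.map f).hom)
    (a₂ := (LocallyConstant.const _ g').comap (𝒢.space.map f).hom) (by
      rw [E.conj_comap, E.conj_comap]
      ext z
      exact hf ⟨z, rfl⟩)
  exact congrArg (fun k => k y) this

lemma tau_exists {U : C} (p q : U ⟶ E.Q.arr) (h : p ≫ E.Q.tgt = q ≫ E.Q.src) :
    ∃ g, E.H.mul (E.incl ((E.Q.mul p q h ≫ E.sec) ≫ E.H.src) g) (E.Q.mul p q h ≫ E.sec)
        (by rw [E.incl_tgt]) =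
      E.H.mul (p ≫ E.sec) (q ≫ E.sec) (by simp [E.sec_src, E.sec_tgt, h]) := by
  refine E.exists_diff _ _ ?_
  rw [E.mul_j]
  simp [E.sec_j]

/-- `τ(p, q) = σ(p) σ(q) σ(p q)⁻¹`, where `σ = sec`; it takes values in `G`. -/
def tau {U : C} (p q : U ⟶ E.Q.arr) (h : p ≫ E.Q.tgt = q ≫ E.Q.src) :
    LocallyConstant (𝒢.space.obj U) G := (E.tau_exists p q h).choose

lemma tau_spec {U : C} (p q : U ⟶ E.Q.arr) (h : p ≫ E.Q.tgt = q ≫ E.Q.src) :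
    E.H.mul (E.incl (p ≫ E.Q.src) (E.tau p q h)) (E.Q.mul p q h ≫ E.sec)
        (by rw [E.incl_tgt, Category.assoc, E.sec_src, E.Q.mul_src]) =
      E.H.mul (p ≫ E.sec) (q ≫ E.sec) (by simp [E.sec_src, E.sec_tgt, h]) := by
  rw [← (E.tau_exists p q h).choose_spec]
  exact E.H.mul_congr (congrArg (E.incl · (E.tau p q h))
    (by rw [Category.assoc, E.sec_src, E.Q.mul_src])) rfl _

lemma tau_eq {U : C} (p q : U ⟶ E.Q.arr) (h : p ≫ E.Q.tgt = q ≫ E.Q.src)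
    (g : LocallyConstant (𝒢.space.obj U) G)
    (e : E.H.mul (E.incl (p ≫ E.Q.src) g) (E.Q.mul p q h ≫ E.sec)
        (by rw [E.incl_tgt, Category.assoc, E.sec_src, E.Q.mul_src]) =
      E.H.mul (p ≫ E.sec) (q ≫ E.sec) (by simp [E.sec_src, E.sec_tgt, h])) :
    E.tau p q h = g :=
  E.diff_unique _ _ _ rfl _ _ ((E.tau_spec p q h).trans e.symm)

lemma tau_comap {U V : C} (f : V ⟶ U) (p q : U ⟶ E.Q.arr) (h : p ≫ E.Q.tgt = q ≫ E.Q.src) :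
    E.tau (f ≫ p) (f ≫ q) (by simp [h]) = (E.tau p q h).comap (𝒢.space.map f).hom := by
  refine E.tau_eq _ _ _ _ ?_
  have e := congrArg (f ≫ ·) (E.tau_spec p q h)
  simp only [E.H.comp_mul] at e
  refine (E.H.mul_congr ?_ ?_ _).trans (e.trans (E.H.mul_congr ?_ ?_ _))
  · rw [E.comp_incl, Category.assoc]
  · rw [← E.Q.comp_mul _ _ _ h, Category.assoc]
  · rw [Category.assoc]
  · rw [Category.assoc]

lemma tau_one_left {U : C} (m : U ⟶ M) (q : U ⟶ E.Q.arr) (h : m = q ≫ E.Q.src) :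
    E.tau (m ≫ E.Q.one) q (by simp [h, E.Q.one_tgt]) = 1 := by
  refine E.tau_eq _ _ _ _ ?_
  refine E.H.mul_congr ?_ ?_ _
  · rw [E.incl_one]; simp [E.Q.one_src, E.one_sec]
  · rw [E.Q.one_mul' _ _ h]

lemma tau_one_right {U : C} (m : U ⟶ M) (q : U ⟶ E.Q.arr) (h : m = q ≫ E.Q.tgt) :
    E.tau q (m ≫ E.Q.one) (by simp [h, E.Q.one_src]) = 1 := by
  refine E.tau_eq _ _ _ _ ?_
  rw [E.H.mul_congr (E.incl_one _) rfl, E.H.one_mul' _ _ (by rw [Category.assoc, E.sec_src, E.Q.mul_src]),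
    E.H.mul_congr (rfl : q ≫ E.sec = _)
      (show (m ≫ E.Q.one) ≫ E.sec = m ≫ E.H.one by rw [Category.assoc, E.one_sec]),
    E.H.mul_one' _ _ (by simp [h, E.sec_tgt]), E.Q.mul_one' _ _ h]

lemma tau_cocycle {U : C} (p q r : U ⟶ E.Q.arr) (h : p ≫ E.Q.tgt = q ≫ E.Q.src)
    (h' : q ≫ E.Q.tgt = r ≫ E.Q.src) :
    E.tau p q h * E.tau (E.Q.mul p q h) r (by rw [E.Q.mul_tgt, h']) =
      E.conj (p ≫ E.sec) (E.tau q r h') *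
        E.tau p (E.Q.mul q r h') (by rw [E.Q.mul_src, h]) := by
  have hs : ∀ a : U ⟶ E.Q.arr, (a ≫ E.sec) ≫ E.H.src = a ≫ E.Q.src := fun a => by
    rw [Category.assoc, E.sec_src]
  have ht : ∀ a : U ⟶ E.Q.arr, (a ≫ E.sec) ≫ E.H.tgt = a ≫ E.Q.tgt := fun a => by
    rw [Category.assoc, E.sec_tgt]
  have e₁ := E.tau_spec p q h
  have e₂ := E.tau_spec q r h'
  have e₃ := E.tau_spec (E.Q.mul p q h) r (by rw [E.Q.mul_tgt, h'])
  have e₄ := E.tau_spec p (E.Q.mul q r h') (by rw [E.Q.mul_src, h])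
  have e₅ := E.conj_spec' (p ≫ E.sec) (E.tau q r h') (p ≫ E.Q.src) (q ≫ E.Q.src)
    (hs _).symm (by rw [ht, h])
  refine E.diff_unique (p ≫ E.Q.src) (p ≫ E.Q.src)
    (E.Q.mul (E.Q.mul p q h) r (by rw [E.Q.mul_tgt, h']) ≫ E.sec) rfl
    (by rw [E.incl_tgt, hs, E.Q.mul_src, E.Q.mul_src])
    (by rw [E.incl_tgt, hs, E.Q.mul_src, E.Q.mul_src]) ?_
  rw [E.H.mul_congr (E.incl_mul _ _ _) rfl, E.H.mul_congr (E.incl_mul _ _ _) rfl,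
    E.H.mul_assoc _ _ _ _ (by rw [E.incl_tgt, hs, E.Q.mul_src, E.Q.mul_src]),
    E.H.mul_assoc _ _ _ _ (by rw [E.incl_tgt, hs, E.Q.mul_src, E.Q.mul_src])]
  have e₃' : E.H.mul (E.incl (p ≫ E.Q.src) (E.tau (E.Q.mul p q h) r (by rw [E.Q.mul_tgt, h'])))
      (E.Q.mul (E.Q.mul p q h) r (by rw [E.Q.mul_tgt, h']) ≫ E.sec)
      (by rw [E.incl_tgt, hs, E.Q.mul_src, E.Q.mul_src]) =
      E.H.mul (E.Q.mul p q h ≫ E.sec) (r ≫ E.sec) (by rw [hs, ht, E.Q.mul_tgt, h']) := by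
    rw [← e₃]; exact E.H.mul_congr (by rw [E.Q.mul_src]) rfl _
  have e₄' : E.H.mul (E.incl (p ≫ E.Q.src) (E.tau p (E.Q.mul q r h') (by rw [E.Q.mul_src, h])))
      (E.Q.mul (E.Q.mul p q h) r (by rw [E.Q.mul_tgt, h']) ≫ E.sec)
      (by rw [E.incl_tgt, hs, E.Q.mul_src, E.Q.mul_src]) =
      E.H.mul (p ≫ E.sec) (E.Q.mul q r h' ≫ E.sec) (by rw [hs, ht, E.Q.mul_src, h]) := by
    rw [← e₄]; exact E.H.mul_congr rfl (by rw [E.Q.mul_assoc _ _ _ h h']) _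
  rw [E.H.mul_congr rfl e₃', E.H.mul_congr rfl e₄',
    ← E.H.mul_assoc _ _ _ (by rw [E.incl_tgt, hs, E.Q.mul_src]) (by rw [hs, ht, E.Q.mul_tgt, h']),
    ← E.H.mul_assoc _ _ _ (by rw [E.incl_tgt, hs]) (by rw [hs, ht, E.Q.mul_src, h]),
    E.H.mul_congr e₁ rfl, E.H.mul_congr e₅ rfl,
    E.H.mul_assoc _ _ _ (by rw [hs, ht, h]) (by rw [hs, ht, h']),
    E.H.mul_assoc _ _ _ (by rw [ht, E.incl_src, h])
      (by rw [E.incl_tgt, hs, E.Q.mul_src])]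
  exact E.H.mul_congr rfl e₂.symm _

variable [Finite G]

/-- The automorphism `g ↦ a g a⁻¹` of `G` at the point `x`. -/
def ad {U : C} (a : U ⟶ E.H.arr) (x : 𝒢.space.obj U) : MulAut G :=
  MulEquiv.ofBijective
    (MonoidHom.mk' (fun g => E.conj a (.const _ g) x) fun g g' =>
      congrArg (fun k => k x) (E.conj_mul a (.const _ g) (.const _ g')))
    (Finite.injective_iff_bijective.1 (E.conj_const_injective a x))

lemma ad_apply {U : C} (a : U ⟶ E.H.arr) (x : 𝒢.space.obj U)
    (g : LocallyConstant (𝒢.space.obj U) G) : E.ad a x (g x) = E.conj a g x :=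
  (E.conj_apply a g x).symm

lemma ad_const {U : C} (a : U ⟶ E.H.arr) (x : 𝒢.space.obj U) (g : G) :
    E.ad a x g = E.conj a (.const _ g) x := rfl

lemma ad_comp {U V : C} (f : V ⟶ U) (a : U ⟶ E.H.arr) (y : 𝒢.space.obj V) :
    E.ad (f ≫ a) y = E.ad a (𝒢.space.map f y) := by
  ext g
  exact congrArg (fun k => k y) (E.conj_comap f a (.const _ g))

lemma ad_mul {U : C} (a b : U ⟶ E.H.arr) (h : a ≫ E.H.tgt = b ≫ E.H.src)
    (x : 𝒢.space.obj U) : E.ad (E.H.mul a b h) x = E.ad a x * E.ad b x := by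
  ext g
  rw [ad_const, conj_mul_left, MulAut.mul_apply, ad_const, ad_const]
  exact E.conj_apply _ _ _

lemma ad_incl {U : C} (m : U ⟶ M) (k : LocallyConstant (𝒢.space.obj U) G)
    (x : 𝒢.space.obj U) : E.ad (E.incl m k) x = MulAut.conj (k x) := by
  ext g
  rw [ad_const, conj_incl]; rfl

lemma ad_one {U : C} (m : U ⟶ M) (x : 𝒢.space.obj U) : E.ad (m ≫ E.H.one) x = 1 := by
  rw [← incl_one, ad_incl]; exact map_one _

lemma isLocallyConstant_ad {U : C} (a : U ⟶ E.H.arr) : IsLocallyConstant (E.ad a) := by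
  rw [IsLocallyConstant.iff_exists_open]
  intro x
  refine ⟨⋂ g : G, {y | E.conj a (.const _ g) y = E.conj a (.const _ g) x},
    isOpen_iInter_of_finite fun g => (E.conj a (.const _ g)).isLocallyConstant {_}, by simp, ?_⟩
  intro y hy
  ext g
  exact Set.mem_iInter.1 hy g

lemma ad_tau {U : C} (p q : U ⟶ E.Q.arr) (h : p ≫ E.Q.tgt = q ≫ E.Q.src)
    (x : 𝒢.space.obj U) :
    E.ad (p ≫ E.sec) x * E.ad (q ≫ E.sec) x =
      MulAut.conj (E.tau p q h x) * E.ad (E.Q.mul p q h ≫ E.sec) x := by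
  rw [← E.ad_mul _ _ (by simp [E.sec_src, E.sec_tgt, h]), ← E.tau_spec p q h, E.ad_mul, E.ad_incl]

variable {D : UnitaryDual G} (T : Intertwiners D)

/-- The `U(1)`-valued cocycle `c` on `M × Ĝ ⋊ Q`, determined by
`T_q T_p = c(p, q) T_{pq} ρ_i(τ(p, q))⁻¹` on `V i`, where `T_q = T_{Ad σ(q)}`. -/
def cocycle {U : C} (i : D.Idx) (p q : U ⟶ E.Q.arr) (h : p ≫ E.Q.tgt = q ≫ E.Q.src) :
    LocallyConstant (𝒢.space.obj U) Circle where
  toFun x := T.scalar i (E.ad (p ≫ E.sec) x) (E.ad (q ≫ E.sec) x)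
    (E.ad (E.Q.mul p q h ≫ E.sec) x) (E.tau p q h x)
  isLocallyConstant :=
    ((((E.isLocallyConstant_ad (p ≫ E.sec)).prodMk (E.isLocallyConstant_ad (q ≫ E.sec))).prodMk
      (E.isLocallyConstant_ad (E.Q.mul p q h ≫ E.sec))).prodMk
        (E.tau p q h).isLocallyConstant).comp
      fun y => T.scalar i y.1.1.1 y.1.1.2 y.1.2 y.2

lemma cocycle_comp {U V : C} (f : V ⟶ U) (i : D.Idx) (p q : U ⟶ E.Q.arr)
    (h : p ≫ E.Q.tgt = q ≫ E.Q.src) (y : 𝒢.space.obj V) :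
    E.cocycle T i (f ≫ p) (f ≫ q) (by simp [h]) y = E.cocycle T i p q h (𝒢.space.map f y) := by
  change T.scalar i _ _ _ _ = T.scalar i _ _ _ _
  rw [E.tau_comap f p q h, ← E.Q.comp_mul f p q h]
  simp only [Category.assoc, E.ad_comp]
  rfl

lemma cocycle_one_left {U : C} (i : D.Idx) (m : U ⟶ M) (q : U ⟶ E.Q.arr)
    (h : m = q ≫ E.Q.src) (x : 𝒢.space.obj U) :
    E.cocycle T i (m ≫ E.Q.one) q (by simp [h, E.Q.one_tgt]) x = 1 := by
  change T.scalar i _ _ _ _ = 1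
  rw [E.tau_one_left m q h, E.Q.one_mul' m q h, Category.assoc, E.one_sec, E.ad_one]
  exact T.scalar_one_left i _

lemma cocycle_one_right {U : C} (i : D.Idx) (m : U ⟶ M) (q : U ⟶ E.Q.arr)
    (h : m = q ≫ E.Q.tgt) (x : 𝒢.space.obj U) :
    E.cocycle T i q (m ≫ E.Q.one) (by simp [h, E.Q.one_src]) x = 1 := by
  change T.scalar i _ _ _ _ = 1
  rw [E.tau_one_right m q h, E.Q.mul_one' m q h, Category.assoc m, E.one_sec, E.ad_one]
  exact T.scalar_one_right i _

/-- The cocycle identity for `c`. -/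
theorem cocycle_mul {U : C} (i k : D.Idx) (p q r : U ⟶ E.Q.arr)
    (h : p ≫ E.Q.tgt = q ≫ E.Q.src) (h' : q ≫ E.Q.tgt = r ≫ E.Q.src)
    (x : 𝒢.space.obj U) (hk : T.act (E.ad (p ≫ E.sec) x) i = k) :
    E.cocycle T k q r h' x * E.cocycle T i p (E.Q.mul q r h') (by rw [E.Q.mul_src, h]) x =
      E.cocycle T i (E.Q.mul p q h) r (by rw [E.Q.mul_tgt, h']) x * E.cocycle T i p q h x := by
  subst hk
  have e := E.ad_tau p (E.Q.mul q r h') (by rw [E.Q.mul_src, h]) x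
  have e' := congrArg (fun k => k x) (E.tau_cocycle p q r h h')
  change _ = E.conj _ _ x * _ at e'
  rw [← E.ad_apply] at e'
  change T.scalar _ _ _ _ _ * T.scalar _ _ _ _ _ = T.scalar _ _ _ _ _ * T.scalar _ _ _ _ _
  rw [E.Q.mul_assoc _ _ _ h h']
  exact T.scalar_cocycle i (E.ad_tau p q h x) (E.ad_tau q r h' x)
    (by rw [E.ad_tau _ _ (by rw [E.Q.mul_tgt, h']), E.Q.mul_assoc _ _ _ h h']) e e'

end GerbeExtension


section Sites
variable {C : Type u} [Category.{v} C] {𝒢 : Geometry C}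

/-- The families of morphisms which are jointly surjective on points. -/
def jointlySurjective (𝒢 : Geometry C) {S : Type*} [Category* S] (π : S ⥤ C) : Precoverage S where
  coverings X := {R | ∀ x : 𝒢.space.obj (π.obj X), ∃ (Y : S) (f : Y ⟶ X),
    R f ∧ x ∈ Set.range (𝒢.space.map (π.map f))}

/-- The Grothendieck topology generated by the jointly surjective families. -/
def etaleTopology (𝒢 : Geometry C) {S : Type*} [Category* S] (π : S ⥤ C) :
    GrothendieckTopology S := (jointlySurjective 𝒢 π).toGrothendieck

/-- The objects of the small étale site of the stack `[M / X]` presented by an étale groupoid `X`: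
étale morphisms `U → M`, regarded as étale morphisms `U → M → [M / X]`. Every étale morphism to
the stack is covered by these. -/
structure Chart {M : C} (X : EtaleGroupoid 𝒢 M) where
  dom : C
  map : dom ⟶ M
  etale : 𝒢.isEtale map

namespace Chart
variable {M : C} {X : EtaleGroupoid 𝒢 M}

/-- A morphism over the stack `[M / X]`: a morphism `U → V` and a 2-isomorphism, which is an arrow of
the groupoid over `U`, from the point `U → M` to the point `U → V → M`. -/
@[ext]
structure Hom (U V : Chart X) where
  hom : U.dom ⟶ V.dom
  arr : U.dom ⟶ X.arr
  arr_src : arr ≫ X.src = U.map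
  arr_tgt : arr ≫ X.tgt = hom ≫ V.map

instance : Category (Chart X) where
  Hom := Hom
  id U :=
    { hom := 𝟙 _
      arr := U.map ≫ X.one
      arr_src := by simp [X.one_src]
      arr_tgt := by simp [X.one_tgt] }
  comp {U V W} a b :=
    { hom := a.hom ≫ b.hom
      arr := X.mul a.arr (a.hom ≫ b.arr) (by simp [a.arr_tgt, b.arr_src])
      arr_src := by simp [X.mul_src, a.arr_src]
      arr_tgt := by simp [X.mul_tgt, b.arr_tgt] }
  id_comp a := Hom.ext (by simp) <| by
    simpa using X.one_mul' _ a.arr a.arr_src.symm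
  comp_id a := Hom.ext (by simp) <| by
    simpa using X.mul_one' _ a.arr a.arr_tgt.symm
  assoc a b c := Hom.ext (by simp) <| by
    simp only [X.comp_mul, Category.assoc]
    exact X.mul_assoc _ _ _ _ _

/-- The underlying geometric object of a chart. -/
def forget (X : EtaleGroupoid 𝒢 M) : Chart X ⥤ C where
  obj U := U.dom
  map a := a.hom

end Chart

variable {G : Type} [Group G] [Finite G] {M : C}

/-- The objects of the small étale site of the `U(1)`-gerbe on the dual stack `Ŷ = [(M × Ĝ) / Q]`
defined by the cocycle `c`: étale morphisms `U → M` together with a class `i : Ĝ`, regarded as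
étale morphisms `U → M × {i} ⊆ M × Ĝ`. Every étale morphism to `Ŷ` is covered by these. -/
structure DualChart (E : GerbeExtension 𝒢 G M) {D : UnitaryDual G} (T : Intertwiners D) where
  dom : C
  map : dom ⟶ M
  etale : 𝒢.isEtale map
  idx : D.Idx

namespace DualChart
variable {E : GerbeExtension 𝒢 G M} {D : UnitaryDual G} {T : Intertwiners D}

/-- A morphism over the `U(1)`-gerbe: a morphism `U → V`, an arrow of the transformation groupoid
`(M × Ĝ) ⋊ Q` over `U` joining the points `U → M × Ĝ` and `U → V → M × Ĝ`, and a locally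
constant phase. Phases are multiplied in a composition, together with the value of `c`. -/
@[ext]
structure Hom (U V : DualChart E T) where
  hom : U.dom ⟶ V.dom
  arr : U.dom ⟶ E.Q.arr
  arr_src : arr ≫ E.Q.src = U.map
  arr_tgt : arr ≫ E.Q.tgt = hom ≫ V.map
  act_idx : ∀ x : 𝒢.space.obj U.dom, T.act (E.ad (arr ≫ E.sec) x) U.idx = V.idx
  phase : LocallyConstant (𝒢.space.obj U.dom) Circle

instance : Category (DualChart E T) where
  Hom := Hom
  id U :=
    { hom := 𝟙 _
      arr := U.map ≫ E.Q.one
      arr_src := by simp [E.Q.one_src]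
      arr_tgt := by simp [E.Q.one_tgt]
      act_idx := fun x => by
        rw [Category.assoc, E.one_sec, E.ad_one]
        exact congrArg Sigma.fst (T.T_one U.idx 0)
      phase := 1 }
  comp {U V W} a b :=
    { hom := a.hom ≫ b.hom
      arr := E.Q.mul a.arr (a.hom ≫ b.arr) (by simp [a.arr_tgt, b.arr_src])
      arr_src := by simp [E.Q.mul_src, a.arr_src]
      arr_tgt := by simp [E.Q.mul_tgt, b.arr_tgt]
      act_idx := fun x => by
        rw [← T.act_act (E.ad_tau _ _ _ x), a.act_idx, Category.assoc, E.ad_comp, b.act_idx]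
      phase := E.cocycle T U.idx a.arr (a.hom ≫ b.arr) (by simp [a.arr_tgt, b.arr_src]) *
        (a.phase * b.phase.comap (𝒢.space.map a.hom).hom) }
  id_comp {U V} a := by
    refine Hom.ext (by simp) ?_ ?_
    · simpa using E.Q.one_mul' _ a.arr a.arr_src.symm
    · ext x
      have e := E.cocycle_one_left T U.idx U.map a.arr a.arr_src.symm x
      simp only [Category.id_comp, LocallyConstant.mul_apply, e]
      simp
  comp_id {U V} a := by
    refine Hom.ext (by simp) ?_ ?_
    · simpa using E.Q.mul_one' _ a.arr a.arr_tgt.symm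
    · ext x
      have e := E.cocycle_one_right T U.idx _ a.arr a.arr_tgt.symm x
      simp only [← Category.assoc, LocallyConstant.mul_apply, e]
      simp
  assoc {U V W Z} a b c := by
    refine Hom.ext (by simp) ?_ ?_
    · simp only [E.Q.comp_mul, Category.assoc]
      exact E.Q.mul_assoc _ _ _ _ _
    · refine LocallyConstant.ext fun x => ?_
      have e := E.cocycle_mul T U.idx V.idx a.arr (a.hom ≫ b.arr) ((a.hom ≫ b.hom) ≫ c.arr)
        (by simp [a.arr_tgt, b.arr_src]) (by simp [b.arr_tgt, c.arr_src]) x (a.act_idx x)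
      have e' := E.cocycle_comp T a.hom V.idx b.arr (b.hom ≫ c.arr)
        (by simp [b.arr_tgt, c.arr_src]) x
      simp only [← Category.assoc] at e'
      simp only [LocallyConstant.mul_apply, LocallyConstant.coe_comap, Function.comp_apply,
        E.Q.comp_mul, ← Category.assoc]
      change _ * (_ * (_ * _) * _) = _ * (_ * (E.cocycle T V.idx b.arr (b.hom ≫ c.arr) _
        (𝒢.space.map a.hom x) * (_ * _)))
      rw [← e', 𝒢.space.map_comp]
      have key : ∀ s t u w k l m : Circle, s * t = u * w →
          u * (w * (k * l) * m) = t * (k * (s * (l * m))) := fun s t u w k l m h => by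
        rw [show u * (w * (k * l) * m) = (u * w) * (k * l * m) by
          simp only [_root_.mul_assoc], ← h]
        simp only [_root_.mul_comm, _root_.mul_left_comm]
      exact key _ _ _ _ _ _ _ e

/-- The underlying geometric object of a chart. -/
def forget (E : GerbeExtension 𝒢 G M) {D : UnitaryDual G} (T : Intertwiners D) :
    DualChart E T ⥤ C where
  obj U := U.dom
  map a := a.hom

/-- The central automorphism of phase `z`. -/
def central (U : DualChart E T) (z : Circle) : U ⟶ U :=
  { (𝟙 U : Hom U U) with phase := .const _ z }

end DualChart

/-- The chart `U → M → M × {i}` of the dual. -/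
abbrev Chart.toDual {E : GerbeExtension 𝒢 G M} {D : UnitaryDual G} (T : Intertwiners D)
    (U : Chart E.H) (i : D.Idx) : DualChart E T := ⟨U.dom, U.map, U.etale, i⟩

/-- The morphism of the dual, of phase one, defined by a morphism `a` of charts of the gerbe along
which `Ad_{σ(j(a))}` is constantly `ν`. -/
def Chart.Hom.toDual {E : GerbeExtension 𝒢 G M} {D : UnitaryDual G} {T : Intertwiners D}
    {U V : Chart E.H} (a : U ⟶ V) (ν : MulAut G)
    (h : ∀ x : 𝒢.space.obj U.dom, E.ad ((a.arr ≫ E.j) ≫ E.sec) x = ν) (i : D.Idx) :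
    U.toDual T i ⟶ V.toDual T (T.act ν i) where
  hom := a.hom
  arr := a.arr ≫ E.j
  arr_src := by simpa [E.j_src] using a.arr_src
  arr_tgt := by simpa [E.j_tgt] using a.arr_tgt
  act_idx x := by rw [h x]
  phase := 1

end Sites


section Modules
open TensorProduct
variable {C : Type u} [Category.{v} C] {𝒢 : Geometry C}

/-- A presheaf of commutative `ℂ`-algebras on `C`. -/
structure AlgebraPresheaf (C : Type u) [Category.{v} C] where
  ring : Cᵒᵖ ⥤ CommRingCat.{0}
  scalars : (Functor.const Cᵒᵖ).obj (CommRingCat.of ℂ) ⟶ ring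

/-- The constant presheaf `ℂ`; modules over it are presheaves of `ℂ`-vector spaces. -/
def constantAlgebra (C : Type u) [Category.{v} C] : AlgebraPresheaf C where
  ring := (Functor.const Cᵒᵖ).obj (CommRingCat.of ℂ)
  scalars := 𝟙 _

/-- Presheaves of modules over the restriction of `𝒪` to a site `S` of charts. -/
abbrev Modules (𝒪 : AlgebraPresheaf C) {S : Type*} [Category* S] (π : S ⥤ C) :=
  PresheafOfModules.{0} ((π.op ⋙ 𝒪.ring) ⋙ forget₂ CommRingCat RingCat)

variable {𝒪 : AlgebraPresheaf C} {S : Type*} [Category* S] {π : S ⥤ C}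

/-- The module of sections over `U`. -/
abbrev Modules.sections (F : Modules 𝒪 π) (U : S) : ModuleCat (𝒪.ring.obj (op (π.obj U))) :=
  F.obj (op U)

/-- The restriction map of `F` along `f`. -/
abbrev Modules.res (F : Modules 𝒪 π) {U V : S} (f : U ⟶ V) (s : F.sections V) : F.sections U :=
  F.map f.op s

/-- The sections over `U`, as a complex vector space. -/
abbrev Modules.complexSections (F : Modules 𝒪 π) (U : S) : ModuleCat ℂ :=
  (ModuleCat.restrictScalars (𝒪.scalars.app (op (π.obj U))).hom).obj (F.sections U)

/-- The action of functions on sections. -/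
abbrev Modules.scale (F : Modules 𝒪 π) {U : S} (r : 𝒪.ring.obj (op (π.obj U)))
    (s : F.sections U) : F.sections U := r • s

/-- The sheaf condition for the étale topology. -/
def IsSheaf (𝒢 : Geometry C) (F : Modules 𝒪 π) : Prop :=
  Presheaf.IsSheaf (etaleTopology 𝒢 π) F.presheaf

/-- For all morphisms `f : U ⟶ V` between charts with the property `P`, the canonical map
`𝒪(U) ⊗_{𝒪(V)} F(V) → F(U)` is an isomorphism. -/
def IsCartesianOn (P : C → Prop) (F : Modules 𝒪 π) : Prop :=
  ∀ ⦃U V : S⦄ (f : U ⟶ V), P (π.obj U) → P (π.obj V) →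
    IsIso (((ModuleCat.extendRestrictScalarsAdj
      (𝒪.ring.map (π.map f).op).hom).homEquiv (F.sections V) (F.sections U)).symm (F.map f.op))

/-- A coherent module: it is finitely generated, and all its finitely generated submodules are finitely
presented. Over a noetherian ring this says that the module is finitely generated. -/
def IsCoherentModule (R N : Type) [CommRing R] [AddCommGroup N] [Module R N] : Prop :=
  Module.Finite R N ∧ ∀ K : Submodule R N, K.FG → Module.FinitePresentation R K

variable {G : Type} [Group G] [Finite G] {M : C} {E : GerbeExtension 𝒢 G M}
  {D : UnitaryDual G} {T : Intertwiners D}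

/-- The twisted sheaves: presheaves on the `U(1)`-gerbe of `c` on which the central `U(1)` acts with
weight one. Writing `q^` for the restriction along the arrow `q` with phase one, this says
`p^ ∘ q^ = c(p, q) (p q)^`. -/
def IsTwisted (W : Modules 𝒪 (DualChart.forget E T)) : Prop :=
  ∀ (U : DualChart E T) (z : Circle) (s : W.complexSections U),
    W.res (U.central z) s = (z : ℂ) • s

open Classical in
/-- The equivalence `e` is tensoring with the twisted sheaf with fibres `V_i`: naturally in the twisted
sheaf `W`, the sections of `e(W)` over a chart `U` are `⨁ i, W(U, i) ⊗ V_i`, compatibly with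
functions on `U`, and the arrow `h = g σ(q)` of `H` acts by `q^ ⊗ ρ_i(g) T_q⁻¹`. In particular `G`
acts through the `V_i`, so that `W(-, i) ⊗ V_i` is the `i`-isotypic part of `e(W)`. The charts on
which both `g` and `Ad_{σ(q)}` are constant cover all others, so the action is determined by them. -/
def IsTensorEquivalence {P : ObjectProperty (Modules 𝒪 (Chart.forget E.H))}
    {P' : ObjectProperty (Modules 𝒪 (DualChart.forget E T))}
    (e : P'.FullSubcategory ≌ P.FullSubcategory) : Prop :=
  ∃ θ : ∀ (W : P'.FullSubcategory) (U : Chart E.H) (i : D.Idx),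
      W.obj.complexSections (U.toDual T i) ⊗[ℂ] D.V i →ₗ[ℂ]
        (e.functor.obj W).obj.complexSections U,
    (∀ W U, Function.Bijective (DirectSum.toModule ℂ D.Idx _ (θ W U))) ∧
    (∀ W U i (r : 𝒪.ring.obj (op U.dom)) (w : W.obj.sections (U.toDual T i)) (v : D.V i),
      θ W U i (W.obj.scale r w ⊗ₜ v) =
        (e.functor.obj W).obj.scale r (θ W U i (w ⊗ₜ v))) ∧
    (∀ W W' (φ : W ⟶ W') U i (w : W.obj.sections (U.toDual T i)) (v : D.V i),
      (e.functor.map φ).hom.app (op U) (θ W U i (w ⊗ₜ v)) =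
        θ W' U i (φ.hom.app (op (U.toDual T i)) w ⊗ₜ v)) ∧
    (∀ (W : P'.FullSubcategory) (U V : Chart E.H) (a : U ⟶ V) (g : G) (ν : MulAut G)
      (_ : Chart.Hom.arr a =
        E.H.mul (E.incl U.map (.const _ g)) ((Chart.Hom.arr a ≫ E.j) ≫ E.sec)
          (by simp [E.incl_tgt, E.sec_src, E.j_src, Chart.Hom.arr_src a]))
      (hν : ∀ x : 𝒢.space.obj U.dom, E.ad ((Chart.Hom.arr a ≫ E.j) ≫ E.sec) x = ν)
      (i : D.Idx) (w : W.obj.sections (V.toDual T (T.act ν i))) (v : D.V (T.act ν i)),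
      (e.functor.obj W).obj.res a (θ W V (T.act ν i) (w ⊗ₜ v)) =
        θ W U i (W.obj.res (Chart.Hom.toDual a ν hν i) w ⊗ₜ D.rep i g ((T.T ν i).symm v)))

/-- Tensoring with the twisted sheaf `V` is an equivalence from `c`-twisted sheaves of `𝒪`-modules with
the property `P` on the dual of the gerbe to sheaves of `𝒪`-modules with the property `P` on the
gerbe. -/
def Duality (E : GerbeExtension 𝒢 G M) (T : Intertwiners D) (𝒪 : AlgebraPresheaf C)
    (P : ∀ {S : Type (max u v)} [Category.{v} S] {π : S ⥤ C}, Modules 𝒪 π → Prop) : Prop :=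
  ∃ e : ObjectProperty.FullSubcategory
          (fun W : Modules 𝒪 (DualChart.forget E T) => IsSheaf 𝒢 W ∧ IsTwisted W ∧ P W) ≌
        ObjectProperty.FullSubcategory
          (fun F : Modules 𝒪 (Chart.forget E.H) => IsSheaf 𝒢 F ∧ P F),
    IsTensorEquivalence e

end Modules

/-- Topological spaces and local homeomorphisms. -/
def topological : Geometry TopCat.{0} where
  isEtale := fun _ _ f => IsLocalHomeomorph f
  space := 𝟭 _
  exists_nhd U x N hN hx :=
    ⟨TopCat.of N, TopCat.ofHom ⟨Subtype.val, continuous_subtype_val⟩,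
      hN.isOpenEmbedding_subtypeVal.isLocalHomeomorph, ⟨⟨x, hx⟩, rfl⟩, by
        rintro _ ⟨y, rfl⟩; exact y.2⟩

/-- Schemes over `ℂ`. -/
abbrev ComplexScheme := Over (Spec (CommRingCat.of ℂ))

/-- Schemes over `ℂ` and étale morphisms. -/
def algebraic : Geometry ComplexScheme where
  isEtale := fun _ _ f => Etale f.left
  space := Over.forget _ ⋙ Scheme.forgetToTop
  exists_nhd U x N hN hx := by
    let W : U.left.Opens := ⟨N, hN⟩
    have hW : Set.range W.ι = N := Scheme.Opens.range_ι W
    exact ⟨Over.mk (W.ι ≫ U.hom), Over.homMk W.ι, (inferInstance : Etale W.ι),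
      (Set.ext_iff.1 hW x).2 hx, hW.le⟩

/-- The structure presheaf `U ↦ Γ(U, 𝒪_U)`. -/
def structureAlgebra : AlgebraPresheaf ComplexScheme where
  ring := (Over.forget _).op ⋙ Scheme.Γ
  scalars :=
    { app := fun U => (Scheme.ΓSpecIso (CommRingCat.of ℂ)).inv ≫ U.unop.hom.appTop
      naturality := fun U V f => by
        have : f.unop.left ≫ U.unop.hom = V.unop.hom := Over.w f.unop
        refine (Category.id_comp ((Scheme.ΓSpecIso (CommRingCat.of ℂ)).inv ≫
          V.unop.hom.appTop)).trans ?_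
        rw [← this, Scheme.Hom.comp_appTop]
        rfl }

/-- Quasi-coherence on an étale site of charts: restriction between affine charts is base change. -/
def IsQuasicoherent {S : Type*} [Category* S] {π : S ⥤ ComplexScheme}
    (F : Modules structureAlgebra π) : Prop :=
  IsCartesianOn (fun X => IsAffine X.left) F

/-- Coherence: quasi-coherent, with coherent modules of sections over affine charts. -/
def IsCoherent {S : Type*} [Category* S] {π : S ⥤ ComplexScheme}
    (F : Modules structureAlgebra π) : Prop :=
  IsQuasicoherent F ∧ ∀ U : S, IsAffine (π.obj U).left →
    IsCoherentModule (structureAlgebra.ring.obj (op (π.obj U))) (F.sections U)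

end GerbeDuality
end

open GerbeDuality

/-!
A twisted sheaf `W` on the dual corresponds to the sheaf on the gerbe with sections
`F(U) = ∏ i, Hom(V_i^*, W(U, i))`, that is, `⨁ i, W(U, i) ⊗ V_i`; conversely, a sheaf `F` on the
gerbe has on every chart `U` an action of `G`, and corresponds to the twisted sheaf of its
multiplicity spaces, `W(U, i) = Hom_G(V_i, F(U))`.

*Restrictions.* A morphism of charts contains an arrow `g σ(q)` of the groupoid, or an arrow `q` and
a phase, where `g`, `Ad_{σ(q)}` and the phase are only locally constant. Where they are constant the
restriction is given by a formula (`TensorSec.push`, `IsotypicSec.push`). The formulas are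
compatible with composition: the scalar by which the intertwiners fail to be multiplicative
(`Intertwiners.into_into`) is by definition the cocycle by which `W` is twisted. A presheaf which
satisfies the sheaf condition on étale objects over `M`, and whose restrictions are known locally on
the source, extends uniquely (`Atlas.LocalPresheaf.extend`). This uses only that étale morphisms
compose, cancel, and can be pulled back locally (`Geometry.IsRegular`), so that both geometries are
treated at once.

*Equivalence.* That the constructions are inverse to each other can be checked on the sections over
one chart, where it is the representation theory of the finite group `G` on an arbitrary complex
vector space. Schur orthogonality identifies `W(U, i)` with the multiplicity space of `V_i` in
`F(U)` (`unitMap_bijective`). The map from `F(U)` to `∏ i, Hom(V_i^*, Hom_G(V_i, F(U)))` is the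
Fourier transform, whose coefficients are averages over the group; it is injective because the
matrix coefficients are complete, and surjective by Schur orthogonality (`fourier_bijective`). Hence
the equivalence for any property of modules which both constructions preserve
(`duality_of_preserves`).

*Quasi-coherence and coherence.* Whether a restriction map is base change may be tested on basic
open subsets of its source (`isCartesianAt_of_local`), hence where the data of the morphism are
constant. There, in suitable bases of the `V_i`, the restriction of `F` is a finite direct sum of
restrictions of `W`, and each of these is, up to a nonzero scalar, a retract of it. Base change and
coherence of modules both pass to finite sums of retracts (`isBaseChange_of_retracts`,
`isCoherentModule_of_retracts`).
-/

open CategoryTheory AlgebraicGeometry Opposite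
noncomputable section
namespace GerbeDuality

/-! ### Fourier analysis on a finite group -/

attribute [local instance] Fintype.ofFinite

namespace UnitaryDual
set_option linter.unusedSectionVars false
variable {G : Type} [Group G] [Finite G] (D : UnitaryDual G)

/-- The operator `∑ g, ρ_k(g) (w ⊗ l) ρ_i(g)⁻¹` from `V i` to `V k`. -/
def average {i k : D.Idx} (l : Module.Dual ℂ (D.V i)) (w : D.V k) : D.V i →ₗ[ℂ] D.V k :=
  ∑ g : G, D.rep k g ∘ₗ l.smulRight w ∘ₗ D.rep i g⁻¹

lemma average_apply {i k : D.Idx} (l : Module.Dual ℂ (D.V i)) (w : D.V k) (v : D.V i) :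
    D.average l w v = ∑ g : G, l (D.rep i g⁻¹ v) • D.rep k g w := by
  simp [average, LinearMap.sum_apply]

lemma sum_translate {N : Type*} [AddCommGroup N] [Module ℂ N] (ρ : Representation ℂ G N)
    {i : D.Idx} (l : Module.Dual ℂ (D.V i)) (h : G) (v : D.V i) (n : N) :
    ∑ g : G, l (D.rep i g⁻¹ (D.rep i h v)) • ρ g n =
      ρ h (∑ g : G, l (D.rep i g⁻¹ v) • ρ g n) := by
  rw [map_sum]
  rw [← Equiv.sum_comp (Equiv.mulLeft h)]
  refine Finset.sum_congr rfl fun g _ => ?_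
  simp [← Module.End.mul_apply, ← map_mul]

lemma average_rep {i k : D.Idx} (l : Module.Dual ℂ (D.V i)) (w : D.V k) (h : G) (v : D.V i) :
    D.average l w (D.rep i h v) = D.rep k h (D.average l w v) := by
  simp only [average_apply]
  exact D.sum_translate (D.rep k) l h v w

/-- Schur orthogonality for inequivalent representations. -/
theorem average_eq_zero {i k : D.Idx} (h : i ≠ k) (l : Module.Dual ℂ (D.V i)) (w : D.V k) :
    D.average l w = 0 := by
  have := D.irreducible i
  have := D.irreducible k
  let f : (D.rep i).IntertwiningMap (D.rep k) :=
    ⟨D.average l w, fun g => LinearMap.ext (D.average_rep l w g)⟩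
  rcases Representation.IsIrreducible.bijective_or_eq_zero f with hf | hf
  · exact absurd (D.eq_of_equiv i k ⟨f.ofBijective hf⟩) h
  · exact congrArg (fun f => f.toLinearMap) hf

/-- The weight `dim V i / |G|`. -/
def weight (i : D.Idx) : ℂ := Module.finrank ℂ (D.V i) / Nat.card G

lemma finrank_ne_zero (i : D.Idx) : (Module.finrank ℂ (D.V i) : ℂ) ≠ 0 := by
  obtain ⟨v, hv⟩ := D.exists_ne_zero i
  have : Nontrivial (D.V i) := ⟨⟨v, 0, hv⟩⟩
  exact_mod_cast Module.finrank_pos.ne'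

lemma card_ne_zero : (Nat.card G : ℂ) ≠ 0 := by exact_mod_cast Nat.card_pos.ne'

lemma weight_ne_zero (i : D.Idx) : D.weight i ≠ 0 :=
  div_ne_zero (D.finrank_ne_zero i) card_ne_zero

/-- Schur orthogonality for a single representation; the scalar is found by taking the trace. -/
theorem average_self {i : D.Idx} (l : Module.Dual ℂ (D.V i)) (w v : D.V i) :
    D.average l w v = ((D.weight i)⁻¹ * l w) • v := by
  obtain ⟨z, hz⟩ := D.schur i _ (D.average_rep l w)
  have h₁ : LinearMap.trace ℂ _ (D.average l w) = z * Module.finrank ℂ (D.V i) := by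
    rw [show D.average l w = z • LinearMap.id from LinearMap.ext hz]
    simp
  have h₂ : LinearMap.trace ℂ _ (D.average l w) = Nat.card G * l w := by
    have : ∀ g : G, LinearMap.trace ℂ _ (D.rep i g ∘ₗ l.smulRight w ∘ₗ D.rep i g⁻¹) = l w := by
      intro g
      rw [LinearMap.trace_comp_comm', LinearMap.comp_assoc,
        show D.rep i g⁻¹ ∘ₗ D.rep i g = LinearMap.id by
          ext v; simp [← Module.End.mul_apply, ← map_mul]]
      simp
    simp [average, this]
  rw [hz v]
  congr 1
  have := D.finrank_ne_zero i
  have hc := card_ne_zero (G := G)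
  rw [h₁] at h₂
  rw [weight, inv_div]
  field_simp
  exact h₂

lemma exists_dual_eq_one {i : D.Idx} {v : D.V i} (hv : v ≠ 0) :
    ∃ l : Module.Dual ℂ (D.V i), l v = 1 := by
  by_contra! H
  have : ∀ l : Module.Dual ℂ (D.V i), l v = 0 := fun l => by
    by_contra h
    exact H ((l v)⁻¹ • l) (by simp [h])
  exact hv ((Module.forall_dual_apply_eq_zero_iff ℂ v).1 this)

/-- A vector of `V i` and a linear form on `V i` which takes the value `1` on it. -/
lemma exists_pair (i : D.Idx) : ∃ (l : Module.Dual ℂ (D.V i)) (v : D.V i), l v = 1 := by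
  obtain ⟨v, hv⟩ := D.exists_ne_zero i
  obtain ⟨l, hl⟩ := D.exists_dual_eq_one hv
  exact ⟨l, v, hl⟩

/-- A finite group has finitely many irreducible representations: their matrix coefficients are
linearly independent functions on the group. -/
instance finite_idx : Finite D.Idx := by
  choose l v hlv using D.exists_pair
  have key : LinearIndependent ℂ (fun i (g : G) => l i (D.rep i g⁻¹ (v i))) := by
    rw [linearIndependent_iff']
    intro s c hc k hk
    have h : ∑ g : G, (∑ i ∈ s, c i * l i (D.rep i g⁻¹ (v i))) • D.rep k g (v k) = 0 := by
      refine Finset.sum_eq_zero fun g _ => ?_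
      have := congrFun hc g
      simp only [Finset.sum_apply, Pi.smul_apply, smul_eq_mul, Pi.zero_apply] at this
      rw [this, zero_smul]
    simp only [Finset.sum_smul, mul_smul] at h
    rw [Finset.sum_comm] at h
    simp only [← Finset.smul_sum, ← average_apply] at h
    rw [Finset.sum_eq_single k (fun i _ hik => by rw [D.average_eq_zero hik]; simp)
      (fun h => absurd hk h), average_self, hlv] at h
    have hv : v k ≠ 0 := fun h0 => by simpa [h0] using hlv k
    simpa [hv, D.weight_ne_zero] using h
  exact key.finite

section Rep
variable {N : Type} [AddCommGroup N] [Module ℂ N] (ρ : Representation ℂ G N)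

/-- The Fourier coefficient `v ↦ ∑ g, l(ρ_i(g)⁻¹ v) g n` of `n`. -/
def coeff {i : D.Idx} (n : N) (l : Module.Dual ℂ (D.V i)) : D.V i →ₗ[ℂ] N :=
  ∑ g : G, (l ∘ₗ D.rep i g⁻¹).smulRight (ρ g n)

lemma coeff_apply {i : D.Idx} (n : N) (l : Module.Dual ℂ (D.V i)) (v : D.V i) :
    D.coeff ρ n l v = ∑ g : G, l (D.rep i g⁻¹ v) • ρ g n := by
  simp [coeff, LinearMap.sum_apply]

lemma coeff_rep {i : D.Idx} (n : N) (l : Module.Dual ℂ (D.V i)) (h : G) (v : D.V i) :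
    D.coeff ρ n l (D.rep i h v) = ρ h (D.coeff ρ n l v) := by
  simp only [coeff_apply]
  exact D.sum_translate ρ l h v n

variable (G) in
lemma finite_monoidAlgebra : Module.Finite ℂ (MonoidAlgebra ℂ G) :=
  Module.Finite.of_basis (MonoidAlgebra.basis G ℂ)

/-- Every simple module over the group algebra is one of the `V i`. -/
lemma exists_of_isSimpleModule (Q : Type) [AddCommGroup Q] [Module (MonoidAlgebra ℂ G) Q]
    [IsSimpleModule (MonoidAlgebra ℂ G) Q] : ∃ (i : D.Idx) (f : Q →+ D.V i),
    Function.Injective f ∧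
      ∀ g (z : ℂ) m, f (MonoidAlgebra.single g z • m) = z • D.rep i g (f m) := by
  let _ : Module ℂ Q := Module.compHom Q (algebraMap ℂ (MonoidAlgebra ℂ G))
  have : IsScalarTower ℂ (MonoidAlgebra ℂ G) Q :=
    ⟨fun z a q => by rw [Algebra.smul_def, mul_smul]; rfl⟩
  let σ : Representation ℂ G Q := Representation.ofModule' Q
  have hσ' : ∀ g (z : ℂ) q, MonoidAlgebra.single g z • q = z • σ g q := fun g z q => by
    rw [show MonoidAlgebra.single g z = algebraMap ℂ (MonoidAlgebra ℂ G) z *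
        MonoidAlgebra.single g 1 by simp, mul_smul]
    rfl
  have hσ : σ.IsIrreducible :=
    { exists_pair_ne := by
        obtain ⟨q, hq⟩ := @exists_ne _ (IsSimpleModule.nontrivial (MonoidAlgebra ℂ G) Q) (0 : Q)
        refine ⟨⟨⊥, by simp⟩, ⟨⊤, by simp⟩, fun h => hq ?_⟩
        have : q ∈ (⟨⊥, by simp⟩ : Subrepresentation σ).toSubmodule := by rw [h]; trivial
        exact this
      eq_bot_or_eq_top := fun S => by
        let K : Submodule (MonoidAlgebra ℂ G) Q :=
          { S.toSubmodule with
            smul_mem' := fun a q hq => by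
              induction a using MonoidAlgebra.induction_linear with
              | zero => rw [zero_smul]; exact S.toSubmodule.zero_mem
              | add a b ha hb => rw [add_smul]; exact S.toSubmodule.add_mem ha hb
              | single g z =>
                rw [hσ']
                exact S.toSubmodule.smul_mem z (S.apply_mem_toSubmodule g hq) }
        rcases eq_bot_or_eq_top K with h | h
        · exact Or.inl (SetLike.ext fun q => (SetLike.ext_iff.1 h q :))
        · exact Or.inr (SetLike.ext fun q => (SetLike.ext_iff.1 h q :)) }
  have := finite_monoidAlgebra G
  -- A simple module is cyclic, hence finite-dimensional.
  have : Module.Finite (MonoidAlgebra ℂ G) Q := inferInstance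
  have : FiniteDimensional ℂ Q := Module.Finite.trans (MonoidAlgebra ℂ G) Q
  obtain ⟨i, ⟨e⟩⟩ := D.exists_equiv Q σ hσ
  refine ⟨i, e.toLinearEquiv.toLinearMap.toAddMonoidHom, e.toLinearEquiv.injective,
    fun g z m => ?_⟩
  have h₁ := LinearMap.congr_fun (e.isIntertwining' g) m
  change e.toLinearEquiv _ = z • D.rep i g (e.toLinearEquiv _)
  rw [hσ', map_smul]
  exact congrArg (z • ·) h₁

/-- A representation in which `n ≠ 0` has an irreducible quotient in which `n` does not vanish:
a semisimple module has trivial radical. -/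
lemma exists_quotient {n : N} (hn : n ≠ 0) : ∃ (i : D.Idx) (f : N →ₗ[ℂ] D.V i),
    (∀ g m, f (ρ g m) = D.rep i g (f m)) ∧ f n ≠ 0 := by
  have : NeZero (Nat.card G : ℂ) := ⟨card_ne_zero⟩
  have hx : ρ.asModuleEquiv.symm n ∉ Module.jacobson (MonoidAlgebra ℂ G) ρ.asModule := by
    rw [IsSemisimpleModule.jacobson_eq_bot]; simpa using hn
  rw [Module.jacobson, Submodule.mem_sInf] at hx
  push Not at hx
  obtain ⟨K, hK, hxK⟩ := hx
  have hQ := isSimpleModule_iff_isCoatom.2 hK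
  obtain ⟨i, f, hf, hfg⟩ := D.exists_of_isSimpleModule (ρ.asModule ⧸ K)
  have key : ∀ g (z : ℂ) (m : N), f (K.mkQ (ρ.asModuleEquiv.symm (z • ρ g m))) =
      z • D.rep i g (f (K.mkQ (ρ.asModuleEquiv.symm m))) := fun g z m => by
    rw [← hfg, ← map_smul]
    refine congrArg (fun x => f (K.mkQ x)) (ρ.asModuleEquiv.injective ?_)
    rw [Representation.asModuleEquiv_map_smul]
    simp
    rfl
  refine ⟨i, { toFun := fun m => f (K.mkQ (ρ.asModuleEquiv.symm m))
               map_add' := fun a b => by rw [map_add, map_add, map_add]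
               map_smul' := fun z a => by
                have h := key 1 z a
                rw [map_one, map_one] at h
                exact h }, fun g m => ?_, fun h => hxK ?_⟩
  · have h := key g 1 m
    rw [one_smul, one_smul] at h
    exact h
  · rw [← K.ker_mkQ, LinearMap.mem_ker]
    exact hf (h.trans (map_zero f).symm)

/-- The matrix coefficients are complete: an element without Fourier coefficients vanishes. -/
theorem eq_zero_of_coeff_eq_zero {n : N}
    (h : ∀ i (l : Module.Dual ℂ (D.V i)), D.coeff ρ n l = 0) : n = 0 := by
  by_contra hn
  obtain ⟨i, f, hf, hfn⟩ := D.exists_quotient ρ hn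
  obtain ⟨l, hl⟩ := D.exists_dual_eq_one hfn
  have h₁ := congrArg f (LinearMap.congr_fun (h i l) (f n))
  rw [coeff_apply, map_sum] at h₁
  simp only [map_smul, hf] at h₁
  rw [← average_apply, average_self, hl] at h₁
  simp [D.weight_ne_zero, hfn] at h₁

/-- Fourier inversion for an equivariant map. -/
theorem coeff_apply_equivariant {i k : D.Idx} (f : D.V k →ₗ[ℂ] N)
    (hf : ∀ g v, f (D.rep k g v) = ρ g (f v)) (l : Module.Dual ℂ (D.V i)) (w : D.V k) :
    D.coeff ρ (f w) l = f ∘ₗ D.average l w := by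
  ext v
  rw [coeff_apply, LinearMap.comp_apply, average_apply, map_sum]
  simp only [map_smul, hf]

/-- Fourier synthesis: prescribed equivariant Fourier coefficients `s` are attained, by the sum of
`(dim V_i / |G|) s_i(e_j^*)(e_j)` over all `i` and a basis `e_j` of each `V_i`. -/
theorem exists_coeff_eq (s : ∀ i, Module.Dual ℂ (D.V i) →ₗ[ℂ] D.V i →ₗ[ℂ] N)
    (hs : ∀ i l g v, s i l (D.rep i g v) = ρ g (s i l v)) :
    ∃ n : N, ∀ i l, D.coeff ρ n l = s i l := by
  let b := fun i => Module.finBasis ℂ (D.V i)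
  have hadd : ∀ (i : D.Idx) (l : Module.Dual ℂ (D.V i)), ∃ A : N →ₗ[ℂ] (D.V i →ₗ[ℂ] N),
      ∀ n, A n = D.coeff ρ n l := fun i l =>
    ⟨{ toFun := fun n => D.coeff ρ n l
       map_add' := fun a c => by
        ext v; simp [coeff_apply, Finset.sum_add_distrib]
       map_smul' := fun z a => by
        ext v; simp [coeff_apply, Finset.smul_sum, smul_comm z] }, fun _ => rfl⟩
  refine ⟨∑ i, D.weight i • ∑ j, s i ((b i).coord j) (b i j), fun i l => ?_⟩
  obtain ⟨A, hA⟩ := hadd i l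
  rw [← hA, map_sum]
  have h : ∀ k, A (D.weight k • ∑ j, s k ((b k).coord j) (b k j)) =
      D.weight k • ∑ j, s k ((b k).coord j) ∘ₗ D.average l (b k j) := fun k => by
    rw [map_smul, map_sum]
    exact congrArg _ (Finset.sum_congr rfl fun j _ =>
      (hA _).trans (D.coeff_apply_equivariant ρ (s k _) (hs k _) l _))
  simp only [h]
  rw [Finset.sum_eq_single i (fun k _ hk => by simp [D.average_eq_zero hk.symm]) (by simp)]
  ext v
  simp only [LinearMap.smul_apply, LinearMap.sum_apply, LinearMap.comp_apply, average_self,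
    map_smul, Finset.smul_sum, smul_smul, ← mul_assoc, mul_inv_cancel₀ (D.weight_ne_zero i),
    one_mul]
  have hl : l = ∑ j, l (b i j) • (b i).coord j := by
    refine (b i).ext fun j => ?_
    simp
  rw [LinearMap.congr_fun (congrArg (s i) hl) v, map_sum, LinearMap.sum_apply]
  simp only [map_smul, LinearMap.smul_apply]

end Rep
end UnitaryDual

/-! ### Sites with an atlas of étale charts -/

section Atlas
universe v u w₁ w₂ w₃ w₄ w₅ w₆
variable {C : Type u} [Category.{v} C] (𝒢 : Geometry C) {S : Type w₁} [Category.{w₂} S] (π : S ⥤ C)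

/-- The image of `f` contains the point `x`. -/
def Hits {X Y : S} (f : X ⟶ Y) (x : 𝒢.space.obj (π.obj Y)) : Prop :=
  x ∈ Set.range (𝒢.space.map (π.map f))

/-- The value of a morphism at a point. -/
abbrev valueAt {X Y : S} (f : X ⟶ Y) (x : 𝒢.space.obj (π.obj X)) : 𝒢.space.obj (π.obj Y) :=
  𝒢.space.map (π.map f) x

/-- An atlas of a site of charts `S`: for every `i : I` a functor to `S` from a category `B` of
étale objects over a base, such that slices of `S` and of `B` correspond to each other and `B` has
enough pullbacks along morphisms of `S`. The morphisms `(chart i).map e` are those whose groupoid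
component is trivial. -/
structure Atlas (I : Type w₃) (B : Type w₄) [Category.{w₅} B] where
  chart : I → B ⥤ S
  exists_eq : ∀ X : S, ∃ i U, X = (chart i).obj U
  fac : ∀ {i : I} {Z : S} {U : B} (t : Z ⟶ (chart i).obj U), ∃ (Z' : B)
    (ζ : Z ≅ (chart i).obj Z') (e : Z' ⟶ U), ζ.hom ≫ (chart i).map e = t
  full : ∀ {i : I} {U V W : B} (f : V ⟶ W) (k : U ⟶ W) (h : (chart i).obj U ⟶ (chart i).obj V),
    h ≫ (chart i).map f = (chart i).map k → ∃ h', (chart i).map h' = h ∧ h' ≫ f = k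
  pullback : ∀ {i k : I} {U V V' : B} (a : (chart i).obj U ⟶ (chart k).obj V) (e : V' ⟶ V)
    (x : 𝒢.space.obj (π.obj ((chart i).obj U))),
    Hits 𝒢 π ((chart k).map e) (valueAt 𝒢 π a x) →
      ∃ (U' : B) (d : U' ⟶ U) (a' : (chart i).obj U' ⟶ (chart k).obj V'),
        (chart i).map d ≫ a = a' ≫ (chart k).map e ∧ Hits 𝒢 π ((chart i).map d) x

variable {𝒢 π}

lemma Hits.comp {X Y Z : S} {f : X ⟶ Y} {g : Y ⟶ Z} {x : 𝒢.space.obj (π.obj X)}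
    {y : 𝒢.space.obj (π.obj Y)} {z : 𝒢.space.obj (π.obj Z)} (h : valueAt 𝒢 π f x = y)
    (h' : valueAt 𝒢 π g y = z) : Hits 𝒢 π (f ≫ g) z :=
  ⟨x, by subst h h'; simp [valueAt]⟩

namespace Atlas
variable {I : Type w₃} {B : Type w₄} [Category.{w₅} B] (A : Atlas 𝒢 π I B)

/-- The points of a chart. -/
abbrev Pt (i : I) (U : B) : Type v := 𝒢.space.obj (π.obj ((A.chart i).obj U))

/-- The morphism of charts `e` hits the point `x`. -/
def HitsAt {i : I} {U V : B} (e : U ⟶ V) (x : A.Pt i V) : Prop := Hits 𝒢 π ((A.chart i).map e) x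

/-- The sheaf condition for a family of presheaves on the category of charts. -/
def Glues (F : I → B → Type w₆) (res : ∀ (i) {U V : B}, (U ⟶ V) → F i V → F i U) : Prop :=
  ∀ (i : I) (U : B) (J : Type (max w₄ w₅)) (V : J → B) (e : ∀ j, V j ⟶ U),
    (∀ x : A.Pt i U, ∃ j, A.HitsAt (e j) x) → ∀ s : ∀ j, F i (V j),
    (∀ j k (Z : B) (d : Z ⟶ V j) (d' : Z ⟶ V k), d ≫ e j = d' ≫ e k →
      res i d (s j) = res i d' (s k)) →
    ∃! t, ∀ j, res i (e j) t = s j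

/-- A sieve of the étale topology is jointly surjective. -/
lemma exists_hits_of_mem (A : Atlas 𝒢 π I B) {X : S} {T : Sieve X} (hT : T ∈ etaleTopology 𝒢 π X)
    (x : 𝒢.space.obj (π.obj X)) : ∃ (Y : S) (f : Y ⟶ X), T f ∧ Hits 𝒢 π f x := by
  induction hT with
  | of X R hR =>
    obtain ⟨Y, f, hf, hx⟩ := hR x
    exact ⟨Y, f, Sieve.le_generate R _ _ hf, hx⟩
  | top X => exact ⟨X, 𝟙 X, trivial, x, by simp⟩
  | pullback X R _ Y f ih =>
    obtain ⟨Z, t, ht, z, hz⟩ := ih (valueAt 𝒢 π f x)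
    obtain ⟨i, V, rfl⟩ := A.exists_eq X
    obtain ⟨k, U, rfl⟩ := A.exists_eq Y
    obtain ⟨Z', ζ, e, rfl⟩ := A.fac t
    obtain ⟨U', d, a', h, hx⟩ := A.pullback f e x ⟨valueAt 𝒢 π ζ.hom z, by
      rw [← hz]; simp [valueAt]⟩
    refine ⟨_, _, ?_, hx⟩
    change R _
    rw [h, show a' ≫ (A.chart i).map e = (a' ≫ ζ.inv) ≫ ζ.hom ≫ (A.chart i).map e by simp]
    exact R.downward_closed ht _
  | transitive X R R' _ _ ih ih' =>
    obtain ⟨Y, f, hf, y, hy⟩ := ih x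
    obtain ⟨Z, g, hg, z, hz⟩ := ih' hf y
    exact ⟨Z, g ≫ f, hg, Hits.comp hz hy⟩

/-- The sheaf condition may be checked on the charts. -/
theorem isSheaf_iff (P : Sᵒᵖ ⥤ Type w₆) : Presieve.IsSheaf (etaleTopology 𝒢 π) P ↔
    A.Glues (fun i U => P.obj (op ((A.chart i).obj U)))
      (fun i _ _ e => P.map ((A.chart i).map e).op) := by
  constructor
  · intro hP i U J V e he s hs
    have hR : Sieve.generate (Presieve.ofArrows (fun j => (A.chart i).obj (V j))
        (fun j => (A.chart i).map (e j))) ∈ etaleTopology 𝒢 π ((A.chart i).obj U) :=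
      Precoverage.generate_mem_toGrothendieck fun x => by
        obtain ⟨j, hj⟩ := he x
        exact ⟨_, _, ⟨j⟩, hj⟩
    have h := (Presieve.isSheafFor_iff_generate _).2 (hP _ hR)
    rw [Presieve.isSheafFor_arrows_iff] at h
    refine h s fun j k Z g g' hg => ?_
    obtain ⟨Z', ζ, d, rfl⟩ := A.fac g
    obtain ⟨d', h₁, h₂⟩ := A.full (e k) (d ≫ e j) (ζ.inv ≫ g') (by
      rw [Category.assoc, ← hg]; simp)
    have hg' : g' = ζ.hom ≫ (A.chart i).map d' := by rw [h₁]; simp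
    rw [hg', op_comp, op_comp, Functor.map_comp_apply, Functor.map_comp_apply]
    exact congrArg _ (hs j k Z' d d' h₂.symm)
  · intro hP X T hT
    obtain ⟨i, U, rfl⟩ := A.exists_eq X
    intro x hx
    have := hP i U (Σ V, {e : V ⟶ U // T ((A.chart i).map e)}) (fun j => j.1) (fun j => j.2.1)
      (fun y => by
        obtain ⟨Y, f, hf, z, hz⟩ := A.exists_hits_of_mem hT y
        obtain ⟨Z', ζ, e, rfl⟩ := A.fac f
        refine ⟨⟨Z', e, ?_⟩, valueAt 𝒢 π ζ.hom z, ?_⟩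
        · rw [show (A.chart i).map e = ζ.inv ≫ ζ.hom ≫ (A.chart i).map e by simp]
          exact T.downward_closed hf _
        · rw [← hz]; simp [valueAt])
      (fun j => x _ j.2.2)
      (fun j k Z d d' h => hx _ _ _ _ (by rw [← Functor.map_comp, h, Functor.map_comp]))
    obtain ⟨t, ht, htu⟩ := this
    refine ⟨t, fun Y f hf => ?_, fun t' ht' => htu t' fun j => ht' _ j.2.2⟩
    obtain ⟨Z', ζ, e, rfl⟩ := A.fac f
    have he : T ((A.chart i).map e) := by
      rw [show (A.chart i).map e = ζ.inv ≫ ζ.hom ≫ (A.chart i).map e by simp]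
      exact T.downward_closed hf _
    rw [op_comp, Functor.map_comp_apply]
    refine (congrArg _ (ht ⟨Z', e, he⟩)).trans ?_
    have := hx (𝟙 _) ζ.hom hf he (by simp)
    simpa using this.symm

/-! ### Extension of a presheaf from locally constant data -/

/-- A presheaf known on charts and on those morphisms for which it is given by a formula:
`Rel a L` says that `L` is a formula for the restriction along `a`. Every morphism has such a
formula locally on its source. The composite of two formulas only has to agree with a formula for
the composite morphism where there is one. -/
structure LocalPresheaf (F : I → B → Type w₆) where
  res : ∀ (i) {U V : B}, (U ⟶ V) → F i V → F i U
  glues : A.Glues F res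
  Rel : ∀ {i k : I} {U V : B}, ((A.chart i).obj U ⟶ (A.chart k).obj V) → (F k V → F i U) → Prop
  rel_id : ∀ {i : I} {U : B}, Rel (𝟙 ((A.chart i).obj U)) id
  rel_map : ∀ {i : I} {U V : B} (e : U ⟶ V), Rel ((A.chart i).map e) (res i e)
  rel_map_comp : ∀ {i k : I} {U' U V : B} (e : U' ⟶ U)
    (a : (A.chart i).obj U ⟶ (A.chart k).obj V) (L : F k V → F i U), Rel a L →
      ∃ L', Rel ((A.chart i).map e ≫ a) L'
  rel_comp : ∀ {i k l : I} {U V W : B} (a : (A.chart i).obj U ⟶ (A.chart k).obj V)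
    (b : (A.chart k).obj V ⟶ (A.chart l).obj W) (L L' L''), Rel a L → Rel b L' → Rel (a ≫ b) L'' →
      L'' = L ∘ L'
  exists_rel : ∀ {i k : I} {U V : B} (a : (A.chart i).obj U ⟶ (A.chart k).obj V) (x : A.Pt i U),
    ∃ (U' : B) (e : U' ⟶ U) (L : _), A.HitsAt e x ∧ Rel ((A.chart i).map e ≫ a) L

namespace LocalPresheaf
variable {A} {F : I → B → Type w₆} (P : A.LocalPresheaf F) {i k l : I} {U V W : B}

lemma rel_unique {a : (A.chart i).obj U ⟶ (A.chart k).obj V} {L L' : F k V → F i U}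
    (h : P.Rel a L) (h' : P.Rel a L') : L = L' :=
  P.rel_comp (𝟙 _) a id L' L P.rel_id h' (by simpa using h)

lemma res_comp {U' : B} (d : U' ⟶ U) (e : U ⟶ V) (s : F i V) :
    P.res i (d ≫ e) s = P.res i d (P.res i e s) :=
  congrFun (P.rel_comp ((A.chart i).map d) ((A.chart i).map e) _ _ _ (P.rel_map d) (P.rel_map e)
    (by rw [← Functor.map_comp]; exact P.rel_map _)) s

lemma rel_map_comp' {U' : B} (e : U' ⟶ U) {a : (A.chart i).obj U ⟶ (A.chart k).obj V}
    {L : F k V → F i U} (h : P.Rel a L) : P.Rel ((A.chart i).map e ≫ a) (P.res i e ∘ L) := by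
  obtain ⟨L', hL'⟩ := P.rel_map_comp e a L h
  rwa [P.rel_comp _ a _ _ _ (P.rel_map e) h hL'] at hL'

/-- Sections which agree locally are equal. -/
lemma ext_local {s t : F i U} (h : ∀ x : A.Pt i U, ∃ (U' : B) (e : U' ⟶ U),
    A.HitsAt e x ∧ P.res i e s = P.res i e t) : s = t := by
  obtain ⟨r, -, hr⟩ := P.glues i U (Σ U', {e : U' ⟶ U // P.res i e s = P.res i e t})
    (fun j => j.1) (fun j => j.2.1) (fun x => by
      obtain ⟨U', e, hx, he⟩ := h x
      exact ⟨⟨U', e, he⟩, hx⟩) (fun j => P.res i j.2.1 s)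
    (fun j k Z d d' hd => by
      rw [← P.res_comp, ← P.res_comp, hd])
  exact (hr s fun _ => rfl).trans (hr t fun j => j.2.2.symm).symm

lemma exists_extend (a : (A.chart i).obj U ⟶ (A.chart k).obj V) (s : F k V) :
    ∃! t : F i U, ∀ j : (Σ U', {e : U' ⟶ U // ∃ L, P.Rel ((A.chart i).map e ≫ a) L}),
      P.res i j.2.1 t = j.2.2.choose s := by
  refine P.glues i U (Σ U', {e : U' ⟶ U // ∃ L, P.Rel ((A.chart i).map e ≫ a) L})
    (fun j => j.1) (fun j => j.2.1) (fun x => ?_) _ fun j k Z d d' hd => ?_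
  · obtain ⟨U', e, L, hx, hL⟩ := P.exists_rel a x
    exact ⟨⟨U', e, L, hL⟩, hx⟩
  · have h₁ := P.rel_map_comp' d j.2.2.choose_spec
    have h₂ := P.rel_map_comp' d' k.2.2.choose_spec
    rw [← Category.assoc, ← Functor.map_comp] at h₁ h₂
    rw [hd] at h₁
    exact congrFun (P.rel_unique h₁ h₂) s

/-- The restriction along an arbitrary morphism, glued from the local formulas. -/
def extend (a : (A.chart i).obj U ⟶ (A.chart k).obj V) (s : F k V) : F i U :=
  (P.exists_extend a s).choose

lemma res_extend (a : (A.chart i).obj U ⟶ (A.chart k).obj V) (s : F k V) {U' : B} (e : U' ⟶ U)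
    {L : F k V → F i U'} (h : P.Rel ((A.chart i).map e ≫ a) L) :
    P.res i e (P.extend a s) = L s :=
  ((P.exists_extend a s).choose_spec.1 ⟨U', e, L, h⟩).trans
    (congrFun (P.rel_unique (Exists.choose_spec (⟨L, h⟩ : ∃ L, P.Rel _ L)) h) s)

lemma extend_of_rel {a : (A.chart i).obj U ⟶ (A.chart k).obj V} {L : F k V → F i U}
    (h : P.Rel a L) (s : F k V) : P.extend a s = L s := by
  refine P.ext_local fun x => ?_
  obtain ⟨U', e, L', hx, hL'⟩ := P.exists_rel a x
  refine ⟨U', e, hx, ?_⟩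
  rw [P.res_extend a s e hL', P.rel_unique hL' (P.rel_map_comp' e h)]
  rfl

lemma extend_id (s : F i U) : P.extend (𝟙 ((A.chart i).obj U)) s = s := P.extend_of_rel P.rel_id s

lemma extend_map (e : U ⟶ V) (s : F i V) : P.extend ((A.chart i).map e) s = P.res i e s :=
  P.extend_of_rel (P.rel_map e) s

lemma extend_comp (a : (A.chart i).obj U ⟶ (A.chart k).obj V)
    (b : (A.chart k).obj V ⟶ (A.chart l).obj W) (s : F l W) :
    P.extend (a ≫ b) s = P.extend a (P.extend b s) := by
  refine P.ext_local fun x => ?_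
  -- Choose a neighbourhood on which all the morphisms involved are given by formulas.
  obtain ⟨V', e, Lb, he, hb⟩ := P.exists_rel b (valueAt 𝒢 π a x)
  obtain ⟨U₁, d, a', hd, x₁, rfl⟩ := A.pullback a e x he
  obtain ⟨U₂, e₂, La, ⟨x₂, rfl⟩, ha⟩ := P.exists_rel a' x₁
  obtain ⟨U₃, e₃, L₃, ⟨x₃, rfl⟩, h₃⟩ := P.exists_rel ((A.chart i).map (e₂ ≫ d) ≫ a) x₂
  obtain ⟨U₄, e₄, L₄, ⟨x₄, rfl⟩, h₄⟩ := P.exists_rel ((A.chart i).map (e₃ ≫ e₂ ≫ d) ≫ a ≫ b) x₃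
  refine ⟨U₄, e₄ ≫ e₃ ≫ e₂ ≫ d, ⟨x₄, by simp⟩, ?_⟩
  have h₄' : P.Rel ((A.chart i).map (e₄ ≫ e₃ ≫ e₂ ≫ d) ≫ a ≫ b) L₄ := by
    simpa using h₄
  have hα := P.rel_map_comp' (e₄ ≫ e₃) ha
  have h₃' := P.rel_map_comp' e₄ h₃
  set L₃' := P.res i e₄ ∘ L₃
  rw [show (A.chart i).map e₄ ≫ (A.chart i).map e₃ ≫ (A.chart i).map (e₂ ≫ d) ≫ a =
    (A.chart i).map (e₄ ≫ e₃ ≫ e₂ ≫ d) ≫ a by simp] at h₃'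
  have hfac : (A.chart i).map (e₄ ≫ e₃ ≫ e₂ ≫ d) ≫ a =
      ((A.chart i).map (e₄ ≫ e₃) ≫ (A.chart i).map e₂ ≫ a') ≫ (A.chart k).map e := by
    simp [hd]
  rw [P.res_extend _ _ _ h₄', P.res_extend _ _ _ h₃',
    P.rel_comp _ _ _ _ L₃' hα (P.rel_map e) (by rw [← hfac]; exact h₃'), Function.comp_apply,
    P.res_extend _ _ _ hb, P.rel_comp _ _ _ _ L₄ hα hb (by
      rw [show ((A.chart i).map (e₄ ≫ e₃) ≫ (A.chart i).map e₂ ≫ a') ≫ (A.chart k).map e ≫ b =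
        (A.chart i).map (e₄ ≫ e₃ ≫ e₂ ≫ d) ≫ a ≫ b by
          rw [← Category.assoc, ← hfac, Category.assoc]]
      exact h₄')]
  rfl

end LocalPresheaf
end Atlas
end Atlas

/-! ### The atlases of a gerbe and of its dual -/

section
universe v u
variable {C : Type u} [Category.{v} C]

/-- The formal properties of étale morphisms which the sites of charts depend on. Instead of fibre
products, which need not be available, it is enough that base change exists near every point. -/
structure Geometry.IsRegular (𝒢 : Geometry C) : Prop where
  comp : ∀ {X Y Z : C} (f : X ⟶ Y) (g : Y ⟶ Z), 𝒢.isEtale f → 𝒢.isEtale g → 𝒢.isEtale (f ≫ g)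
  of_comp : ∀ {X Y Z : C} (f : X ⟶ Y) (g : Y ⟶ Z), 𝒢.isEtale g → 𝒢.isEtale (f ≫ g) → 𝒢.isEtale f
  pullback : ∀ {U V V' : C} (h : U ⟶ V) (f : V' ⟶ V), 𝒢.isEtale f → ∀ x : 𝒢.space.obj U,
    𝒢.space.map h x ∈ Set.range (𝒢.space.map f) → ∃ (P : C) (p : P ⟶ U) (r : P ⟶ V'),
      𝒢.isEtale p ∧ p ≫ h = r ≫ f ∧ x ∈ Set.range (𝒢.space.map p)

/-- An étale object over `M`. -/
structure EtaleOver (𝒢 : Geometry C) (M : C) where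
  dom : C
  map : dom ⟶ M
  etale : 𝒢.isEtale map

namespace EtaleOver
variable {𝒢 : Geometry C} {M : C}

/-- A morphism over `M`. -/
@[ext]
structure Hom (U V : EtaleOver 𝒢 M) where
  hom : U.dom ⟶ V.dom
  w : hom ≫ V.map = U.map

instance : Category (EtaleOver 𝒢 M) where
  Hom := Hom
  id U := ⟨𝟙 _, by simp⟩
  comp a b := ⟨a.hom ≫ b.hom, by rw [Category.assoc, b.w, a.w]⟩
  id_comp a := Hom.ext (by simp)
  comp_id a := Hom.ext (by simp)
  assoc a b c := Hom.ext (by simp)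

lemma Hom.etale (h𝒢 : 𝒢.IsRegular) {U V : EtaleOver 𝒢 M} (e : U ⟶ V) : 𝒢.isEtale e.hom :=
  h𝒢.of_comp _ _ V.etale (by rw [e.w]; exact U.etale)

/-- Points have small étale neighbourhoods. -/
lemma exists_nhd (h𝒢 : 𝒢.IsRegular) (U : EtaleOver 𝒢 M) (x : 𝒢.space.obj U.dom)
    (N : Set (𝒢.space.obj U.dom)) (hN : IsOpen N) (hx : x ∈ N) :
    ∃ (V : EtaleOver 𝒢 M) (e : V ⟶ U), x ∈ Set.range (𝒢.space.map e.hom) ∧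
      Set.range (𝒢.space.map e.hom) ⊆ N := by
  obtain ⟨V, f, hf, hx, hN⟩ := 𝒢.exists_nhd U.dom x N hN hx
  exact ⟨⟨V, f ≫ U.map, h𝒢.comp _ _ hf U.etale⟩, ⟨f, rfl⟩, hx, hN⟩

/-- A locally constant function is constant near every point. -/
lemma exists_nhd_const (h𝒢 : 𝒢.IsRegular) (U : EtaleOver 𝒢 M) (x : 𝒢.space.obj U.dom)
    {Y : Type*} {φ : 𝒢.space.obj U.dom → Y} (hφ : IsLocallyConstant φ) :
    ∃ (V : EtaleOver 𝒢 M) (e : V ⟶ U), x ∈ Set.range (𝒢.space.map e.hom) ∧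
      ∀ y, φ (𝒢.space.map e.hom y) = φ x := by
  obtain ⟨V, e, hx, hN⟩ := U.exists_nhd h𝒢 x _ (hφ {φ x}) rfl
  exact ⟨V, e, hx, fun y => hN ⟨y, rfl⟩⟩

end EtaleOver

variable {𝒢 : Geometry C} {M : C}

namespace Chart
variable {X : EtaleGroupoid 𝒢 M}

lemma comp_arr {U V W : Chart X} (a : U ⟶ V) (b : V ⟶ W) : (a ≫ b).arr =
    X.mul a.arr (a.hom ≫ b.arr) (by simp [a.arr_tgt, b.arr_src]) := rfl

variable (X) in
/-- Étale objects over `M` as charts; the groupoid component of a morphism over `M` is trivial. -/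
abbrev ofEtale : EtaleOver 𝒢 M ⥤ Chart X where
  obj U := ⟨U.dom, U.map, U.etale⟩
  map {U V} e :=
    { hom := e.hom
      arr := U.map ≫ X.one
      arr_src := by simp [X.one_src]
      arr_tgt := by simpa [X.one_tgt] using e.w.symm }
  map_id U := rfl
  map_comp {U V W} e f := by
    refine Hom.ext rfl (Eq.symm ?_)
    rw [comp_arr]
    refine X.mul_one' (e.hom ≫ V.map) (U.map ≫ X.one) ?_ |>.symm.trans ?_ |>.symm
    · simp [X.one_tgt, e.w]
    · exact X.mul_congr rfl (Category.assoc _ _ _) _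

lemma arr_ofEtale {U V : EtaleOver 𝒢 M} (e : U ⟶ V) :
    Hom.arr ((ofEtale X).map e) = U.map ≫ X.one := rfl

lemma ofEtale_comp_arr {U V : EtaleOver 𝒢 M} {W : Chart X} (e : U ⟶ V)
    (a : (ofEtale X).obj V ⟶ W) : Hom.arr ((ofEtale X).map e ≫ a) = e.hom ≫ a.arr :=
  X.one_mul' U.map (e.hom ≫ a.arr) (by
    rw [Category.assoc, a.arr_src]; exact e.w.symm)

lemma comp_ofEtale_arr {U : Chart X} {V W : EtaleOver 𝒢 M} (a : U ⟶ (ofEtale X).obj V)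
    (e : V ⟶ W) : Hom.arr (a ≫ (ofEtale X).map e) = a.arr := by
  refine (X.mul_congr rfl (Category.assoc _ _ _).symm _).trans (X.mul_one' (a.hom ≫ V.map) a.arr ?_)
  exact a.arr_tgt.symm

lemma etale_arr (h𝒢 : 𝒢.IsRegular) {U V : Chart X} (a : U ⟶ V) : 𝒢.isEtale (a.hom ≫ V.map) := by
  rw [← a.arr_tgt]
  exact h𝒢.comp _ _ (h𝒢.of_comp _ _ X.etale_src (by rw [a.arr_src]; exact U.etale)) X.etale_tgt

variable (X) in
/-- The atlas of the stack `[M / X]`. -/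
abbrev atlas (h𝒢 : 𝒢.IsRegular) : Atlas 𝒢 (forget X) Unit (EtaleOver 𝒢 M) where
  chart _ := ofEtale X
  exists_eq U := ⟨(), ⟨U.dom, U.map, U.etale⟩, rfl⟩
  fac {_ Z U} t := by
    refine ⟨⟨Z.dom, t.hom ≫ U.map, etale_arr h𝒢 t⟩,
      { hom := ⟨𝟙 _, t.arr, t.arr_src, by rw [t.arr_tgt]; exact (Category.id_comp _).symm⟩
        inv := ⟨𝟙 _, t.arr ≫ X.inv, by rw [Category.assoc, X.inv_src, t.arr_tgt],
          by rw [Category.assoc, X.inv_tgt, t.arr_src]; exact (Category.id_comp _).symm⟩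
        hom_inv_id := ?_
        inv_hom_id := ?_ }, ⟨t.hom, rfl⟩, ?_⟩
    · refine Hom.ext (Category.id_comp _) ?_
      refine (X.mul_congr rfl (Category.id_comp _) _).trans ((X.mul_inv _).trans ?_)
      rw [t.arr_src]; rfl
    · refine Hom.ext (Category.id_comp _) ?_
      refine (X.mul_congr rfl (Category.id_comp _) _).trans ((X.inv_mul _).trans ?_)
      rw [t.arr_tgt]; rfl
    · exact Hom.ext (Category.id_comp _) (comp_ofEtale_arr _ _)
  full {_ U V W} f k h e := by
    have h₁ := congrArg Hom.hom e
    have h₂ := congrArg Hom.arr e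
    rw [comp_ofEtale_arr, arr_ofEtale] at h₂
    refine ⟨⟨h.hom, ?_⟩, Hom.ext rfl h₂.symm, EtaleOver.Hom.ext h₁⟩
    refine h.arr_tgt.symm.trans ?_
    rw [h₂]; simp [X.one_tgt]
  pullback {_ _ U V V'} a e x hx := by
    obtain ⟨P, p, r, hp, hpr, hxp⟩ := h𝒢.pullback a.hom e.hom (e.etale h𝒢) x hx
    refine ⟨⟨P, p ≫ U.map, h𝒢.comp _ _ hp U.etale⟩, ⟨p, rfl⟩,
      ⟨r, p ≫ a.arr, by rw [Category.assoc, a.arr_src], ?_⟩, ?_, hxp⟩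
    · rw [Category.assoc, a.arr_tgt, ← Category.assoc, hpr, Category.assoc]
      exact congrArg (r ≫ ·) e.w
    · refine Hom.ext hpr ?_
      rw [ofEtale_comp_arr, comp_ofEtale_arr]

end Chart

namespace DualChart
variable {G : Type} [Group G] [Finite G] {E : GerbeExtension 𝒢 G M} {D : UnitaryDual G}
  {T : Intertwiners D}

omit [Finite G] in
lemma act_one (i : D.Idx) : T.act 1 i = i := congrArg Sigma.fst (T.T_one i 0)

lemma comp_arr {U V W : DualChart E T} (a : U ⟶ V) (b : V ⟶ W) : (a ≫ b).arr =
    E.Q.mul a.arr (a.hom ≫ b.arr) (by simp [a.arr_tgt, b.arr_src]) := rfl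

lemma comp_phase {U V W : DualChart E T} (a : U ⟶ V) (b : V ⟶ W) (x : 𝒢.space.obj U.dom) :
    (a ≫ b).phase x = E.cocycle T U.idx a.arr (a.hom ≫ b.arr) (by simp [a.arr_tgt, b.arr_src]) x *
      (a.phase x * b.phase (𝒢.space.map a.hom x)) := rfl

lemma cocycle_one_right' {U : C} {i : D.Idx} {q r : U ⟶ E.Q.arr} (m : U ⟶ M)
    (hr : r = m ≫ E.Q.one) (h : q ≫ E.Q.tgt = r ≫ E.Q.src) (x : 𝒢.space.obj U) :
    E.cocycle T i q r h x = 1 := by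
  subst hr
  exact E.cocycle_one_right T i m q (by simpa [E.Q.one_src] using h.symm) x

lemma cocycle_one_left' {U : C} {i : D.Idx} {q r : U ⟶ E.Q.arr} (m : U ⟶ M)
    (hq : q = m ≫ E.Q.one) (h : q ≫ E.Q.tgt = r ≫ E.Q.src) (x : 𝒢.space.obj U) :
    E.cocycle T i q r h x = 1 := by
  subst hq
  exact E.cocycle_one_left T i m r (by simpa [E.Q.one_tgt] using h) x

variable (E T) in
/-- Étale objects over `M` as charts of `M × {i}`; the groupoid component of a morphism over `M` is
trivial, and its phase is one. -/
abbrev ofEtale (i : D.Idx) : EtaleOver 𝒢 M ⥤ DualChart E T where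
  obj U := ⟨U.dom, U.map, U.etale, i⟩
  map {U V} e :=
    { hom := e.hom
      arr := U.map ≫ E.Q.one
      arr_src := by simp [E.Q.one_src]
      arr_tgt := by simpa [E.Q.one_tgt] using e.w.symm
      act_idx := fun x => by
        rw [Category.assoc, E.one_sec, E.ad_one]
        exact act_one i
      phase := 1 }
  map_id U := rfl
  map_comp {U V W} e f := by
    refine Hom.ext rfl (Eq.symm ?_) (LocallyConstant.ext fun x => ?_)
    · rw [comp_arr]
      refine E.Q.mul_one' (e.hom ≫ V.map) (U.map ≫ E.Q.one) ?_ |>.symm.trans ?_ |>.symm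
      · simp [E.Q.one_tgt, e.w]
      · exact E.Q.mul_congr rfl (Category.assoc _ _ _) _
    · rw [comp_phase, cocycle_one_left' U.map rfl]; simp

lemma arr_ofEtale {i : D.Idx} {U V : EtaleOver 𝒢 M} (e : U ⟶ V) :
    Hom.arr ((ofEtale E T i).map e) = U.map ≫ E.Q.one := rfl

lemma phase_ofEtale {i : D.Idx} {U V : EtaleOver 𝒢 M} (e : U ⟶ V) :
    Hom.phase ((ofEtale E T i).map e) = 1 := rfl

lemma ofEtale_comp_arr {i : D.Idx} {U V : EtaleOver 𝒢 M} {W : DualChart E T} (e : U ⟶ V)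
    (a : (ofEtale E T i).obj V ⟶ W) : Hom.arr ((ofEtale E T i).map e ≫ a) = e.hom ≫ a.arr :=
  E.Q.one_mul' U.map (e.hom ≫ a.arr) (by
    rw [Category.assoc, a.arr_src]; exact e.w.symm)

lemma ofEtale_comp_phase {i : D.Idx} {U V : EtaleOver 𝒢 M} {W : DualChart E T} (e : U ⟶ V)
    (a : (ofEtale E T i).obj V ⟶ W) (x : 𝒢.space.obj U.dom) :
    Hom.phase ((ofEtale E T i).map e ≫ a) x = a.phase (𝒢.space.map e.hom x) := by
  change E.cocycle T i (U.map ≫ E.Q.one) (e.hom ≫ a.arr) _ x *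
    ((1 : Circle) * a.phase (𝒢.space.map e.hom x)) = _
  refine (congrArg (· * _) (cocycle_one_left' U.map rfl _ x)).trans ?_
  simp only [one_mul]

lemma comp_ofEtale_arr {i : D.Idx} {U : DualChart E T} {V W : EtaleOver 𝒢 M}
    (a : U ⟶ (ofEtale E T i).obj V) (e : V ⟶ W) :
    Hom.arr (a ≫ (ofEtale E T i).map e) = a.arr := by
  refine (E.Q.mul_congr rfl (Category.assoc _ _ _).symm _).trans
    (E.Q.mul_one' (a.hom ≫ V.map) a.arr ?_)
  exact a.arr_tgt.symm

lemma comp_ofEtale_phase {i : D.Idx} {U : DualChart E T} {V W : EtaleOver 𝒢 M}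
    (a : U ⟶ (ofEtale E T i).obj V) (e : V ⟶ W) :
    Hom.phase (a ≫ (ofEtale E T i).map e) = a.phase := by
  refine LocallyConstant.ext fun x => (comp_phase _ _ x).trans ?_
  rw [cocycle_one_right' (a.hom ≫ V.map) (Category.assoc _ _ _).symm, one_mul, phase_ofEtale]
  exact mul_one _

lemma etale_arr (h𝒢 : 𝒢.IsRegular) {U V : DualChart E T} (a : U ⟶ V) :
    𝒢.isEtale (a.hom ≫ V.map) := by
  rw [← a.arr_tgt]
  exact h𝒢.comp _ _ (h𝒢.of_comp _ _ E.Q.etale_src (by rw [a.arr_src]; exact U.etale))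
    E.Q.etale_tgt

lemma act_inv {U : C} {i k : D.Idx} (q : U ⟶ E.Q.arr) (x : 𝒢.space.obj U)
    (h : T.act (E.ad (q ≫ E.sec) x) i = k) : T.act (E.ad ((q ≫ E.Q.inv) ≫ E.sec) x) k = i := by
  have hq : q ≫ E.Q.tgt = (q ≫ E.Q.inv) ≫ E.Q.src := by simp [E.Q.inv_src]
  rw [← h, T.act_act (E.ad_tau _ _ hq x), E.Q.mul_inv, Category.assoc (q ≫ E.Q.src), E.one_sec,
    E.ad_one]
  exact act_one i

/-- The morphism of charts on the same object defined by an arrow of the groupoid and a phase. -/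
def ofArrow {d : C} {m m' : d ⟶ M} {hm : 𝒢.isEtale m} {hm' : 𝒢.isEtale m'} {i k : D.Idx}
    (q : d ⟶ E.Q.arr) (hs : q ≫ E.Q.src = m) (ht : q ≫ E.Q.tgt = m')
    (ha : ∀ x, T.act (E.ad (q ≫ E.sec) x) i = k) (φ : LocallyConstant (𝒢.space.obj d) Circle) :
    (⟨d, m, hm, i⟩ : DualChart E T) ⟶ ⟨d, m', hm', k⟩ :=
  ⟨𝟙 _, q, hs, ht.trans (Category.id_comp _).symm, ha, φ⟩

lemma ofArrow_comp_eq_id {d : C} {m m' : d ⟶ M} {hm : 𝒢.isEtale m} {hm' : 𝒢.isEtale m'}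
    {i k : D.Idx} (q q' : d ⟶ E.Q.arr) (hs hs' ht ht' ha ha') (φ φ')
    (h : E.Q.mul q q' (by rw [ht, hs']) = m ≫ E.Q.one)
    (h' : φ' = (E.cocycle T i q q' (by rw [ht, hs']) * φ)⁻¹) :
    (ofArrow q hs ht ha φ : (⟨d, m, hm, i⟩ : DualChart E T) ⟶ ⟨d, m', hm', k⟩) ≫
      ofArrow q' hs' ht' ha' φ' = 𝟙 _ := by
  subst h'
  refine Hom.ext (Category.id_comp _) ?_ (LocallyConstant.ext fun x => ?_)
  · exact (E.Q.mul_congr rfl (Category.id_comp q') _).trans h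
  · have e₁ : ∀ (r : d ⟶ E.Q.arr) (h : q ≫ E.Q.tgt = r ≫ E.Q.src), r = q' →
        E.cocycle T i q r h x = E.cocycle T i q q' (by rw [ht, hs']) x := by
      rintro r h rfl; rfl
    have e₂ : 𝒢.space.map (𝟙 d) x = x := by simp
    change E.cocycle T i q (𝟙 d ≫ q') _ x *
      (φ x * (E.cocycle T i q q' _ (𝒢.space.map (𝟙 d) x) * φ (𝒢.space.map (𝟙 d) x))⁻¹) = 1
    refine (congrArg (· * _) (e₁ _ _ (Category.id_comp _))).trans ?_
    rw [e₂, ← mul_assoc, mul_inv_cancel]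

/-- A morphism of charts on the same object is invertible. Its left and right inverses are found
separately, so that no relation between `c(q, q⁻¹)` and `c(q⁻¹, q)` is needed. -/
lemma isIso_ofArrow {d : C} {m m' : d ⟶ M} {hm : 𝒢.isEtale m} {hm' : 𝒢.isEtale m'}
    {i k : D.Idx} (q : d ⟶ E.Q.arr) (hs ht ha) (φ) :
    IsIso (ofArrow q hs ht ha φ : (⟨d, m, hm, i⟩ : DualChart E T) ⟶ ⟨d, m', hm', k⟩) := by
  have hs' : (q ≫ E.Q.inv) ≫ E.Q.src = m' := by rw [Category.assoc, E.Q.inv_src, ht]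
  have ht' : (q ≫ E.Q.inv) ≫ E.Q.tgt = m := by rw [Category.assoc, E.Q.inv_tgt, hs]
  have ha' : ∀ x, T.act (E.ad ((q ≫ E.Q.inv) ≫ E.sec) x) k = i := fun x => act_inv _ _ (ha x)
  have h₁ := ofArrow_comp_eq_id (hm := hm) (hm' := hm') q (q ≫ E.Q.inv) hs hs' ht ht' ha ha' φ _
    (by rw [E.Q.mul_inv, hs]) rfl
  have h₂ := ofArrow_comp_eq_id (hm := hm') (hm' := hm) (q ≫ E.Q.inv) q hs' hs ht' ht ha' ha
    (E.cocycle T k (q ≫ E.Q.inv) q (by rw [ht', hs]) * φ)⁻¹ φ (by rw [E.Q.inv_mul, ht])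
    (by
      rw [mul_inv, inv_inv, ← mul_assoc, inv_mul_cancel, one_mul])
  refine ⟨_, h₁, ?_⟩
  rw [← h₂]
  congr 1
  refine (Category.id_comp _).symm.trans ?_
  rw [← h₂, Category.assoc, h₁, Category.comp_id]

variable (E T) in
/-- The atlas of the `U(1)`-gerbe over the dual stack. -/
abbrev atlas (h𝒢 : 𝒢.IsRegular) : Atlas 𝒢 (forget E T) D.Idx (EtaleOver 𝒢 M) where
  chart := ofEtale E T
  exists_eq U := ⟨U.idx, ⟨U.dom, U.map, U.etale⟩, rfl⟩
  fac {i Z U} t := by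
    let ζ : Z ⟶ (ofEtale E T i).obj ⟨Z.dom, t.hom ≫ U.map, etale_arr h𝒢 t⟩ :=
      ofArrow t.arr t.arr_src t.arr_tgt t.act_idx t.phase
    have : IsIso ζ := isIso_ofArrow _ _ _ _ _
    refine ⟨_, asIso ζ, ⟨t.hom, rfl⟩, Hom.ext (Category.id_comp _) ?_ ?_⟩
    · exact comp_ofEtale_arr ζ _
    · exact comp_ofEtale_phase ζ _
  full {i U V W} f k h e := by
    have h₁ := congrArg Hom.hom e
    have h₂ := congrArg Hom.arr e
    have h₃ := congrArg Hom.phase e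
    rw [comp_ofEtale_arr, arr_ofEtale] at h₂
    rw [comp_ofEtale_phase, phase_ofEtale] at h₃
    refine ⟨⟨h.hom, ?_⟩, Hom.ext rfl h₂.symm h₃.symm, EtaleOver.Hom.ext h₁⟩
    refine h.arr_tgt.symm.trans ?_
    rw [h₂]; simp [E.Q.one_tgt]
  pullback {_ _ U V V'} a e x hx := by
    obtain ⟨P, p, r, hp, hpr, hxp⟩ := h𝒢.pullback a.hom e.hom (e.etale h𝒢) x hx
    refine ⟨⟨P, p ≫ U.map, h𝒢.comp _ _ hp U.etale⟩, ⟨p, rfl⟩,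
      ⟨r, p ≫ a.arr, by rw [Category.assoc, a.arr_src], ?_, ?_,
        a.phase.comap (𝒢.space.map p).hom⟩, ?_, hxp⟩
    · rw [Category.assoc, a.arr_tgt, ← Category.assoc, hpr, Category.assoc]
      exact congrArg (r ≫ ·) e.w
    · intro x
      rw [Category.assoc, E.ad_comp]
      exact a.act_idx _
    · refine Hom.ext hpr ?_ (LocallyConstant.ext fun x => ?_)
      · rw [ofEtale_comp_arr, comp_ofEtale_arr]
      · rw [ofEtale_comp_phase, comp_ofEtale_phase]; rfl

end DualChart
end

/-! ### Sections of modules on a site of charts -/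

section
universe v u
variable {C : Type u} [Category.{v} C]

/-- The algebra of functions on `X`. -/
abbrev AlgebraPresheaf.at (𝒪 : AlgebraPresheaf C) (X : C) : Type := 𝒪.ring.obj (op X)

variable {𝒪 : AlgebraPresheaf C}

instance AlgebraPresheaf.algebra (X : C) : Algebra ℂ (𝒪.at X) :=
  RingHom.toAlgebra (𝒪.scalars.app (op X)).hom

lemma AlgebraPresheaf.map_algebraMap {X Y : C} (f : X ⟶ Y) (z : ℂ) :
    (𝒪.ring.map f.op).hom (algebraMap ℂ (𝒪.at Y) z) = algebraMap ℂ (𝒪.at X) z :=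
  (congrArg (fun h => (CommRingCat.Hom.hom h) z) (𝒪.scalars.naturality f.op)).symm

namespace Modules
variable {S : Type*} [Category* S] {π : S ⥤ C}

/-- The type of sections over `U`. -/
def Sec (F : Modules 𝒪 π) (U : S) : Type := F.sections U

variable (F : Modules 𝒪 π)

instance (U : S) : AddCommGroup (F.Sec U) := inferInstanceAs (AddCommGroup (F.sections U))
instance (U : S) : Module (𝒪.at (π.obj U)) (F.Sec U) :=
  inferInstanceAs (Module (𝒪.at (π.obj U)) (F.sections U))
instance (U : S) : Module ℂ (F.Sec U) := Module.compHom _ (algebraMap ℂ (𝒪.at (π.obj U)))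
instance (U : S) : IsScalarTower ℂ (𝒪.at (π.obj U)) (F.Sec U) :=
  ⟨fun z r s => by rw [Algebra.smul_def, mul_smul]; rfl⟩

lemma complex_smul_def {U : S} (z : ℂ) (s : F.Sec U) :
    z • s = algebraMap ℂ (𝒪.at (π.obj U)) z • s := rfl

lemma res_add {U V : S} (f : U ⟶ V) (s t : F.Sec V) :
    (F.res f (s + t : F.Sec V) : F.Sec U) = (F.res f s : F.Sec U) + (F.res f t : F.Sec U) :=
  (F.map f.op).hom.map_add s t

lemma res_smul {U V : S} (f : U ⟶ V) (r : 𝒪.at (π.obj V)) (s : F.Sec V) :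
    (F.res f (r • s : F.Sec V) : F.Sec U) =
      (𝒪.ring.map (π.map f).op).hom r • (F.res f s : F.Sec U) :=
  (F.map f.op).hom.map_smul r s

/-- The restriction map along a morphism. -/
def restr {U V : S} (f : U ⟶ V) : F.Sec V →ₗ[ℂ] F.Sec U where
  toFun s := F.res f s
  map_add' := F.res_add f
  map_smul' z s := by
    rw [complex_smul_def, res_smul, AlgebraPresheaf.map_algebraMap]; rfl

lemma restr_smul {U V : S} (f : U ⟶ V) (r : 𝒪.at (π.obj V)) (s : F.Sec V) :
    F.restr f (r • s) = (𝒪.ring.map (π.map f).op).hom r • F.restr f s := F.res_smul f r s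

lemma restr_id {U : S} (s : F.Sec U) : F.restr (𝟙 U) s = s :=
  congrArg (fun h => (ModuleCat.Hom.hom h) s) (F.map_id (op U))

lemma restr_comp {U V W : S} (f : U ⟶ V) (g : V ⟶ W) (s : F.Sec W) :
    F.restr (f ≫ g) s = F.restr f (F.restr g s) :=
  PresheafOfModules.map_comp_apply F g.op f.op s

/-- A presheaf of modules from its sections and restriction maps. -/
def ofSec (N : S → Type) [∀ U, AddCommGroup (N U)] [∀ U, Module (𝒪.at (π.obj U)) (N U)]
    (res : ∀ {U V : S}, (U ⟶ V) → N V → N U)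
    (res_add : ∀ {U V : S} (f : U ⟶ V) (s t), res f (s + t) = res f s + res f t)
    (res_smul : ∀ {U V : S} (f : U ⟶ V) (r : 𝒪.at (π.obj V)) (s),
      res f (r • s) = (𝒪.ring.map (π.map f).op).hom r • res f s)
    (res_id : ∀ {U : S} (s : N U), res (𝟙 U) s = s)
    (res_comp : ∀ {U V W : S} (f : U ⟶ V) (g : V ⟶ W) (s), res (f ≫ g) s = res f (res g s)) :
    Modules 𝒪 π where
  obj U := ModuleCat.of (𝒪.at (π.obj U.unop)) (N U.unop)
  map {U V} f := ModuleCat.ofHom (X := N U.unop)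
    (Y := (ModuleCat.restrictScalars (𝒪.ring.map (π.map f.unop).op).hom).obj
      (ModuleCat.of (𝒪.at (π.obj V.unop)) (N V.unop)))
    { toFun := res f.unop
      map_add' := res_add f.unop
      map_smul' := res_smul f.unop }
  map_id U := by
    ext s
    exact res_id s
  map_comp f g := by
    ext s
    exact res_comp _ _ s

variable {F} {F' : Modules 𝒪 π}

/-- A morphism of presheaves of modules from its values on sections. -/
def homMk (φ : ∀ U, F.Sec U →ₗ[𝒪.at (π.obj U)] F'.Sec U)
    (h : ∀ {U V : S} (f : U ⟶ V) s, φ U (F.restr f s) = F'.restr f (φ V s)) : F ⟶ F' where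
  app U := ModuleCat.ofHom (X := F.sections U.unop) (Y := F'.sections U.unop) (φ U.unop)
  naturality {U V} f := by
    ext s
    exact h f.unop s

/-- The value of a morphism on sections. -/
def homSec (φ : F ⟶ F') (U : S) : F.Sec U →ₗ[𝒪.at (π.obj U)] F'.Sec U := (φ.app (op U)).hom

lemma homSec_restr (φ : F ⟶ F') {U V : S} (f : U ⟶ V) (s : F.Sec V) :
    homSec φ U (F.restr f s) = F'.restr f (homSec φ V s) :=
  PresheafOfModules.naturality_apply φ f.op s

lemma hom_ext {φ ψ : F ⟶ F'} (h : ∀ U s, homSec φ U s = homSec ψ U s) : φ = ψ :=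
  PresheafOfModules.hom_ext fun U => ModuleCat.hom_ext (LinearMap.ext (h U.unop))

/-- An isomorphism of presheaves of modules from its values on sections. -/
def isoMk (φ : ∀ U, F.Sec U ≃ₗ[𝒪.at (π.obj U)] F'.Sec U)
    (h : ∀ {U V : S} (f : U ⟶ V) s, φ U (F.restr f s) = F'.restr f (φ V s)) : F ≅ F' where
  hom := homMk (fun U => (φ U).toLinearMap) h
  inv := homMk (fun U => (φ U).symm.toLinearMap) fun {U V} f s => by
    apply (φ U).injective
    refine ((φ U).apply_symm_apply _).trans (Eq.symm ((h f _).trans ?_))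
    exact congrArg _ ((φ V).apply_symm_apply s)
  hom_inv_id := hom_ext fun U s => (φ U).symm_apply_apply s
  inv_hom_id := hom_ext fun U s => (φ U).apply_symm_apply s

end Modules
end

section
universe v u w₁ w₂ w₃ w₄ w₅
variable {C : Type u} [Category.{v} C] {𝒢 : Geometry C} {𝒪 : AlgebraPresheaf C}
  {S : Type w₁} [Category.{w₂} S] {π : S ⥤ C}

open Limits in
/-- The sheaf condition for a presheaf of abelian groups depends only on the sets of sections. -/
lemma isSheaf_iff_forget (J : GrothendieckTopology S) (P : Sᵒᵖ ⥤ Ab.{0}) :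
    Presheaf.IsSheaf J P ↔ Presieve.IsSheaf J (P ⋙ forget Ab) := by
  constructor
  · intro h
    exact Presieve.isSheaf_iso J (Functor.isoWhiskerLeft P AddCommGrpCat.coyonedaObjIsoForget) (h _)
  · intro h A X R hR x hx
    -- Homomorphisms into the groups of sections are glued pointwise.
    have hc : ∀ a : A, Presieve.FamilyOfElements.Compatible (P := P ⋙ forget Ab)
        (fun Y f hf => (x f hf).hom a) := fun a Y₁ Y₂ Z g₁ g₂ f₁ f₂ h₁ h₂ e =>
      congrArg (fun k => (AddCommGrpCat.Hom.hom k) a) (hx g₁ g₂ h₁ h₂ e)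
    choose t ht htu using fun a : A => h R hR _ (hc a)
    have hadd : ∀ a b, t (a + b) = (t a + t b : P.obj (op X)) := fun a b =>
      (htu (a + b) _ fun Y f hf => by
        refine ((P.map f.op).hom.map_add (t a) (t b)).trans ?_
        refine Eq.trans ?_ ((x f hf).hom.map_add a b).symm
        exact congrArg₂ _ (ht a f hf) (ht b f hf)).symm
    refine ⟨AddCommGrpCat.ofHom (AddMonoidHom.mk' t hadd), fun Y f hf => ?_, fun y hy => ?_⟩
    · refine AddCommGrpCat.hom_ext (AddMonoidHom.ext fun a => ?_)
      exact ht a f hf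
    · refine AddCommGrpCat.hom_ext (AddMonoidHom.ext fun a => ?_)
      exact htu a _ fun Y f hf => congrArg (fun k => (AddCommGrpCat.Hom.hom k) a) (hy f hf)

/-- The sheaf condition for a presheaf of modules, on the charts of an atlas. -/
theorem Atlas.isSheaf_modules_iff {I : Type w₃} {B : Type w₄} [Category.{w₅} B] (A : Atlas 𝒢 π I B)
    (F : Modules 𝒪 π) : IsSheaf 𝒢 F ↔ A.Glues (fun i U => F.Sec ((A.chart i).obj U))
      (fun i _ _ e s => F.restr ((A.chart i).map e) s) :=
  (isSheaf_iff_forget _ _).trans (A.isSheaf_iff _)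

end

/-! ### Intertwiners with a prescribed target -/

namespace Intertwiners
variable {G : Type} [Group G] {D : UnitaryDual G} (T : Intertwiners D)

/-- The intertwiner `T ν i`, with its target `V (act ν i)` written as `V k` for `k = act ν i`. -/
def into (ν : MulAut G) {i k : D.Idx} (h : T.act ν i = k) : D.V i ≃ₗ[ℂ] D.V k :=
  h.rec (T.T ν i).toLinearEquiv

lemma mk_into (ν : MulAut G) {i k : D.Idx} (h : T.act ν i = k) (v : D.V i) :
    (⟨k, T.into ν h v⟩ : D.Total) = T.map ν ⟨i, v⟩ := by
  subst h; rfl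

lemma into_rep (ν : MulAut G) {i k : D.Idx} (h : T.act ν i = k) (g : G) (v : D.V i) :
    T.into ν h (D.rep i (ν g) v) = D.rep k g (T.into ν h v) := by
  subst h; exact T.T_rep ν i g v

lemma into_one {i : D.Idx} (h : T.act 1 i = i) (v : D.V i) : T.into 1 h v = v :=
  eq_of_heq (Sigma.mk.inj ((T.mk_into 1 h v).trans (T.T_one i v))).2

/-- Intertwiners compose up to a scalar and an inner correction; the scalar is the value of the
cocycle `c`. -/
lemma into_into {ν₁ ν₂ ν₁₂ : MulAut G} {τ : G} (hν : ν₁ * ν₂ = MulAut.conj τ * ν₁₂)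
    {i k l : D.Idx} (h₁ : T.act ν₁ i = k) (h₂ : T.act ν₂ k = l) (h₁₂ : T.act ν₁₂ i = l)
    (v : D.V i) :
    T.into ν₂ h₂ (T.into ν₁ h₁ v) =
      (T.scalar i ν₁ ν₂ ν₁₂ τ : ℂ) • T.into ν₁₂ h₁₂ (D.rep i τ⁻¹ v) := by
  subst h₁ h₂
  refine eq_of_heq (Sigma.mk.inj ((T.scalar_spec hν ⟨i, v⟩).trans ?_)).2
  change D.smul _ (T.map ν₁₂ ⟨i, D.rep i τ⁻¹ v⟩) = _
  rw [← T.mk_into ν₁₂ h₁₂]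
  rfl

lemma act_injective (ν : MulAut G) : Function.Injective (T.act ν) := fun i k h => by
  have e : ∀ l, T.act ν⁻¹ (T.act ν l) = l := fun l =>
    (T.act_act (ν₁₂ := 1) (τ := 1) (by simp) l).trans (congrArg Sigma.fst (T.T_one l 0))
  rw [← e i, h, e]

end Intertwiners

section
universe v u
variable {C : Type u} [Category.{v} C] {𝒢 : Geometry C} {M : C} {G : Type} [Group G] [Finite G]
  {E : GerbeExtension 𝒢 G M} {D : UnitaryDual G} {T : Intertwiners D} {𝒪 : AlgebraPresheaf C}

/-! ### Twisted sheaves -/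

lemma IsTwisted.restr_central {W : Modules 𝒪 (DualChart.forget E T)} (hW : IsTwisted W)
    (U : DualChart E T) (z : Circle) (s : W.Sec U) : W.restr (U.central z) s = (z : ℂ) • s :=
  hW U z s

/-- Restrictions along morphisms which differ by a phase differ by a scalar. -/
lemma IsTwisted.restr_eq {W : Modules 𝒪 (DualChart.forget E T)} (hW : IsTwisted W)
    {U V : DualChart E T} {a b : U ⟶ V} (h : a.hom = b.hom) (h' : a.arr = b.arr) (z : Circle)
    (hz : ∀ x, a.phase x = z * b.phase x) (s : W.Sec V) :
    W.restr a s = (z : ℂ) • W.restr b s := by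
  suffices key : a = U.central z ≫ b by
    rw [← hW.restr_central, ← W.restr_comp, key]
  refine DualChart.Hom.ext (h.trans (Category.id_comp b.hom).symm) ?_
    (LocallyConstant.ext fun x => ?_)
  · refine h'.trans (Eq.symm ?_)
    refine (E.Q.mul_congr rfl (Category.id_comp b.arr) _).trans (E.Q.one_mul' U.map b.arr ?_)
    exact b.arr_src.symm
  · rw [hz, DualChart.comp_phase]
    refine Eq.trans ?_ (congrArg (· * _) (DualChart.cocycle_one_left' U.map rfl _ x)).symm
    have : 𝒢.space.map (DualChart.Hom.hom (U.central z)) x = x := by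
      change 𝒢.space.map (𝟙 U.dom) x = x
      simp
    rw [this, one_mul]
    rfl

end

/-! ### Decomposition of the arrows of the gerbe -/

/-- The rearrangement `u k t s = (u p) (l r)` of a composite of arrows if `k p = p l` and
`t s = p r`. -/
lemma EtaleGroupoid.mul_rearrange {C : Type*} [Category* C] {𝒢 : Geometry C} {M : C}
    (X : EtaleGroupoid 𝒢 M) {U : C} {u k t s p r l : U ⟶ X.arr}
    (huk : u ≫ X.tgt = k ≫ X.src) (hkt : k ≫ X.tgt = t ≫ X.src) (hts : t ≫ X.tgt = s ≫ X.src)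
    (hkp : k ≫ X.tgt = p ≫ X.src) (hpl : p ≫ X.tgt = l ≫ X.src) (hpr : p ≫ X.tgt = r ≫ X.src)
    (hlr : l ≫ X.tgt = r ≫ X.src) (hup : u ≫ X.tgt = p ≫ X.src)
    (e : X.mul k p hkp = X.mul p l hpl) (e' : X.mul t s hts = X.mul p r hpr) :
    X.mul (X.mul (X.mul u k huk) t (by rw [X.mul_tgt, hkt])) s (by rw [X.mul_tgt, hts]) =
      X.mul (X.mul u p hup) (X.mul l r hlr) (by rw [X.mul_tgt, X.mul_src, hpl]) := by
  rw [X.mul_assoc _ _ _ _ hts, X.mul_congr rfl e',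
    X.mul_assoc _ _ _ huk (by rw [X.mul_src, hkp]),
    X.mul_congr rfl (X.mul_assoc k p r hkp hpr).symm, X.mul_congr rfl (X.mul_congr e rfl _),
    X.mul_congr rfl (X.mul_assoc p l r hpl hlr),
    ← X.mul_assoc _ _ _ hup (by rw [X.mul_src, hpl])]

namespace GerbeExtension
universe v u
variable {C : Type u} [Category.{v} C] {𝒢 : Geometry C} {M : C} {G : Type} [Group G]
  (E : GerbeExtension 𝒢 G M)

lemma exists_fiberPart {U : C} (a : U ⟶ E.H.arr) : ∃ g, E.H.mul (E.incl (a ≫ E.H.src) g)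
    ((a ≫ E.j) ≫ E.sec) (by simp [E.incl_tgt, E.sec_src, E.j_src]) = a := by
  obtain ⟨g, hg⟩ := E.exists_diff a ((a ≫ E.j) ≫ E.sec) (by simp [E.sec_j])
  refine ⟨g, (E.H.mul_congr ?_ rfl _).trans hg⟩
  simp [E.sec_src, E.j_src]

/-- The factor `g` in the decomposition `a = g σ(j(a))` of an arrow of `H`. -/
def fiberPart {U : C} (a : U ⟶ E.H.arr) : LocallyConstant (𝒢.space.obj U) G :=
  (E.exists_fiberPart a).choose

lemma fiberPart_spec {U : C} (a : U ⟶ E.H.arr) {m : U ⟶ M} (hm : a ≫ E.H.src = m) :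
    E.H.mul (E.incl m (E.fiberPart a)) ((a ≫ E.j) ≫ E.sec)
      (by simp [E.incl_tgt, E.sec_src, E.j_src, hm]) = a := by
  subst hm
  exact (E.exists_fiberPart a).choose_spec

lemma fiberPart_eq {U : C} (a : U ⟶ E.H.arr) (q : U ⟶ E.Q.arr) {m : U ⟶ M}
    (g : LocallyConstant (𝒢.space.obj U) G) (h : E.incl m g ≫ E.H.tgt = (q ≫ E.sec) ≫ E.H.src)
    (e : E.H.mul (E.incl m g) (q ≫ E.sec) h = a) : E.fiberPart a = g := by
  have hm : a ≫ E.H.src = m := by rw [← e, E.H.mul_src, E.incl_src]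
  have hq : a ≫ E.j = q := by
    rw [← e, E.mul_j, E.Q.mul_congr (E.incl_j m g)
      (show (q ≫ E.sec) ≫ E.j = q by rw [Category.assoc, E.sec_j, Category.comp_id]),
      E.Q.one_mul' m q (by rw [← E.incl_tgt m g, h, Category.assoc, E.sec_src])]
  subst hq
  exact E.diff_unique m m _ rfl _ _ ((E.fiberPart_spec a hm).trans e.symm)

lemma fiberPart_comp {U V : C} (f : V ⟶ U) (a : U ⟶ E.H.arr) :
    E.fiberPart (f ≫ a) = (E.fiberPart a).comap (𝒢.space.map f).hom := by
  refine E.fiberPart_eq _ (f ≫ a ≫ E.j) (m := f ≫ a ≫ E.H.src) _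
    (by simp [E.incl_tgt, E.sec_src, E.j_src]) ?_
  refine Eq.trans ?_ (congrArg (f ≫ ·) (E.fiberPart_spec a rfl))
  rw [E.H.comp_mul]
  exact E.H.mul_congr (E.comp_incl _ _ _).symm (by simp) _

lemma fiberPart_one {U : C} (m : U ⟶ M) : E.fiberPart (m ≫ E.H.one) = 1 := by
  refine E.fiberPart_eq _ (m ≫ E.Q.one) (m := m) _ (by
    simp [E.incl_tgt, E.sec_src, E.Q.one_src]) ?_
  rw [E.H.mul_congr (E.incl_one m) rfl, E.H.one_mul' _ _ (by
    simp [E.sec_src, E.Q.one_src]), Category.assoc, E.one_sec]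

/-- The group law of `H` in terms of the decomposition:
`g σ(p) g' σ(q) = g Ad_{σ(p)}(g') τ(p, q) σ(p q)`. -/
lemma fiberPart_mul {U : C} (a b : U ⟶ E.H.arr) (h : a ≫ E.H.tgt = b ≫ E.H.src) :
    E.fiberPart (E.H.mul a b h) = E.fiberPart a *
      E.conj ((a ≫ E.j) ≫ E.sec) (E.fiberPart b) *
        E.tau (a ≫ E.j) (b ≫ E.j) (by simp [E.j_src, E.j_tgt, h]) := by
  set p := a ≫ E.j with hp
  set q := b ≫ E.j with hq
  have hpq : p ≫ E.Q.tgt = q ≫ E.Q.src := by simp [hp, hq, E.j_src, E.j_tgt, h]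
  have hps : (p ≫ E.sec) ≫ E.H.src = a ≫ E.H.src := by simp [hp, E.sec_src, E.j_src]
  have hpt : (p ≫ E.sec) ≫ E.H.tgt = b ≫ E.H.src := by simp [hp, E.sec_tgt, E.j_tgt, h]
  have hqs : (q ≫ E.sec) ≫ E.H.src = b ≫ E.H.src := by simp [hq, E.sec_src, E.j_src]
  have hs : (E.Q.mul p q hpq ≫ E.sec) ≫ E.H.src = a ≫ E.H.src := by
    rw [Category.assoc, E.sec_src, E.Q.mul_src]; simp [hp, E.j_src]
  refine E.fiberPart_eq _ (E.Q.mul p q hpq) (m := a ≫ E.H.src) _ (by rw [E.incl_tgt, hs]) ?_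
  have e₁ := E.fiberPart_spec a rfl
  have e₂ := E.fiberPart_spec b rfl
  have e₃ := E.conj_spec' (p ≫ E.sec) (E.fiberPart b) (a ≫ E.H.src) (b ≫ E.H.src) hps.symm hpt.symm
  have e₄ : E.H.mul (E.incl (a ≫ E.H.src) (E.tau p q hpq)) (E.Q.mul p q hpq ≫ E.sec)
      (by rw [E.incl_tgt, hs]) = E.H.mul (p ≫ E.sec) (q ≫ E.sec) (by rw [hpt, hqs]) :=
    (E.H.mul_congr (congrArg (E.incl · _) (by simp [hp, E.j_src])) rfl _).trans (E.tau_spec p q hpq)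
  have h₁ : ∀ g g' : LocallyConstant (𝒢.space.obj U) G,
      E.incl (a ≫ E.H.src) g ≫ E.H.tgt = E.incl (a ≫ E.H.src) g' ≫ E.H.src := fun g g' => by
    rw [E.incl_tgt, E.incl_src]
  refine Eq.trans ?_ ((E.H.mul_rearrange (h₁ _ _) (h₁ _ _) (by rw [E.incl_tgt, hs])
    (by rw [E.incl_tgt, hps]) (by rw [hpt, E.incl_src]) (by rw [hpt, hqs])
    (by rw [E.incl_tgt, hqs]) (by rw [E.incl_tgt, hps]) e₃ e₄).trans (E.H.mul_congr e₁ e₂ _))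
  exact E.H.mul_congr ((E.incl_mul _ _ _).trans (E.H.mul_congr (E.incl_mul _ _ _) rfl _)) rfl _

end GerbeExtension

/-! ### Arrows of the gerbe with constant data -/

namespace Intertwiners
variable {G : Type} [Group G] {D : UnitaryDual G} (T : Intertwiners D)

/-- The transpose `l ↦ l ∘ ρ_i(g) ∘ T_ν⁻¹` of the action of an arrow `g σ(q)` with
`Ad_{σ(q)} = ν`. -/
def codual (g : G) (ν : MulAut G) {i k : D.Idx} (h : T.act ν i = k) :
    Module.Dual ℂ (D.V i) →ₗ[ℂ] Module.Dual ℂ (D.V k) :=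
  LinearMap.dualMap (D.rep i g ∘ₗ (T.into ν h).symm.toLinearMap)

lemma codual_apply (g : G) (ν : MulAut G) {i k : D.Idx} (h : T.act ν i = k)
    (l : Module.Dual ℂ (D.V i)) (v : D.V k) :
    T.codual g ν h l v = l (D.rep i g ((T.into ν h).symm v)) := rfl

lemma codual_into (g : G) (ν : MulAut G) {i k : D.Idx} (h : T.act ν i = k)
    (l : Module.Dual ℂ (D.V i)) (v : D.V i) :
    T.codual g ν h l (T.into ν h v) = l (D.rep i g v) := by
  rw [codual_apply, LinearEquiv.symm_apply_apply]

lemma codual_one {i : D.Idx} (h : T.act 1 i = i) (l : Module.Dual ℂ (D.V i)) :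
    T.codual 1 1 h l = l := by
  refine LinearMap.ext fun v => ?_
  obtain ⟨w, rfl⟩ := (T.into 1 h).surjective v
  rw [codual_into, _root_.map_one, T.into_one]
  rfl

/-- The scalar by which the transposes fail to be multiplicative is the value of the cocycle `c`, so
that it cancels against the one in `IsConst.restr_along`. -/
lemma codual_codual {ν ν' ν'' : MulAut G} {g g' g'' : G}
    (hν : ν * ν' = MulAut.conj ((g * ν g')⁻¹ * g'') * ν'')
    {i k l : D.Idx} (h₁ : T.act ν i = k) (h₂ : T.act ν' k = l) (h₁₂ : T.act ν'' i = l)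
    (f : Module.Dual ℂ (D.V i)) :
    (T.scalar i ν ν' ν'' ((g * ν g')⁻¹ * g'') : ℂ) • T.codual g' ν' h₂ (T.codual g ν h₁ f) =
      T.codual g'' ν'' h₁₂ f := by
  refine LinearMap.ext fun v => ?_
  obtain ⟨v, rfl⟩ := (T.into ν' h₂).surjective v
  obtain ⟨v, rfl⟩ := (T.into ν h₁).surjective v
  rw [LinearMap.smul_apply, codual_into, ← T.into_rep, codual_into, T.into_into hν h₁ h₂ h₁₂,
    _root_.map_smul, codual_into, ← Module.End.mul_apply, ← Module.End.mul_apply, ← _root_.map_mul,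
    ← _root_.map_mul]
  exact congrArg (fun x => _ • f (D.rep i x v)) (by group)

end Intertwiners

section
universe v u
variable {C : Type u} [Category.{v} C] {𝒢 : Geometry C} {M : C} {G : Type} [Group G] [Finite G]
  {E : GerbeExtension 𝒢 G M} {D : UnitaryDual G} {T : Intertwiners D} {𝒪 : AlgebraPresheaf C}

namespace Chart

/-- The arrow of the groupoid underlying `a` is `g σ(q)` with `g` constant and `Ad_{σ(q)}`
constantly `ν`. -/
structure IsConst {U V : Chart E.H} (a : U ⟶ V) (g : G) (ν : MulAut G) : Prop where
  fiber_eq : ∀ x : 𝒢.space.obj U.dom, E.fiberPart a.arr x = g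
  ad_eq : ∀ x : 𝒢.space.obj U.dom, E.ad ((a.arr ≫ E.j) ≫ E.sec) x = ν

lemma IsConst.of_arr_eq {U V : Chart E.H} {a : U ⟶ V} {g : G} {ν : MulAut G}
    (h : E.incl U.map (.const _ g) ≫ E.H.tgt = ((a.arr ≫ E.j) ≫ E.sec) ≫ E.H.src)
    (e : a.arr = E.H.mul (E.incl U.map (.const _ g)) ((a.arr ≫ E.j) ≫ E.sec) h)
    (hν : ∀ x : 𝒢.space.obj U.dom, E.ad ((a.arr ≫ E.j) ≫ E.sec) x = ν) : IsConst a g ν :=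
  ⟨fun x => by rw [E.fiberPart_eq a.arr _ _ h e.symm]; rfl, hν⟩

lemma isConst_ofEtale {U V : EtaleOver 𝒢 M} (e : U ⟶ V) : IsConst ((ofEtale E.H).map e) 1 1 := by
  refine ⟨fun x => ?_, fun x => ?_⟩
  · rw [arr_ofEtale, E.fiberPart_one]; rfl
  · rw [arr_ofEtale, Category.assoc U.map, E.one_j, Category.assoc, E.one_sec, E.ad_one]

lemma IsConst.ofEtale_comp {U' U : EtaleOver 𝒢 M} (e : U' ⟶ U) {V : Chart E.H}
    {a : (ofEtale E.H).obj U ⟶ V} {g : G} {ν : MulAut G} (h : IsConst a g ν) :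
    IsConst ((ofEtale E.H).map e ≫ a) g ν := by
  refine ⟨fun x => ?_, fun x => ?_⟩
  · rw [ofEtale_comp_arr, E.fiberPart_comp]
    exact h.fiber_eq _
  · rw [ofEtale_comp_arr, Category.assoc, Category.assoc, E.ad_comp, ← Category.assoc]
    exact h.ad_eq _

/-- Near every point of its source, a morphism of charts has constant data. -/
lemma exists_isConst_nhd {U : EtaleOver 𝒢 M} {V : Chart E.H}
    (a : (ofEtale E.H).obj U ⟶ V) (x : 𝒢.space.obj U.dom) :
    ∃ (N : Set (𝒢.space.obj U.dom)) (g : G) (ν : MulAut G), IsOpen N ∧ x ∈ N ∧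
      ∀ (U' : EtaleOver 𝒢 M) (e : U' ⟶ U), Set.range (𝒢.space.map e.hom) ⊆ N →
        IsConst ((ofEtale E.H).map e ≫ a) g ν := by
  refine ⟨_, E.fiberPart a.arr x, E.ad ((a.arr ≫ E.j) ≫ E.sec) x,
    ((E.fiberPart a.arr).isLocallyConstant.prodMk
      (E.isLocallyConstant_ad ((a.arr ≫ E.j) ≫ E.sec))) {(E.fiberPart a.arr x, _)}, rfl,
    fun U' e he => ⟨fun y => ?_, fun y => ?_⟩⟩
  · rw [ofEtale_comp_arr, E.fiberPart_comp]
    exact congrArg Prod.fst (he ⟨y, rfl⟩)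
  · rw [ofEtale_comp_arr, Category.assoc, Category.assoc, E.ad_comp, ← Category.assoc]
    exact congrArg Prod.snd (he ⟨y, rfl⟩)

lemma exists_isConst (h𝒢 : 𝒢.IsRegular) {U : EtaleOver 𝒢 M} {V : Chart E.H}
    (a : (ofEtale E.H).obj U ⟶ V) (x : 𝒢.space.obj U.dom) :
    ∃ (U' : EtaleOver 𝒢 M) (e : U' ⟶ U) (g : G) (ν : MulAut G),
      x ∈ Set.range (𝒢.space.map e.hom) ∧ IsConst ((ofEtale E.H).map e ≫ a) g ν := by
  obtain ⟨N, g, ν, hN, hx, h⟩ := exists_isConst_nhd a x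
  obtain ⟨U', e, hx, he⟩ := U.exists_nhd h𝒢 x N hN hx
  exact ⟨U', e, g, ν, hx, h U' e he⟩

section comp
variable {U V W : Chart E.H} {a : U ⟶ V} {b : V ⟶ W} {g g' g'' : G} {ν ν' ν'' : MulAut G}

omit [Finite G] in
lemma composable (a : U ⟶ V) (b : V ⟶ W) :
    (a.arr ≫ E.j) ≫ E.Q.tgt = (a.hom ≫ b.arr ≫ E.j) ≫ E.Q.src := by
  simp [E.j_src, E.j_tgt, a.arr_tgt, b.arr_src]

omit [Finite G] in
lemma comp_arr_j (a : U ⟶ V) (b : V ⟶ W) : (a ≫ b).arr ≫ E.j =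
    E.Q.mul (a.arr ≫ E.j) (a.hom ≫ b.arr ≫ E.j) (composable a b) :=
  (E.mul_j _ _ _).trans (E.Q.mul_congr rfl (Category.assoc _ _ _) _)

lemma IsConst.tau_eq (ha : IsConst a g ν) (hb : IsConst b g' ν') (hab : IsConst (a ≫ b) g'' ν'')
    (x : 𝒢.space.obj U.dom) :
    E.tau (a.arr ≫ E.j) (a.hom ≫ b.arr ≫ E.j) (composable a b) x = (g * ν g')⁻¹ * g'' := by
  have h := congrArg (fun k => k x) (E.fiberPart_mul a.arr (a.hom ≫ b.arr)
    (by simp [a.arr_tgt, b.arr_src]))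
  have h' : ∀ (r : U.dom ⟶ E.Q.arr) (hr : (a.arr ≫ E.j) ≫ E.Q.tgt = r ≫ E.Q.src),
      r = a.hom ≫ b.arr ≫ E.j → E.tau (a.arr ≫ E.j) r hr x =
        E.tau (a.arr ≫ E.j) (a.hom ≫ b.arr ≫ E.j) (composable a b) x := by
    rintro r hr rfl; rfl
  change E.fiberPart (a ≫ b).arr x = E.fiberPart a.arr x * E.conj _ _ x * E.tau _ _ _ x at h
  rw [hab.fiber_eq, ha.fiber_eq, ← E.ad_apply, ha.ad_eq, E.fiberPart_comp,
    h' _ _ (Category.assoc _ _ _)] at h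
  have hb' : (E.fiberPart b.arr).comap (𝒢.space.map a.hom).hom x = g' := hb.fiber_eq _
  rw [h, hb', inv_mul_cancel_left]

lemma IsConst.ad_mul (ha : IsConst a g ν) (hb : IsConst b g' ν') (hab : IsConst (a ≫ b) g'' ν'')
    (x : 𝒢.space.obj U.dom) : ν * ν' = MulAut.conj ((g * ν g')⁻¹ * g'') * ν'' := by
  have h := E.ad_tau _ _ (composable a b) x
  rw [ha.tau_eq hb hab, ← comp_arr_j, hab.ad_eq, ha.ad_eq, Category.assoc, E.ad_comp,
    hb.ad_eq] at h
  exact h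

end comp

variable (T) in
/-- The morphism of the dual, of phase one, defined by a morphism of charts with constant data. -/
def IsConst.along {U V : Chart E.H} {a : U ⟶ V} {g : G} {ν : MulAut G} (h : IsConst a g ν)
    {i k : D.Idx} (hk : T.act ν i = k) : U.toDual T i ⟶ V.toDual T k where
  hom := a.hom
  arr := a.arr ≫ E.j
  arr_src := by simpa [E.j_src] using a.arr_src
  arr_tgt := by simpa [E.j_tgt] using a.arr_tgt
  act_idx x := by rw [h.ad_eq x, hk]
  phase := 1

lemma along_ofEtale {U V : EtaleOver 𝒢 M} (e : U ⟶ V) {i : D.Idx} (h : T.act 1 i = i) :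
    (isConst_ofEtale (E := E) e).along T h = (DualChart.ofEtale E T i).map e :=
  DualChart.Hom.ext rfl ((Category.assoc _ _ _).trans (congrArg (U.map ≫ ·) E.one_j)) rfl

/-- Composites of arrows with constant data act on twisted sheaves up to the cocycle `c`. -/
lemma IsConst.restr_along {W : Modules 𝒪 (DualChart.forget E T)} (hW : IsTwisted W)
    {U V X : Chart E.H} {a : U ⟶ V} {b : V ⟶ X} {g g' g'' : G} {ν ν' ν'' : MulAut G}
    (ha : IsConst a g ν) (hb : IsConst b g' ν') (hab : IsConst (a ≫ b) g'' ν'')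
    {i k l : D.Idx} (h₁ : T.act ν i = k) (h₂ : T.act ν' k = l) (h₁₂ : T.act ν'' i = l)
    (s : W.Sec (X.toDual T l)) :
    W.restr (ha.along T h₁) (W.restr (hb.along T h₂) s) =
      (T.scalar i ν ν' ν'' ((g * ν g')⁻¹ * g'') : ℂ) • W.restr (hab.along T h₁₂) s := by
  rw [← W.restr_comp]
  refine hW.restr_eq (a := ha.along T h₁ ≫ hb.along T h₂) (b := hab.along T h₁₂) rfl
    (comp_arr_j a b).symm _ (fun x => ?_) s
  change T.scalar i _ _ _ _ * (1 * 1) = _ * 1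
  rw [mul_one, mul_one, mul_one]
  congr 1
  · exact ha.ad_eq x
  · change E.ad ((a.hom ≫ b.arr ≫ E.j) ≫ E.sec) x = ν'
    rw [Category.assoc, E.ad_comp, hb.ad_eq]
  · refine Eq.trans ?_ (hab.ad_eq x)
    rw [comp_arr_j a b]; rfl
  · exact ha.tau_eq hb hab x

end Chart
end

namespace Atlas.LocalPresheaf
universe v u w₁ w₂ w₃ w₄ w₅ w₆
variable {C : Type u} [Category.{v} C] {𝒢 : Geometry C} {S : Type w₁} [Category.{w₂} S] {π : S ⥤ C}
  {I : Type w₃} {B : Type w₄} [Category.{w₅} B] {A : Atlas 𝒢 π I B}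
  {F : I → B → Type w₆} (P : A.LocalPresheaf F) {i k : I} {U V : B}

lemma extend_eq (a : (A.chart i).obj U ⟶ (A.chart k).obj V) {s : F k V} {t : F i U}
    (h : ∀ (U' : B) (e : U' ⟶ U) L, P.Rel ((A.chart i).map e ≫ a) L → P.res i e t = L s) :
    P.extend a s = t := by
  refine P.ext_local fun x => ?_
  obtain ⟨U', e, L, hx, hL⟩ := P.exists_rel a x
  exact ⟨U', e, hx, (P.res_extend a s e hL).trans (h _ e L hL).symm⟩

lemma extend_add [∀ i U, AddCommGroup (F i U)]
    (h : ∀ {i U V} (e : U ⟶ V) (s t), P.res i e (s + t) = P.res i e s + P.res i e t)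
    (h' : ∀ {i k U V} (a : (A.chart i).obj U ⟶ (A.chart k).obj V) L, P.Rel a L →
      ∀ s t, L (s + t) = L s + L t)
    (a : (A.chart i).obj U ⟶ (A.chart k).obj V) (s t : F k V) :
    P.extend a (s + t) = P.extend a s + P.extend a t :=
  P.extend_eq a fun U' e L hL => by
    rw [h, h' _ L hL, P.res_extend a s e hL, P.res_extend a t e hL]

lemma extend_smul {𝒪 : AlgebraPresheaf C} [∀ i U, AddCommGroup (F i U)]
    [∀ i U, Module (𝒪.at (π.obj ((A.chart i).obj U))) (F i U)]
    (h : ∀ {i U V} (e : U ⟶ V) (r) (s : F i V), P.res i e (r • s) =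
      (𝒪.ring.map (π.map ((A.chart i).map e)).op).hom r • P.res i e s)
    (h' : ∀ {i k U V} (a : (A.chart i).obj U ⟶ (A.chart k).obj V) L, P.Rel a L →
      ∀ r s, L (r • s) = (𝒪.ring.map (π.map a).op).hom r • L s)
    (a : (A.chart i).obj U ⟶ (A.chart k).obj V) (r) (s : F k V) :
    P.extend a (r • s) = (𝒪.ring.map (π.map a).op).hom r • P.extend a s :=
  P.extend_eq a fun U' e L hL => by
    rw [h, h' _ L hL, P.res_extend a s e hL, Functor.map_comp, op_comp, Functor.map_comp]
    rfl

end Atlas.LocalPresheaf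

/-! ### From twisted sheaves on the dual to sheaves on the gerbe -/

section
universe v u
variable {C : Type u} [Category.{v} C] {𝒢 : Geometry C} {M : C} {G : Type} [Group G] [Finite G]
  {E : GerbeExtension 𝒢 G M} {D : UnitaryDual G} {T : Intertwiners D} {𝒪 : AlgebraPresheaf C}

/-- The sections over `U` of the sheaf corresponding to a twisted sheaf: a family of elements of
`W(U, i) ⊗ V_i`, regarded as linear maps from the dual of `V_i` to `W(U, i)`. -/
def TensorSec (W : Modules 𝒪 (DualChart.forget E T)) (U : Chart E.H) : Type :=
  ∀ i, Module.Dual ℂ (D.V i) →ₗ[ℂ] W.Sec (U.toDual T i)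

namespace TensorSec
variable {W : Modules 𝒪 (DualChart.forget E T)}

instance (U : Chart E.H) (i : D.Idx) : Module (𝒪.at U.dom) (W.Sec (U.toDual T i)) :=
  inferInstanceAs (Module (𝒪.at ((DualChart.forget E T).obj (U.toDual T i))) _)

instance (U : Chart E.H) (i : D.Idx) : IsScalarTower ℂ (𝒪.at U.dom) (W.Sec (U.toDual T i)) :=
  inferInstanceAs (IsScalarTower ℂ (𝒪.at ((DualChart.forget E T).obj (U.toDual T i))) _)

instance (U : Chart E.H) : AddCommGroup (TensorSec W U) :=
  inferInstanceAs (AddCommGroup (∀ i, Module.Dual ℂ (D.V i) →ₗ[ℂ] W.Sec (U.toDual T i)))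

instance (U : Chart E.H) : Module (𝒪.at U.dom) (TensorSec W U) :=
  inferInstanceAs (Module (𝒪.at U.dom) (∀ i, Module.Dual ℂ (D.V i) →ₗ[ℂ] W.Sec (U.toDual T i)))

instance (U : Chart E.H) : Module (𝒪.at ((Chart.forget E.H).obj U)) (TensorSec W U) :=
  inferInstanceAs (Module (𝒪.at U.dom) (TensorSec W U))

lemma ext {U : Chart E.H} {s t : TensorSec W U} (h : ∀ i l, s i l = t i l) : s = t :=
  funext fun i => LinearMap.ext (h i)

/-- The restriction along a morphism of étale objects over `M`. -/
def res {U V : EtaleOver 𝒢 M} (e : U ⟶ V) (s : TensorSec W ((Chart.ofEtale E.H).obj V)) :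
    TensorSec W ((Chart.ofEtale E.H).obj U) :=
  fun i => W.restr ((DualChart.ofEtale E T i).map e) ∘ₗ s i

/-- The restriction along a morphism of charts with constant data. -/
def push {U V : Chart E.H} {a : U ⟶ V} {g : G} {ν : MulAut G} (h : Chart.IsConst a g ν)
    (s : TensorSec W V) : TensorSec W U :=
  fun i => W.restr (h.along T rfl) ∘ₗ s (T.act ν i) ∘ₗ T.codual g ν rfl

lemma push_apply {U V : Chart E.H} {a : U ⟶ V} {g : G} {ν : MulAut G} (h : Chart.IsConst a g ν)
    (s : TensorSec W V) {i k : D.Idx} (hk : T.act ν i = k) (l : Module.Dual ℂ (D.V i)) :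
    push h s i l = W.restr (h.along T hk) (s k (T.codual g ν hk l)) := by
  subst hk; rfl

/-- The restrictions along morphisms with constant data are functorial: the cocycle of the twisted
sheaf and that of the intertwiners cancel. -/
lemma push_push (hW : IsTwisted W) {U V X : Chart E.H} {a : U ⟶ V} {b : V ⟶ X} {g g' g'' : G}
    {ν ν' ν'' : MulAut G} (ha : Chart.IsConst a g ν) (hb : Chart.IsConst b g' ν')
    (hab : Chart.IsConst (a ≫ b) g'' ν'') (x : 𝒢.space.obj U.dom) (s : TensorSec W X) :
    push ha (push hb s) = push hab s := by
  have hν := ha.ad_mul hb hab x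
  refine TensorSec.ext fun i l => ?_
  have h₁₂ : T.act ν'' i = T.act ν' (T.act ν i) := (T.act_act hν i).symm
  rw [push_apply ha _ rfl, push_apply hb _ rfl, push_apply hab _ h₁₂,
    ha.restr_along hW hb hab rfl rfl h₁₂, ← _root_.map_smul, ← _root_.map_smul,
    T.codual_codual hν rfl rfl h₁₂]

lemma push_ofEtale {U V : EtaleOver 𝒢 M} (e : U ⟶ V)
    (s : TensorSec W ((Chart.ofEtale E.H).obj V)) : push (Chart.isConst_ofEtale e) s = res e s := by
  refine TensorSec.ext fun i l => ?_
  have h : T.act 1 i = i := DualChart.act_one i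
  rw [push_apply _ _ h, T.codual_one, Chart.along_ofEtale]
  rfl

lemma glues (h𝒢 : 𝒢.IsRegular) (hW : IsSheaf 𝒢 W) : (Chart.atlas E.H h𝒢).Glues
    (fun _ U => TensorSec W ((Chart.ofEtale E.H).obj U)) (fun _ _ _ e s => res e s) := by
  intro _ U J V e he s hs
  have hW' := fun i => ((DualChart.atlas E T h𝒢).isSheaf_modules_iff W).1 hW i U J V e he
  choose t ht htu using fun i l => hW' i (fun j => s j i l) fun j k Z d d' hd =>
    LinearMap.congr_fun (congrFun (hs j k Z d d' hd) i) l
  refine ⟨fun i => ⟨⟨t i, fun l l' => ?_⟩, fun z l => ?_⟩, fun j => ?_, fun y hy => ?_⟩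
  · refine (htu i (l + l') _ fun j => ?_).symm
    refine ((W.restr _).map_add _ _).trans ?_
    refine (congrArg₂ _ (ht i l j) (ht i l' j)).trans ((s j i).map_add l l').symm
  · refine (htu i (z • l) _ fun j => ?_).symm
    refine ((W.restr _).map_smul z _).trans ?_
    exact (congrArg _ (ht i l j)).trans ((s j i).map_smul z l).symm
  · exact TensorSec.ext fun i l => ht i l j
  · exact TensorSec.ext fun i l => htu i l _ fun j => LinearMap.congr_fun (congrFun (hy j) i) l

end TensorSec

/-- A sheaf has only one section over an empty chart. -/
lemma Atlas.Glues.subsingleton {S : Type*} [Category* S] {π : S ⥤ C} {I B : Type*} [Category* B]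
    {A : Atlas 𝒢 π I B} {F : I → B → Type*} {res : ∀ (i) {U V : B}, (U ⟶ V) → F i V → F i U}
    (h : A.Glues F res) {i : I} {U : B} (hU : IsEmpty (A.Pt i U)) : Subsingleton (F i U) := by
  obtain ⟨t, -, ht⟩ := h i U PEmpty (fun j => j.elim) (fun j => j.elim) (fun x => hU.elim x)
    (fun j => j.elim) (fun j => j.elim)
  exact ⟨fun a b => (ht a fun j => j.elim).trans (ht b fun j => j.elim).symm⟩

open TensorSec in
/-- The sheaf corresponding to a twisted sheaf, in terms of its restrictions along morphisms with
constant data. -/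
def tensorLocal (h𝒢 : 𝒢.IsRegular) {W : Modules 𝒪 (DualChart.forget E T)} (hs : IsSheaf 𝒢 W)
    (hW : IsTwisted W) : (Chart.atlas E.H h𝒢).LocalPresheaf
      (fun _ U => TensorSec W ((Chart.ofEtale E.H).obj U)) where
  res _ _ _ e s := res e s
  glues := glues h𝒢 hs
  Rel a L := ∃ g ν, ∃ h : Chart.IsConst a g ν, L = push h
  rel_id {i U} := ⟨1, 1, Chart.isConst_ofEtale (𝟙 U), by
    funext s
    refine Eq.trans ?_ (push_ofEtale (𝟙 U) s).symm
    exact TensorSec.ext fun i l => (W.restr_id (s i l)).symm⟩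
  rel_map e := ⟨1, 1, Chart.isConst_ofEtale e, funext fun s => (push_ofEtale e s).symm⟩
  rel_map_comp e a L := fun ⟨g, ν, h, _⟩ => ⟨_, g, ν, h.ofEtale_comp e, rfl⟩
  rel_comp {i k l U V X} a b L L' L'' := by
    rintro ⟨g, ν, h, rfl⟩ ⟨g', ν', h', rfl⟩ ⟨g'', ν'', h'', rfl⟩
    funext s
    rcases isEmpty_or_nonempty (𝒢.space.obj U.dom) with hU | ⟨⟨x⟩⟩
    · have := (glues h𝒢 hs).subsingleton (i := ()) (U := U) hU
      exact Subsingleton.elim _ _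
    · exact (push_push hW h h' h'' x s).symm
  exists_rel {i k U V} a x := by
    obtain ⟨U', e, g, ν, hx, h⟩ := Chart.exists_isConst h𝒢 a x
    exact ⟨U', e, _, hx, g, ν, h, rfl⟩

end

section
universe v u
variable {C : Type u} [Category.{v} C] {𝒢 : Geometry C} {M : C} {G : Type} [Group G] [Finite G]
  {E : GerbeExtension 𝒢 G M} {D : UnitaryDual G} {T : Intertwiners D} {𝒪 : AlgebraPresheaf C}

namespace TensorSec
variable {W W' : Modules 𝒪 (DualChart.forget E T)}

lemma push_add {U V : Chart E.H} {a : U ⟶ V} {g : G} {ν : MulAut G} (h : Chart.IsConst a g ν)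
    (s t : TensorSec W V) : push h (s + t) = push h s + push h t := by
  exact TensorSec.ext fun i l => (W.restr (h.along T rfl)).map_add _ _

lemma push_smul {U V : Chart E.H} {a : U ⟶ V} {g : G} {ν : MulAut G} (h : Chart.IsConst a g ν)
    (r : 𝒪.at V.dom) (s : TensorSec W V) :
    push h (r • s) = (𝒪.ring.map a.hom.op).hom r • push h s := by
  exact TensorSec.ext fun i l => W.restr_smul (h.along T rfl) r _

lemma res_add {U V : EtaleOver 𝒢 M} (e : U ⟶ V)
    (s t : TensorSec W ((Chart.ofEtale E.H).obj V)) : res e (s + t) = res e s + res e t := by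
  rw [← push_ofEtale, push_add, push_ofEtale, push_ofEtale]

lemma res_smul {U V : EtaleOver 𝒢 M} (e : U ⟶ V)
    (r : 𝒪.at ((Chart.forget E.H).obj ((Chart.ofEtale E.H).obj V)))
    (s : TensorSec W ((Chart.ofEtale E.H).obj V)) :
    res e (r • s) = (𝒪.ring.map ((Chart.forget E.H).map ((Chart.ofEtale E.H).map e)).op).hom r •
      res e s := by
  rw [← push_ofEtale, ← push_ofEtale]
  exact push_smul _ r s

/-- The effect of a morphism of twisted sheaves. -/
def map (φ : W ⟶ W') (U : Chart E.H) :
    TensorSec W U →ₗ[𝒪.at ((Chart.forget E.H).obj U)] TensorSec W' U where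
  toFun s i := ((Modules.homSec φ (U.toDual T i)).restrictScalars ℂ) ∘ₗ s i
  map_add' s t := by
    exact TensorSec.ext fun i l => (Modules.homSec φ (U.toDual T i)).map_add _ _
  map_smul' r s := by
    exact TensorSec.ext fun i l => (Modules.homSec φ (U.toDual T i)).map_smul _ _

lemma map_push (φ : W ⟶ W') {U V : Chart E.H} {a : U ⟶ V} {g : G} {ν : MulAut G}
    (h : Chart.IsConst a g ν) (s : TensorSec W V) : map φ U (push h s) = push h (map φ V s) := by
  exact TensorSec.ext fun i l => Modules.homSec_restr φ _ _

end TensorSec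

section
variable (h𝒢 : 𝒢.IsRegular) {W W' W'' : Modules 𝒪 (DualChart.forget E T)}
  (hs : IsSheaf 𝒢 W) (hW : IsTwisted W) (hs' : IsSheaf 𝒢 W') (hW' : IsTwisted W')

/-- The sheaf on the gerbe corresponding to a twisted sheaf on its dual. -/
def tensorModules : Modules 𝒪 (Chart.forget E.H) :=
  Modules.ofSec (TensorSec W)
    (fun {U V} a => (tensorLocal h𝒢 hs hW).extend (i := ()) (k := ()) (U := ⟨U.dom, U.map, U.etale⟩)
      (V := ⟨V.dom, V.map, V.etale⟩) a)
    (fun {U V} a s t => (tensorLocal h𝒢 hs hW).extend_add (i := ()) (k := ())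
      (U := ⟨U.dom, U.map, U.etale⟩) (V := ⟨V.dom, V.map, V.etale⟩)
      (fun e s t => TensorSec.res_add e s t)
      (by rintro _ _ _ _ a _ ⟨g, ν, h, rfl⟩ s t; exact TensorSec.push_add h s t) a s t)
    (fun {U V} a r s => (tensorLocal h𝒢 hs hW).extend_smul (i := ()) (k := ())
      (U := ⟨U.dom, U.map, U.etale⟩) (V := ⟨V.dom, V.map, V.etale⟩)
      (fun e r s => TensorSec.res_smul e r s)
      (by rintro _ _ _ _ a _ ⟨g, ν, h, rfl⟩ r s; exact TensorSec.push_smul h r s) a r s)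
    (fun {U} s => (tensorLocal h𝒢 hs hW).extend_id (i := ())
      (U := ⟨U.dom, U.map, U.etale⟩) s)
    (fun {U V X} a b s => (tensorLocal h𝒢 hs hW).extend_comp (i := ()) (k := ()) (l := ())
      (U := ⟨U.dom, U.map, U.etale⟩) (V := ⟨V.dom, V.map, V.etale⟩) (W := ⟨X.dom, X.map, X.etale⟩)
      a b s)

/-- The sections of the sheaf on the gerbe. -/
def tensorSecEquiv (U : Chart E.H) :
    (tensorModules h𝒢 hs hW).Sec U ≃ₗ[𝒪.at ((Chart.forget E.H).obj U)] TensorSec W U :=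
  LinearEquiv.refl _ _

lemma tensorModules_restr {U V : Chart E.H} {a : U ⟶ V} {g : G} {ν : MulAut G}
    (h : Chart.IsConst a g ν) (s : (tensorModules h𝒢 hs hW).Sec V) :
    tensorSecEquiv h𝒢 hs hW U ((tensorModules h𝒢 hs hW).restr a s) =
      TensorSec.push h (tensorSecEquiv h𝒢 hs hW V s) :=
  (tensorLocal h𝒢 hs hW).extend_of_rel (i := ()) (k := ()) (U := ⟨U.dom, U.map, U.etale⟩)
    (V := ⟨V.dom, V.map, V.etale⟩) ⟨g, ν, h, rfl⟩ s

lemma tensorModules_isSheaf : IsSheaf 𝒢 (tensorModules h𝒢 hs hW) := by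
  rw [(Chart.atlas E.H h𝒢).isSheaf_modules_iff]
  have e : ∀ {U V : EtaleOver 𝒢 M} (e : U ⟶ V) (s : TensorSec W ((Chart.ofEtale E.H).obj V)),
      (tensorModules h𝒢 hs hW).restr ((Chart.ofEtale E.H).map e) s = TensorSec.res e s :=
    fun e s => (tensorLocal h𝒢 hs hW).extend_map (i := ()) e s
  have := TensorSec.glues h𝒢 hs
  intro i U J V f hf s hs'
  obtain ⟨t, ht, htu⟩ := this i U J V f hf s fun j k Z d d' hd =>
    (e _ _).symm.trans ((hs' j k Z d d' hd).trans (e _ _))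
  exact ⟨t, fun j => (e _ _).trans (ht j), fun t' ht' => htu t' fun j => (e _ _).symm.trans (ht' j)⟩

/-- Maps on sections commute with all restrictions if they do so for morphisms with constant
data. -/
lemma tensorModules_natural (F : Modules 𝒪 (Chart.forget E.H))
    (φ : ∀ U, F.Sec U → TensorSec W U)
    (h : ∀ {U V : Chart E.H} {a : U ⟶ V} {g : G} {ν : MulAut G} (h : Chart.IsConst a g ν) s,
      φ U (F.restr a s) = TensorSec.push h (φ V s)) {U V : Chart E.H} (a : U ⟶ V) (s : F.Sec V) :
    φ U (F.restr a s) = tensorSecEquiv h𝒢 hs hW U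
      ((tensorModules h𝒢 hs hW).restr a ((tensorSecEquiv h𝒢 hs hW V).symm (φ V s))) := by
  refine ((tensorLocal h𝒢 hs hW).extend_eq (i := ()) (k := ()) (U := ⟨U.dom, U.map, U.etale⟩)
      (V := ⟨V.dom, V.map, V.etale⟩) (s := φ V s) (t := φ U (F.restr a s)) a ?_).symm
  rintro U' e _ ⟨g, ν, h', rfl⟩
  refine (TensorSec.push_ofEtale e _).symm.trans ?_
  rw [← h, ← F.restr_comp]
  exact h h' s

/-- The functoriality of the sheaf on the gerbe in the twisted sheaf. -/
def tensorMap (φ : W ⟶ W') : tensorModules h𝒢 hs hW ⟶ tensorModules h𝒢 hs' hW' :=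
  Modules.homMk (fun U => (tensorSecEquiv h𝒢 hs' hW' U).symm.toLinearMap ∘ₗ TensorSec.map φ U ∘ₗ
    (tensorSecEquiv h𝒢 hs hW U).toLinearMap) fun {U V} a s =>
      tensorModules_natural h𝒢 hs' hW' _
        (fun U s => TensorSec.map φ U (tensorSecEquiv h𝒢 hs hW U s))
        (fun h s => by rw [tensorModules_restr h𝒢 hs hW h, TensorSec.map_push]) a s

end
end

/-! ### From sheaves on the gerbe to twisted sheaves on the dual -/

section
universe v u
variable {C : Type u} [Category.{v} C] {𝒢 : Geometry C} {M : C} {G : Type} [Group G]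
  {E : GerbeExtension 𝒢 G M} {𝒪 : AlgebraPresheaf C}

namespace Chart

/-- The automorphism of a chart defined by a section of the group bundle `M × G`. -/
def gauge (U : Chart E.H) (φ : LocallyConstant (𝒢.space.obj U.dom) G) : U ⟶ U where
  hom := 𝟙 _
  arr := E.incl U.map φ
  arr_src := E.incl_src _ _
  arr_tgt := (E.incl_tgt _ _).trans (Category.id_comp _).symm

lemma gauge_mul (U : Chart E.H) (φ ψ) : U.gauge (φ * ψ) = U.gauge φ ≫ U.gauge ψ :=
  Hom.ext (Category.id_comp _).symm ((E.incl_mul _ _ _).trans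
    (E.H.mul_congr rfl (Category.id_comp _).symm _))

lemma gauge_one (U : Chart E.H) : U.gauge 1 = 𝟙 U := Hom.ext rfl (E.incl_one _)

lemma ofEtale_gauge {U V : EtaleOver 𝒢 M} (e : U ⟶ V)
    (φ : LocallyConstant (𝒢.space.obj V.dom) G) :
    (ofEtale E.H).map e ≫ gauge ((ofEtale E.H).obj V) φ =
      gauge ((ofEtale E.H).obj U) (φ.comap (𝒢.space.map e.hom).hom) ≫ (ofEtale E.H).map e := by
  refine Hom.ext ((Category.comp_id e.hom).trans (Category.id_comp e.hom).symm) ?_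
  rw [ofEtale_comp_arr]
  change e.hom ≫ E.incl V.map φ = _
  rw [E.comp_incl]
  refine Eq.trans ?_ ((E.H.mul_congr rfl (Category.id_comp (U.map ≫ E.H.one)) _).trans
    (E.H.mul_one' U.map (E.incl U.map _) (E.incl_tgt _ _).symm)).symm
  rw [e.w]

end Chart

/-- The representation of `G` on the sections over a chart. -/
def gaugeRep (F : Modules 𝒪 (Chart.forget E.H)) (U : Chart E.H) :
    Representation ℂ G (F.Sec U) where
  toFun g := F.restr (U.gauge (.const _ g))
  map_one' := LinearMap.ext fun s => by
    refine Eq.trans ?_ (F.restr_id s)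
    rw [← Chart.gauge_one]; rfl
  map_mul' g h := LinearMap.ext fun s => by
    refine Eq.trans ?_ (F.restr_comp (U.gauge (.const _ g)) (U.gauge (.const _ h)) s)
    rw [← Chart.gauge_mul]; rfl

lemma gaugeRep_apply (F : Modules 𝒪 (Chart.forget E.H)) (U : Chart E.H) (g : G) (s : F.Sec U) :
    gaugeRep F U g s = F.restr (U.gauge (.const _ g)) s := rfl

lemma gaugeRep_smul (F : Modules 𝒪 (Chart.forget E.H)) (U : Chart E.H) (g : G)
    (r : 𝒪.at ((Chart.forget E.H).obj U)) (s : F.Sec U) :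
    gaugeRep F U g (r • s) = r • gaugeRep F U g s := by
  refine (F.restr_smul _ _ _).trans (congrArg (· • F.restr (U.gauge (.const _ g)) s) ?_)
  change (𝒪.ring.map (𝟙 U.dom).op).hom r = r
  rw [op_id, 𝒪.ring.map_id]
  rfl

lemma restr_gaugeRep (F : Modules 𝒪 (Chart.forget E.H)) {U V : EtaleOver 𝒢 M} (e : U ⟶ V) (g : G)
    (s : F.Sec ((Chart.ofEtale E.H).obj V)) :
    F.restr ((Chart.ofEtale E.H).map e) (gaugeRep F _ g s) =
      gaugeRep F _ g (F.restr ((Chart.ofEtale E.H).map e) s) := by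
  rw [gaugeRep_apply, gaugeRep_apply, ← F.restr_comp, ← F.restr_comp, Chart.ofEtale_gauge]
  rfl

variable [Finite G] {D : UnitaryDual G} {T : Intertwiners D}

namespace DualChart

/-- The chart of the gerbe underlying a chart of the dual. -/
abbrev toChart (X : DualChart E T) : Chart E.H := ⟨X.dom, X.map, X.etale⟩

/-- The morphism of charts of the gerbe defined by the section `σ` and a morphism of charts of the
dual. -/
def Hom.lift {X Y : DualChart E T} (a : X ⟶ Y) : X.toChart ⟶ Y.toChart where
  hom := a.hom
  arr := a.arr ≫ E.sec
  arr_src := by rw [Category.assoc, E.sec_src]; exact a.arr_src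
  arr_tgt := by rw [Category.assoc, E.sec_tgt]; exact a.arr_tgt

/-- Lifts intertwine the sections of the group bundle through `Ad_{σ(q)}`. -/
lemma lift_gauge {X Y : DualChart E T} (a : X ⟶ Y)
    (φ : LocallyConstant (𝒢.space.obj Y.dom) G) :
    Hom.lift a ≫ Y.toChart.gauge φ =
      X.toChart.gauge (E.conj (a.arr ≫ E.sec) (φ.comap (𝒢.space.map a.hom).hom)) ≫ Hom.lift a := by
  refine Chart.Hom.ext ((Category.comp_id a.hom).trans (Category.id_comp a.hom).symm) ?_
  refine Eq.trans ?_ ((E.H.mul_congr rfl (Category.id_comp (a.arr ≫ E.sec)) _).trans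
    (E.conj_spec' (a.arr ≫ E.sec) (φ.comap (𝒢.space.map a.hom).hom) X.map (a.hom ≫ Y.map)
      (Hom.lift a).arr_src.symm (Hom.lift a).arr_tgt.symm)).symm
  exact E.H.mul_congr rfl (E.comp_incl _ _ _) _

/-- The lift of a composite, up to the function `τ`. -/
lemma lift_comp {X Y Z : DualChart E T} (a : X ⟶ Y) (b : Y ⟶ Z) :
    Hom.lift a ≫ Hom.lift b = X.toChart.gauge (E.tau a.arr (a.hom ≫ b.arr)
      (by simp [a.arr_tgt, b.arr_src])) ≫ Hom.lift (a ≫ b) := by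
  refine Chart.Hom.ext (Category.id_comp (a.hom ≫ b.hom)).symm ?_
  refine Eq.trans ?_ ((E.tau_spec a.arr (a.hom ≫ b.arr)
    (by simp [a.arr_tgt, b.arr_src])).symm.trans (E.H.mul_congr ?_ ?_ _))
  · exact E.H.mul_congr rfl (Category.assoc _ _ _).symm _
  · exact congrArg (E.incl · _) a.arr_src
  · exact (Category.id_comp ((a ≫ b).arr ≫ E.sec)).symm

lemma lift_ofEtale {i : D.Idx} {U V : EtaleOver 𝒢 M} (e : U ⟶ V) :
    Hom.lift ((ofEtale E T i).map e) = (Chart.ofEtale E.H).map e :=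
  Chart.Hom.ext rfl ((Category.assoc _ _ _).trans (congrArg (U.map ≫ ·) E.one_sec))

/-- Along the morphism `a` the automorphism `Ad_{σ(q)}` is constantly `ν` and the phase is
constantly `z`. -/
structure IsConst {X Y : DualChart E T} (a : X ⟶ Y) (ν : MulAut G) (z : Circle) : Prop where
  ad_eq : ∀ x : 𝒢.space.obj X.dom, E.ad (a.arr ≫ E.sec) x = ν
  phase_eq : ∀ x : 𝒢.space.obj X.dom, a.phase x = z

lemma isConst_ofEtale {i : D.Idx} {U V : EtaleOver 𝒢 M} (e : U ⟶ V) :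
    IsConst ((ofEtale E T i).map e) 1 1 := by
  refine ⟨fun x => ?_, fun x => rfl⟩
  rw [arr_ofEtale, Category.assoc, E.one_sec, E.ad_one]

lemma IsConst.ofEtale_comp {i : D.Idx} {U V : EtaleOver 𝒢 M} {X : DualChart E T} (e : U ⟶ V)
    {a : (ofEtale E T i).obj V ⟶ X} {ν : MulAut G} {z : Circle} (h : IsConst a ν z) :
    IsConst ((ofEtale E T i).map e ≫ a) ν z := by
  refine ⟨fun x => ?_, fun x => ?_⟩
  · rw [ofEtale_comp_arr, Category.assoc, E.ad_comp, h.ad_eq]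
  · rw [ofEtale_comp_phase, h.phase_eq]

/-- Near every point of its source, a morphism of charts of the dual has constant data. -/
lemma exists_isConst_nhd {i : D.Idx} {U : EtaleOver 𝒢 M} {X : DualChart E T}
    (a : (ofEtale E T i).obj U ⟶ X) (x : 𝒢.space.obj U.dom) :
    ∃ (N : Set (𝒢.space.obj U.dom)) (ν : MulAut G) (z : Circle), IsOpen N ∧ x ∈ N ∧
      T.act ν i = X.idx ∧ ∀ (U' : EtaleOver 𝒢 M) (e : U' ⟶ U),
        Set.range (𝒢.space.map e.hom) ⊆ N → IsConst ((ofEtale E T i).map e ≫ a) ν z := by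
  refine ⟨_, E.ad (a.arr ≫ E.sec) x, a.phase x, ((E.isLocallyConstant_ad
    (a.arr ≫ E.sec)).prodMk a.phase.isLocallyConstant) {(_, a.phase x)}, rfl, a.act_idx x,
    fun U' e he => ⟨fun y => ?_, fun y => ?_⟩⟩
  · rw [ofEtale_comp_arr, Category.assoc, E.ad_comp]
    exact congrArg Prod.fst (he ⟨y, rfl⟩)
  · rw [ofEtale_comp_phase]
    exact congrArg Prod.snd (he ⟨y, rfl⟩)

lemma exists_isConst (h𝒢 : 𝒢.IsRegular) {i : D.Idx} {U : EtaleOver 𝒢 M} {X : DualChart E T}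
    (a : (ofEtale E T i).obj U ⟶ X) (x : 𝒢.space.obj U.dom) :
    ∃ (U' : EtaleOver 𝒢 M) (e : U' ⟶ U) (ν : MulAut G) (z : Circle) (_ : T.act ν i = X.idx),
      x ∈ Set.range (𝒢.space.map e.hom) ∧ IsConst ((ofEtale E T i).map e ≫ a) ν z := by
  obtain ⟨N, ν, z, hN, hx, hν, h⟩ := exists_isConst_nhd a x
  obtain ⟨U', e, hx, he⟩ := U.exists_nhd h𝒢 x N hN hx
  exact ⟨U', e, ν, z, hν, hx, h U' e he⟩

end DualChart
end

section
universe v u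
variable {C : Type u} [Category.{v} C] {𝒢 : Geometry C} {M : C} {G : Type} [Group G] [Finite G]
  {E : GerbeExtension 𝒢 G M} {D : UnitaryDual G} {T : Intertwiners D} {𝒪 : AlgebraPresheaf C}

instance (F : Modules 𝒪 (Chart.forget E.H)) (X : DualChart E T) :
    Module (𝒪.at ((DualChart.forget E T).obj X)) (F.Sec X.toChart) :=
  inferInstanceAs (Module (𝒪.at ((Chart.forget E.H).obj X.toChart)) _)

instance (F : Modules 𝒪 (Chart.forget E.H)) (X : DualChart E T) :
    IsScalarTower ℂ (𝒪.at ((DualChart.forget E T).obj X)) (F.Sec X.toChart) :=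
  inferInstanceAs (IsScalarTower ℂ (𝒪.at ((Chart.forget E.H).obj X.toChart)) _)

/-- The sections over `(U, i)` of the twisted sheaf corresponding to a sheaf on the gerbe: the
equivariant linear maps from `V_i` to the sections over `U`. -/
def IsotypicSec (F : Modules 𝒪 (Chart.forget E.H)) (X : DualChart E T) :
    Submodule (𝒪.at ((DualChart.forget E T).obj X)) (D.V X.idx →ₗ[ℂ] F.Sec X.toChart) where
  carrier := {f | ∀ g v, f (D.rep X.idx g v) = gaugeRep F X.toChart g (f v)}
  add_mem' hf hf' g v :=
    (congrArg₂ _ (hf g v) (hf' g v)).trans (_root_.map_add (gaugeRep F X.toChart g) _ _).symm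
  zero_mem' g _ := (_root_.map_zero (gaugeRep F X.toChart g)).symm
  smul_mem' r _ hf g v :=
    (congrArg (r • ·) (hf g v)).trans (gaugeRep_smul F X.toChart g r _).symm

namespace IsotypicSec
variable {F : Modules 𝒪 (Chart.forget E.H)}

lemma ext {X : DualChart E T} {f f' : IsotypicSec F X} (h : ∀ v, f.1 v = f'.1 v) : f = f' :=
  Subtype.ext (LinearMap.ext h)

/-- The restriction along a morphism with constant data. -/
def push {X Y : DualChart E T} {a : X ⟶ Y} {ν : MulAut G} {z : Circle}
    (h : DualChart.IsConst a ν z) (hν : T.act ν X.idx = Y.idx) (f : IsotypicSec F Y) :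
    IsotypicSec F X where
  val := (z : ℂ) • F.restr (DualChart.Hom.lift a) ∘ₗ f.1 ∘ₗ (T.into ν hν).toLinearMap
  property g v := by
    change (z : ℂ) • F.restr (DualChart.Hom.lift a) (f.1 (T.into ν hν (D.rep X.idx g v))) =
      gaugeRep F _ g ((z : ℂ) • F.restr (DualChart.Hom.lift a) (f.1 (T.into ν hν v)))
    obtain ⟨g, rfl⟩ := ν.surjective g
    rw [T.into_rep, f.2, _root_.map_smul, gaugeRep_apply, gaugeRep_apply, ← F.restr_comp,
      DualChart.lift_gauge, F.restr_comp]
    congr 3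
    refine congrArg _ (LocallyConstant.ext fun x => ?_)
    exact congrArg (fun ν : MulAut G => ν g) (h.ad_eq x)

lemma push_apply {X Y : DualChart E T} {a : X ⟶ Y} {ν : MulAut G} {z : Circle}
    (h : DualChart.IsConst a ν z) (hν : T.act ν X.idx = Y.idx) (f : IsotypicSec F Y)
    (v : D.V X.idx) :
    (push h hν f).1 v = (z : ℂ) • F.restr (DualChart.Hom.lift a) (f.1 (T.into ν hν v)) := rfl

/-- The restriction along a morphism of étale objects over `M`. -/
def res {i : D.Idx} {U V : EtaleOver 𝒢 M} (e : U ⟶ V)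
    (f : IsotypicSec F ((DualChart.ofEtale E T i).obj V)) :
    IsotypicSec F ((DualChart.ofEtale E T i).obj U) where
  val := F.restr ((Chart.ofEtale E.H).map e) ∘ₗ f.1
  property g v := (congrArg (F.restr ((Chart.ofEtale E.H).map e)) (f.2 g v)).trans
    (restr_gaugeRep F e g (f.1 v))

lemma push_ofEtale {i : D.Idx} {U V : EtaleOver 𝒢 M} (e : U ⟶ V)
    (f : IsotypicSec F ((DualChart.ofEtale E T i).obj V)) :
    push (DualChart.isConst_ofEtale e) (DualChart.act_one i) f = res e f := by
  refine IsotypicSec.ext fun v => ?_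
  rw [push_apply, T.into_one, DualChart.lift_ofEtale]
  exact one_smul _ _

lemma push_add {X Y : DualChart E T} {a : X ⟶ Y} {ν : MulAut G} {z : Circle}
    (h : DualChart.IsConst a ν z) (hν : T.act ν X.idx = Y.idx) (f f' : IsotypicSec F Y) :
    push h hν (f + f') = push h hν f + push h hν f' := by
  refine IsotypicSec.ext fun v => ?_
  refine (congrArg _ (_root_.map_add (F.restr (DualChart.Hom.lift a)) _ _)).trans (smul_add _ _ _)

lemma push_smul {X Y : DualChart E T} {a : X ⟶ Y} {ν : MulAut G} {z : Circle}
    (h : DualChart.IsConst a ν z) (hν : T.act ν X.idx = Y.idx)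
    (r : 𝒪.at ((DualChart.forget E T).obj Y)) (f : IsotypicSec F Y) :
    push h hν (r • f) =
      (𝒪.ring.map ((DualChart.forget E T).map a).op).hom r • push h hν f := by
  refine IsotypicSec.ext fun v => ?_
  refine (congrArg ((z : ℂ) • ·) (F.restr_smul (DualChart.Hom.lift a) r _)).trans ?_
  exact smul_comm _ _ _

lemma res_add {i : D.Idx} {U V : EtaleOver 𝒢 M} (e : U ⟶ V)
    (f f' : IsotypicSec F ((DualChart.ofEtale E T i).obj V)) :
    res e (f + f') = res e f + res e f' := by
  rw [← push_ofEtale, ← push_ofEtale, ← push_ofEtale, push_add]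

lemma res_smul {i : D.Idx} {U V : EtaleOver 𝒢 M} (e : U ⟶ V)
    (r : 𝒪.at ((DualChart.forget E T).obj ((DualChart.ofEtale E T i).obj V)))
    (f : IsotypicSec F ((DualChart.ofEtale E T i).obj V)) :
    res e (r • f) =
      (𝒪.ring.map ((DualChart.forget E T).map ((DualChart.ofEtale E T i).map e)).op).hom r •
        res e f := by
  rw [← push_ofEtale, ← push_ofEtale]
  exact push_smul _ _ r f

lemma glues (h𝒢 : 𝒢.IsRegular) (hF : IsSheaf 𝒢 F) : (DualChart.atlas E T h𝒢).Glues
    (fun i U => IsotypicSec F ((DualChart.ofEtale E T i).obj U)) (fun _ _ _ e f => res e f) := by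
  intro i U J V e he s hs
  have hF' := ((Chart.atlas E.H h𝒢).isSheaf_modules_iff F).1 hF () U J V e he
  choose t ht htu using fun v : D.V i => hF' (fun j => (s j).1 v) fun j k Z d d' hd => by
    have h := hs j k Z d d' hd
    exact congrArg (fun f => f.1 v) h
  refine ⟨⟨⟨⟨t, fun v v' => ?_⟩, fun z v => ?_⟩, fun g v => ?_⟩, fun j => ?_, fun y hy => ?_⟩
  · refine (htu (v + v') _ fun j => ?_).symm
    refine ((F.restr _).map_add _ _).trans ?_
    exact (congrArg₂ _ (ht v j) (ht v' j)).trans ((s j).1.map_add v v').symm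
  · refine (htu (z • v) _ fun j => ?_).symm
    refine ((F.restr _).map_smul z _).trans ?_
    exact (congrArg _ (ht v j)).trans ((s j).1.map_smul z v).symm
  · refine (htu _ _ fun j => ?_).symm
    refine (restr_gaugeRep F (e j) g (t v)).trans ?_
    exact (congrArg _ (ht v j)).trans ((s j).2 g v).symm
  · exact IsotypicSec.ext fun v => ht v j
  · exact IsotypicSec.ext fun v => htu v _ fun j =>
      LinearMap.congr_fun (congrArg Subtype.val (hy j)) v

end IsotypicSec

omit [Finite G] in
/-- Sections of a sheaf on the gerbe which agree locally are equal. -/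
lemma IsSheaf.ext_local (h𝒢 : 𝒢.IsRegular) {F : Modules 𝒪 (Chart.forget E.H)} (hF : IsSheaf 𝒢 F)
    {U : Chart E.H} {s t : F.Sec U} (h : ∀ x : 𝒢.space.obj U.dom,
      ∃ (U' : EtaleOver 𝒢 M) (e : U' ⟶ ⟨U.dom, U.map, U.etale⟩),
        x ∈ Set.range (𝒢.space.map e.hom) ∧
          F.restr ((Chart.ofEtale E.H).map e) s = F.restr ((Chart.ofEtale E.H).map e) t) :
    s = t := by
  choose U' e hx he using h
  obtain ⟨r, -, hr⟩ := ((Chart.atlas E.H h𝒢).isSheaf_modules_iff F).1 hF ()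
    ⟨U.dom, U.map, U.etale⟩ (Σ U' : EtaleOver 𝒢 M, {e : U' ⟶ ⟨U.dom, U.map, U.etale⟩ //
      F.restr ((Chart.ofEtale E.H).map e) s = F.restr ((Chart.ofEtale E.H).map e) t})
    (fun j => j.1) (fun j => j.2.1) (fun x => ⟨⟨U' x, e x, he x⟩, hx x⟩)
    (fun j => F.restr ((Chart.ofEtale E.H).map j.2.1) s) (fun j k Z d d' hd => by
      change F.restr ((Chart.ofEtale E.H).map d) (F.restr ((Chart.ofEtale E.H).map j.2.1) s) =
        F.restr ((Chart.ofEtale E.H).map d') (F.restr ((Chart.ofEtale E.H).map k.2.1) s)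
      rw [← F.restr_comp, ← F.restr_comp, ← Functor.map_comp, ← Functor.map_comp, hd])
  exact (hr s fun _ => rfl).trans (hr t fun j => j.2.2.symm).symm

namespace IsotypicSec
variable {F : Modules 𝒪 (Chart.forget E.H)}

/-- The restrictions along morphisms with constant data are functorial. The function `τ` is only
locally constant, so that equality is checked locally. -/
lemma push_push (h𝒢 : 𝒢.IsRegular) (hF : IsSheaf 𝒢 F) {X Y Z : DualChart E T} {a : X ⟶ Y}
    {b : Y ⟶ Z} {ν ν' ν'' : MulAut G} {z z' z'' : Circle} (ha : DualChart.IsConst a ν z)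
    (hb : DualChart.IsConst b ν' z') (hab : DualChart.IsConst (a ≫ b) ν'' z'')
    (hν : T.act ν X.idx = Y.idx) (hν' : T.act ν' Y.idx = Z.idx) (hν'' : T.act ν'' X.idx = Z.idx)
    (f : IsotypicSec F Z) : push ha hν (push hb hν' f) = push hab hν'' f := by
  have hcomp : a.arr ≫ E.Q.tgt = (a.hom ≫ b.arr) ≫ E.Q.src := by simp [a.arr_tgt, b.arr_src]
  refine IsotypicSec.ext fun v => hF.ext_local h𝒢 fun x => ?_
  obtain ⟨U', e, hx, he⟩ := EtaleOver.exists_nhd_const h𝒢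
    (⟨X.dom, X.map, X.etale⟩ : EtaleOver 𝒢 M) x
    (E.tau a.arr (a.hom ≫ b.arr) hcomp).isLocallyConstant
  refine ⟨U', e, hx, ?_⟩
  set τ := E.tau a.arr (a.hom ≫ b.arr) hcomp with hτ
  have hadb : E.ad ((a.hom ≫ b.arr) ≫ E.sec) x = ν' := by
    rw [Category.assoc, E.ad_comp, hb.ad_eq]
  have had : E.ad (E.Q.mul a.arr (a.hom ≫ b.arr) hcomp ≫ E.sec) x = ν'' := hab.ad_eq x
  have hνν : ν * ν' = MulAut.conj (τ x) * ν'' := by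
    have := E.ad_tau _ _ hcomp x
    rwa [ha.ad_eq, hadb, had] at this
  have hz : z'' = T.scalar X.idx ν ν' ν'' (τ x) * (z * z') := by
    have h : _ = E.cocycle T X.idx a.arr (a.hom ≫ b.arr) hcomp x *
      (a.phase x * b.phase (𝒢.space.map a.hom x)) := DualChart.comp_phase a b x
    rw [hab.phase_eq, ha.phase_eq, hb.phase_eq] at h
    rw [h]
    congr 1
    change T.scalar _ _ _ _ _ = _
    rw [ha.ad_eq, hadb, had]
  -- Near `x` the function `τ` is constant, and its action cancels the factor `ρ(τ)⁻¹` in the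
  -- definition of the scalar.
  have key : ∀ w, F.restr ((Chart.ofEtale E.H).map e) (F.restr (X.toChart.gauge τ)
      (F.restr (DualChart.Hom.lift (a ≫ b)) (f.1 (T.into ν'' hν'' (D.rep X.idx (τ x)⁻¹ w))))) =
      F.restr ((Chart.ofEtale E.H).map e) (F.restr (DualChart.Hom.lift (a ≫ b))
        (f.1 (T.into ν'' hν'' w))) := by
    intro w
    have h₁ := (push hab hν'' f).2 (τ x)⁻¹ w
    rw [push_apply, push_apply, _root_.map_smul] at h₁
    have h₁ := smul_right_injective _ (Circle.coe_ne_zero z'') h₁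
    rw [h₁, gaugeRep_apply, ← F.restr_comp, ← F.restr_comp, Category.assoc, ← Chart.gauge_mul,
      Chart.ofEtale_gauge]
    have : (τ * LocallyConstant.const _ (τ x)⁻¹).comap (𝒢.space.map e.hom).hom = 1 :=
      LocallyConstant.ext fun y => by
        change τ (𝒢.space.map e.hom y) * (τ x)⁻¹ = 1
        rw [show τ (𝒢.space.map e.hom y) = τ x from he y, mul_inv_cancel]
    rw [this, Chart.gauge_one, Category.id_comp]
  rw [push_apply, push_apply, push_apply, T.into_into hνν hν hν' hν'', hz]
  simp only [_root_.map_smul]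
  rw [← F.restr_comp (DualChart.Hom.lift a), DualChart.lift_comp, F.restr_comp, key,
    smul_smul, smul_smul]
  congr 1
  rw [Circle.coe_mul, Circle.coe_mul]
  ring

end IsotypicSec

open IsotypicSec in
/-- The twisted sheaf corresponding to a sheaf on the gerbe, in terms of its restrictions along
morphisms with constant data. -/
def isotypicLocal (h𝒢 : 𝒢.IsRegular) {F : Modules 𝒪 (Chart.forget E.H)} (hF : IsSheaf 𝒢 F)
    (T : Intertwiners D) : (DualChart.atlas E T h𝒢).LocalPresheaf
      (fun i U => IsotypicSec F ((DualChart.ofEtale E T i).obj U)) where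
  res _ _ _ e s := res e s
  glues := glues h𝒢 hF
  Rel a L := ∃ ν z, ∃ (h : DualChart.IsConst a ν z) (hν : _), L = push h hν
  rel_id {i U} := ⟨1, 1, DualChart.isConst_ofEtale (𝟙 U), DualChart.act_one i, by
    funext s
    refine Eq.trans ?_ (push_ofEtale (𝟙 U) s).symm
    exact IsotypicSec.ext fun v => (F.restr_id (s.1 v)).symm⟩
  rel_map {i U V} e := ⟨1, 1, DualChart.isConst_ofEtale e, DualChart.act_one i,
    funext fun s => (push_ofEtale e s).symm⟩
  rel_map_comp e a L := fun ⟨ν, z, h, hν, _⟩ => ⟨_, ν, z, h.ofEtale_comp e, hν, rfl⟩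
  rel_comp {i k l U V X} a b L L' L'' := by
    rintro ⟨ν, z, h, hν, rfl⟩ ⟨ν', z', h', hν', rfl⟩ ⟨ν'', z'', h'', hν'', rfl⟩
    exact funext fun s => (push_push h𝒢 hF h h' h'' hν hν' hν'' s).symm
  exists_rel {i k U V} a x := by
    obtain ⟨U', e, ν, z, hν, hx, h⟩ := DualChart.exists_isConst h𝒢 a x
    exact ⟨U', e, _, hx, ν, z, h, hν, rfl⟩

section
variable (h𝒢 : 𝒢.IsRegular) {F F' : Modules 𝒪 (Chart.forget E.H)} (hF : IsSheaf 𝒢 F)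
  (hF' : IsSheaf 𝒢 F') (T)

/-- The twisted sheaf on the dual corresponding to a sheaf on the gerbe. -/
def isotypicModules : Modules 𝒪 (DualChart.forget E T) :=
  Modules.ofSec (fun X => IsotypicSec F X)
    (fun {X Y} a => (isotypicLocal h𝒢 hF T).extend (i := X.idx) (k := Y.idx)
      (U := ⟨X.dom, X.map, X.etale⟩) (V := ⟨Y.dom, Y.map, Y.etale⟩) a)
    (fun {X Y} a s t => (isotypicLocal h𝒢 hF T).extend_add (i := X.idx) (k := Y.idx)
      (U := ⟨X.dom, X.map, X.etale⟩) (V := ⟨Y.dom, Y.map, Y.etale⟩)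
      (fun e s t => IsotypicSec.res_add e s t)
      (by rintro _ _ _ _ a _ ⟨ν, z, h, hν, rfl⟩ s t; exact IsotypicSec.push_add h hν s t) a s t)
    (fun {X Y} a r s => (isotypicLocal h𝒢 hF T).extend_smul (i := X.idx) (k := Y.idx)
      (U := ⟨X.dom, X.map, X.etale⟩) (V := ⟨Y.dom, Y.map, Y.etale⟩)
      (fun e r s => IsotypicSec.res_smul e r s)
      (by rintro _ _ _ _ a _ ⟨ν, z, h, hν, rfl⟩ r s; exact IsotypicSec.push_smul h hν r s) a r s)
    (fun {X} s => (isotypicLocal h𝒢 hF T).extend_id (i := X.idx)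
      (U := ⟨X.dom, X.map, X.etale⟩) s)
    (fun {X Y Z} a b s => (isotypicLocal h𝒢 hF T).extend_comp (i := X.idx) (k := Y.idx)
      (l := Z.idx) (U := ⟨X.dom, X.map, X.etale⟩) (V := ⟨Y.dom, Y.map, Y.etale⟩)
      (W := ⟨Z.dom, Z.map, Z.etale⟩) a b s)

/-- The sections of the twisted sheaf. -/
def isotypicSecEquiv (X : DualChart E T) :
    (isotypicModules T h𝒢 hF).Sec X ≃ₗ[𝒪.at ((DualChart.forget E T).obj X)] IsotypicSec F X :=
  LinearEquiv.refl _ _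

variable {T}

lemma isotypicModules_restr {X Y : DualChart E T} {a : X ⟶ Y} {ν : MulAut G} {z : Circle}
    (h : DualChart.IsConst a ν z) (hν : T.act ν X.idx = Y.idx)
    (s : (isotypicModules T h𝒢 hF).Sec Y) :
    isotypicSecEquiv T h𝒢 hF X ((isotypicModules T h𝒢 hF).restr a s) =
      IsotypicSec.push h hν (isotypicSecEquiv T h𝒢 hF Y s) :=
  (isotypicLocal h𝒢 hF T).extend_of_rel (i := X.idx) (k := Y.idx)
    (U := ⟨X.dom, X.map, X.etale⟩) (V := ⟨Y.dom, Y.map, Y.etale⟩) ⟨ν, z, h, hν, rfl⟩ s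

lemma isotypicModules_isSheaf : IsSheaf 𝒢 (isotypicModules T h𝒢 hF) := by
  rw [(DualChart.atlas E T h𝒢).isSheaf_modules_iff]
  have e : ∀ {i : D.Idx} {U V : EtaleOver 𝒢 M} (e : U ⟶ V)
      (s : IsotypicSec F ((DualChart.ofEtale E T i).obj V)),
      (isotypicModules T h𝒢 hF).restr ((DualChart.ofEtale E T i).map e) s = IsotypicSec.res e s :=
    fun {i} _ _ e s => (isotypicLocal h𝒢 hF T).extend_map (i := i) e s
  have := IsotypicSec.glues (T := T) h𝒢 hF
  intro i U J V f hf s hs'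
  obtain ⟨t, ht, htu⟩ := this i U J V f hf s fun j k Z d d' hd =>
    (e _ _).symm.trans ((hs' j k Z d d' hd).trans (e _ _))
  exact ⟨t, fun j => (e _ _).trans (ht j), fun t' ht' => htu t' fun j => (e _ _).symm.trans (ht' j)⟩

lemma isotypicModules_isTwisted : IsTwisted (isotypicModules T h𝒢 hF) := by
  intro X z s
  have hc : DualChart.IsConst (X.central z) 1 z :=
    ⟨(DualChart.isConst_ofEtale (i := X.idx) (T := T) (E := E)
      (𝟙 (⟨X.dom, X.map, X.etale⟩ : EtaleOver 𝒢 M))).ad_eq, fun x => rfl⟩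
  refine (isotypicModules_restr h𝒢 hF hc (DualChart.act_one X.idx) s).trans ?_
  refine IsotypicSec.ext fun v => ?_
  rw [IsotypicSec.push_apply, T.into_one]
  have hl : DualChart.Hom.lift (X.central z) = 𝟙 X.toChart :=
    DualChart.lift_ofEtale (i := X.idx) (T := T) (E := E)
      (𝟙 (⟨X.dom, X.map, X.etale⟩ : EtaleOver 𝒢 M))
  rw [hl, F.restr_id]
  rfl

end
end

/-! ### Fourier transform -/

namespace UnitaryDual
variable {G : Type} [Group G] [Finite G] (D : UnitaryDual G) {N : Type} [AddCommGroup N]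
  [Module ℂ N] (ρ : Representation ℂ G N) {i : D.Idx}

lemma coeff_add_dual (n : N) (l l' : Module.Dual ℂ (D.V i)) :
    D.coeff ρ n (l + l') = D.coeff ρ n l + D.coeff ρ n l' := by
  ext v
  simp [coeff_apply, ← Finset.sum_add_distrib, add_smul]

lemma coeff_smul_dual (n : N) (z : ℂ) (l : Module.Dual ℂ (D.V i)) :
    D.coeff ρ n (z • l) = z • D.coeff ρ n l := by
  ext v
  simp [coeff_apply, Finset.smul_sum, smul_smul]

lemma coeff_add (n n' : N) (l : Module.Dual ℂ (D.V i)) :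
    D.coeff ρ (n + n') l = D.coeff ρ n l + D.coeff ρ n' l := by
  ext v
  simp [coeff_apply, ← Finset.sum_add_distrib]

end UnitaryDual

section
universe v u
variable {C : Type u} [Category.{v} C] {𝒢 : Geometry C} {M : C} {G : Type} [Group G] [Finite G]
  {E : GerbeExtension 𝒢 G M} {D : UnitaryDual G} {T : Intertwiners D} {𝒪 : AlgebraPresheaf C}

namespace Chart

/-- A morphism of charts with constant data is `g` followed by a lift of a morphism of the dual. -/
lemma arr_eq_of_isConst {U V : Chart E.H} {a : U ⟶ V} {g : G} {ν : MulAut G} (h : IsConst a g ν)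
    {i k : D.Idx} (hk : T.act ν i = k) :
    a = U.gauge (.const _ g) ≫ DualChart.Hom.lift (h.along T hk) := by
  refine Hom.ext (Category.id_comp a.hom).symm ((E.fiberPart_spec a.arr a.arr_src).symm.trans ?_)
  refine E.H.mul_congr ?_ (Category.id_comp ((a.arr ≫ E.j) ≫ E.sec)).symm _
  exact congrArg _ (LocallyConstant.ext h.fiber_eq)

lemma IsConst.along_isConst {U V : Chart E.H} {a : U ⟶ V} {g : G} {ν : MulAut G}
    (h : IsConst a g ν) {i k : D.Idx} (hk : T.act ν i = k) :
    DualChart.IsConst (h.along T hk) ν 1 := ⟨h.ad_eq, fun _ => rfl⟩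

lemma gauge_isConst (U : Chart E.H) (g : G) : IsConst (U.gauge (.const _ g)) g 1 := by
  refine ⟨fun x => ?_, fun x => ?_⟩
  · refine (congrArg (fun φ => φ x) (E.fiberPart_eq _ (U.map ≫ E.Q.one) (m := U.map)
      (.const _ g) ?_ ?_)).trans rfl
    · simp [E.incl_tgt, E.sec_src, E.Q.one_src]
    · refine (E.H.mul_congr rfl ?_ _).trans (E.H.mul_one' U.map _ (E.incl_tgt _ _).symm)
      rw [Category.assoc, E.one_sec]
  · change E.ad ((E.incl U.map _ ≫ E.j) ≫ E.sec) x = 1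
    rw [E.incl_j, Category.assoc, E.one_sec, E.ad_one]

lemma gauge_along (U : Chart E.H) (g : G) {i : D.Idx} (h : T.act 1 i = i) :
    (U.gauge_isConst g).along T h = 𝟙 (U.toDual T i) :=
  DualChart.Hom.ext rfl (E.incl_j _ _) rfl

lemma lift_isConst {X Y : DualChart E T} {a : X ⟶ Y} {ν : MulAut G} {z : Circle}
    (h : DualChart.IsConst a ν z) : IsConst (DualChart.Hom.lift a) 1 ν := by
  refine ⟨fun x => ?_, fun x => ?_⟩
  · refine (congrArg (fun φ => φ x) (E.fiberPart_eq _ a.arr (m := X.map) 1 ?_ ?_)).trans rfl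
    · rw [E.incl_tgt]; exact (DualChart.Hom.lift a).arr_src.symm
    · refine (E.H.mul_congr (E.incl_one _) rfl _).trans (E.H.one_mul' X.map (a.arr ≫ E.sec) ?_)
      exact (DualChart.Hom.lift a).arr_src.symm
  · change E.ad (((a.arr ≫ E.sec) ≫ E.j) ≫ E.sec) x = ν
    rw [Category.assoc a.arr, E.sec_j, Category.comp_id, h.ad_eq]

end Chart

section counit
variable (h𝒢 : 𝒢.IsRegular) {F : Modules 𝒪 (Chart.forget E.H)} (hF : IsSheaf 𝒢 F)

/-- A Fourier coefficient of a section, as an equivariant map. -/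
def coeffSec (T : Intertwiners D) {U : Chart E.H} (n : F.Sec U) {i : D.Idx}
    (l : Module.Dual ℂ (D.V i)) : IsotypicSec F (U.toDual T i) :=
  ⟨D.coeff (gaugeRep F U) n l, D.coeff_rep (gaugeRep F U) n l⟩

lemma coeffSec_apply {U : Chart E.H} (n : F.Sec U) {i : D.Idx} (l : Module.Dual ℂ (D.V i))
    (v : D.V i) :
    (coeffSec T n l).1 v = ∑ g : G, l (D.rep i g⁻¹ v) • gaugeRep F U g n :=
  D.coeff_apply _ n l v

/-- The Fourier transform is compatible with restriction, by the substitution `y = Ad_{σ(q)}⁻¹(x g)`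
in the sum over the group. -/
lemma coeffSec_push {U V : Chart E.H} {a : U ⟶ V} {g : G} {ν : MulAut G} (h : Chart.IsConst a g ν)
    (n : F.Sec V) {i k : D.Idx} (hk : T.act ν i = k) (l : Module.Dual ℂ (D.V i)) :
    coeffSec T (F.restr a n) l =
      IsotypicSec.push (h.along_isConst hk) hk (coeffSec T n (T.codual g ν hk l)) := by
  refine IsotypicSec.ext fun v => ?_
  rw [IsotypicSec.push_apply, coeffSec_apply, coeffSec_apply, Circle.coe_one, one_smul, map_sum]
  refine Fintype.sum_equiv ((Equiv.mulRight g).trans ν.symm.toEquiv) _ _ fun x => ?_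
  obtain ⟨y, hy⟩ := ν.surjective (x * g)
  have hx : ((Equiv.mulRight g).trans ν.symm.toEquiv) x = y := by
    change ν.symm (x * g) = y
    rw [← hy, MulEquiv.symm_apply_apply]
  rw [hx, ← T.into_rep, T.codual_into, _root_.map_smul,
    show ν y⁻¹ = (x * g)⁻¹ by rw [_root_.map_inv, hy], ← Module.End.mul_apply,
    ← _root_.map_mul, mul_inv_rev, mul_inv_cancel_left]
  congr 1
  conv_lhs => rw [Chart.arr_eq_of_isConst h hk, F.restr_comp]
  rw [← gaugeRep_apply, ← Module.End.mul_apply, ← _root_.map_mul, ← hy, gaugeRep_apply,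
    gaugeRep_apply, ← F.restr_comp, ← F.restr_comp, DualChart.lift_gauge]
  congr 3
  refine congrArg _ (LocallyConstant.ext fun z => ?_)
  exact congrArg (fun ν : MulAut G => ν y) (h.ad_eq z).symm

/-- The Fourier transform of a section of a sheaf on the gerbe. -/
def fourier (T : Intertwiners D) (U : Chart E.H) :
    F.Sec U →ₗ[𝒪.at ((Chart.forget E.H).obj U)] TensorSec (isotypicModules T h𝒢 hF) U where
  toFun n i :=
    { toFun := fun l => (isotypicSecEquiv T h𝒢 hF (U.toDual T i)).symm (coeffSec T n l)
      map_add' := fun l l' => Subtype.ext (D.coeff_add_dual _ n l l')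
      map_smul' := fun z l => Subtype.ext (D.coeff_smul_dual _ n z l) }
  map_add' n n' := TensorSec.ext fun _ l => Subtype.ext (D.coeff_add _ n n' l)
  map_smul' r n := TensorSec.ext fun _ l => Subtype.ext <| LinearMap.ext fun v => by
    refine (D.coeff_apply _ (r • n) l v).trans
      (Eq.trans ?_ (congrArg (r • ·) (D.coeff_apply _ n l v)).symm)
    simp only [Finset.smul_sum, gaugeRep_smul, smul_comm r]

lemma fourier_apply {U : Chart E.H} (n : F.Sec U) (i : D.Idx) (l : Module.Dual ℂ (D.V i)) :
    isotypicSecEquiv T h𝒢 hF (U.toDual T i) (fourier h𝒢 hF T U n i l) = coeffSec T n l := rfl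

lemma fourier_push {U V : Chart E.H} {a : U ⟶ V} {g : G} {ν : MulAut G} (h : Chart.IsConst a g ν)
    (n : F.Sec V) : fourier h𝒢 hF T U (F.restr a n) = TensorSec.push h (fourier h𝒢 hF T V n) := by
  refine TensorSec.ext fun i l => ?_
  apply (isotypicSecEquiv T h𝒢 hF (U.toDual T i)).injective
  rw [fourier_apply, coeffSec_push h n rfl, TensorSec.push_apply h _ rfl,
    isotypicModules_restr h𝒢 hF (h.along_isConst rfl) rfl, fourier_apply]

/-- Injectivity is completeness of the matrix coefficients, surjectivity is Fourier synthesis. -/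
lemma fourier_bijective (U : Chart E.H) : Function.Bijective (fourier h𝒢 hF T U) := by
  constructor
  · refine (injective_iff_map_eq_zero _).2 fun n hn => ?_
    refine D.eq_zero_of_coeff_eq_zero (gaugeRep F U) fun i l => ?_
    have h : fourier h𝒢 hF T U n i l = 0 := congrArg (fun s : TensorSec _ U => s i l) hn
    exact congrArg (fun f => (isotypicSecEquiv T h𝒢 hF (U.toDual T i) f).1) h
  · intro s
    let s' : ∀ i, Module.Dual ℂ (D.V i) →ₗ[ℂ] D.V i →ₗ[ℂ] F.Sec U := fun i =>
      { toFun := fun l => (isotypicSecEquiv T h𝒢 hF (U.toDual T i) (s i l)).1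
        map_add' := fun l l' =>
          congrArg (fun f => (isotypicSecEquiv T h𝒢 hF (U.toDual T i) f).1) ((s i).map_add l l')
        map_smul' := fun z l =>
          congrArg (fun f => (isotypicSecEquiv T h𝒢 hF (U.toDual T i) f).1) ((s i).map_smul z l) }
    obtain ⟨n, hn⟩ := D.exists_coeff_eq (gaugeRep F U) s' fun i l g v =>
      (isotypicSecEquiv T h𝒢 hF (U.toDual T i) (s i l)).2 g v
    exact ⟨n, TensorSec.ext fun i l => Subtype.ext (hn i l)⟩

end counit
end

/-! ### Pure tensors and their multiplicity spaces -/

section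
universe v u
variable {C : Type u} [Category.{v} C] {𝒢 : Geometry C} {M : C} {G : Type} [Group G] [Finite G]
  {E : GerbeExtension 𝒢 G M} {D : UnitaryDual G} {T : Intertwiners D} {𝒪 : AlgebraPresheaf C}

section unit
variable (h𝒢 : 𝒢.IsRegular) {W : Modules 𝒪 (DualChart.forget E T)}
  (hs : IsSheaf 𝒢 W) (hW : IsTwisted W)

open Classical in
/-- The pure tensor `w ⊗ v` in the summand `W(U, i) ⊗ V_i`, regarded as `l ↦ l(v) w`. -/
def tmul {U : Chart E.H} {i : D.Idx} (w : W.Sec (U.toDual T i)) (v : D.V i) : TensorSec W U :=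
  Pi.single (M := fun i => Module.Dual ℂ (D.V i) →ₗ[ℂ] W.Sec (U.toDual T i)) i
    ((Module.Dual.eval ℂ (D.V i) v).smulRight w)

open Classical in
lemma tmul_self {U : Chart E.H} {i : D.Idx} (w : W.Sec (U.toDual T i)) (v : D.V i)
    (l : Module.Dual ℂ (D.V i)) : tmul w v i l = l v • w := by
  unfold tmul
  rw [Pi.single_eq_same]
  rfl

open Classical in
lemma tmul_ne {U : Chart E.H} {i k : D.Idx} (w : W.Sec (U.toDual T i)) (v : D.V i) (h : k ≠ i)
    (l : Module.Dual ℂ (D.V k)) : tmul w v k l = 0 := by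
  unfold tmul
  rw [Pi.single_eq_of_ne h]
  rfl

lemma tmul_add {U : Chart E.H} {i : D.Idx} (w : W.Sec (U.toDual T i)) (v v' : D.V i) :
    tmul w (v + v') = tmul w v + tmul w v' := by
  refine TensorSec.ext fun k l => ?_
  change _ = tmul w v k l + tmul w v' k l
  by_cases h : k = i
  · subst h
    rw [tmul_self, tmul_self, tmul_self, _root_.map_add, add_smul]
  · rw [tmul_ne _ _ h, tmul_ne _ _ h, tmul_ne _ _ h, add_zero]

lemma tmul_smul {U : Chart E.H} {i : D.Idx} (z : ℂ) (w : W.Sec (U.toDual T i)) (v : D.V i)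
    (k : D.Idx) (l : Module.Dual ℂ (D.V k)) : tmul w (z • v) k l = z • tmul w v k l := by
  by_cases h : k = i
  · subst h
    rw [tmul_self, tmul_self, _root_.map_smul, smul_assoc]
  · rw [tmul_ne _ _ h, tmul_ne _ _ h, smul_zero]

lemma add_tmul {U : Chart E.H} {i : D.Idx} (w w' : W.Sec (U.toDual T i)) (v : D.V i) :
    tmul (w + w') v = tmul w v + tmul w' v := by
  refine TensorSec.ext fun k l => ?_
  change _ = tmul w v k l + tmul w' v k l
  by_cases h : k = i
  · subst h
    rw [tmul_self, tmul_self, tmul_self, smul_add]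
  · rw [tmul_ne _ _ h, tmul_ne _ _ h, tmul_ne _ _ h, add_zero]

lemma smul_tmul {U : Chart E.H} {i : D.Idx} (r : 𝒪.at U.dom) (w : W.Sec (U.toDual T i))
    (v : D.V i) : tmul (r • w) v = r • tmul w v := by
  refine TensorSec.ext fun k l => ?_
  change _ = r • tmul w v k l
  by_cases h : k = i
  · subst h
    rw [tmul_self, tmul_self, smul_comm]
  · rw [tmul_ne _ _ h, tmul_ne _ _ h, smul_zero]

/-- An arrow `g σ(q)` acts on pure tensors by `Γ_q ⊗ ρ_i(g) T_q⁻¹`. -/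
lemma push_tmul {U V : Chart E.H} {a : U ⟶ V} {g : G} {ν : MulAut G} (h : Chart.IsConst a g ν)
    {i k : D.Idx} (hk : T.act ν i = k) (w : W.Sec (V.toDual T k)) (v : D.V k) :
    TensorSec.push h (tmul w v) =
      tmul (W.restr (h.along T hk) w) (D.rep i g ((T.into ν hk).symm v)) := by
  refine TensorSec.ext fun m l => ?_
  by_cases hm : m = i
  · subst hm
    rw [TensorSec.push_apply h _ hk, tmul_self, tmul_self, _root_.map_smul, T.codual_apply]
  · have hm' : T.act ν m ≠ k := fun e => hm (T.act_injective ν (e.trans hk.symm))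
    rw [TensorSec.push_apply h _ rfl, tmul_ne _ _ hm', tmul_ne _ _ hm, _root_.map_zero]

lemma gaugeRep_tensor {U : Chart E.H} (g : G) (s : (tensorModules h𝒢 hs hW).Sec U) {i : D.Idx}
    (l : Module.Dual ℂ (D.V i)) :
    tensorSecEquiv h𝒢 hs hW U (gaugeRep (tensorModules h𝒢 hs hW) U g s) i l =
      tensorSecEquiv h𝒢 hs hW U s i (l ∘ₗ D.rep i g) := by
  have h₁ : T.act 1 i = i := DualChart.act_one i
  rw [gaugeRep_apply, tensorModules_restr h𝒢 hs hW (U.gauge_isConst g),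
    TensorSec.push_apply _ _ h₁, Chart.gauge_along, W.restr_id]
  refine congrArg _ (LinearMap.ext fun v => ?_)
  obtain ⟨v, rfl⟩ := (T.into 1 h₁).surjective v
  rw [T.codual_into, T.into_one]
  rfl

/-- The evaluation `s ↦ s_i(l)`. -/
def evalSec (U : Chart E.H) (i : D.Idx) (l : Module.Dual ℂ (D.V i)) :
    (tensorModules h𝒢 hs hW).Sec U →ₗ[ℂ] W.Sec (U.toDual T i) where
  toFun s := tensorSecEquiv h𝒢 hs hW U s i l
  map_add' _ _ := rfl
  map_smul' _ _ := rfl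

lemma tensorSec_ext {U : Chart E.H} {s t : (tensorModules h𝒢 hs hW).Sec U}
    (h : ∀ i l, evalSec h𝒢 hs hW U i l s = evalSec h𝒢 hs hW U i l t) : s = t :=
  (tensorSecEquiv h𝒢 hs hW U).injective (TensorSec.ext h)

/-- The map from a twisted sheaf to the multiplicity spaces of the corresponding sheaf on the gerbe:
`w` is sent to `v ↦ w ⊗ v`. -/
def unitMap (X : DualChart E T) :
    W.Sec X →ₗ[𝒪.at ((DualChart.forget E T).obj X)] IsotypicSec (tensorModules h𝒢 hs hW) X where
  toFun w :=
    { val :=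
        { toFun := fun v => (tensorSecEquiv h𝒢 hs hW X.toChart).symm
            (tmul (U := X.toChart) (i := X.idx) w v)
          map_add' := fun v v' => tmul_add (U := X.toChart) (i := X.idx) w v v'
          map_smul' := fun z v => TensorSec.ext (tmul_smul (U := X.toChart) (i := X.idx) z w v) }
      property := fun g v => by
        apply (tensorSecEquiv h𝒢 hs hW X.toChart).injective
        refine TensorSec.ext fun k l => ?_
        rw [gaugeRep_tensor]
        change tmul (U := X.toChart) (i := X.idx) w (D.rep X.idx g v) k l =
          tmul (U := X.toChart) (i := X.idx) w v k (l ∘ₗ D.rep k g)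
        by_cases h : k = X.idx
        · subst h
          rw [tmul_self, tmul_self]
          rfl
        · rw [tmul_ne _ _ h, tmul_ne _ _ h] }
  map_add' w w' := IsotypicSec.ext fun v => add_tmul (U := X.toChart) (i := X.idx) w w' v
  map_smul' r w := IsotypicSec.ext fun v => smul_tmul (U := X.toChart) (i := X.idx) r w v

lemma unitMap_apply {X : DualChart E T} (w : W.Sec X) (v : D.V X.idx) :
    tensorSecEquiv h𝒢 hs hW X.toChart ((unitMap h𝒢 hs hW X w).1 v) =
      tmul (U := X.toChart) (i := X.idx) w v := rfl

lemma unitMap_push {X Y : DualChart E T} {a : X ⟶ Y} {ν : MulAut G} {z : Circle}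
    (h : DualChart.IsConst a ν z) (hν : T.act ν X.idx = Y.idx) (w : W.Sec Y) :
    unitMap h𝒢 hs hW X (W.restr a w) = IsotypicSec.push h hν (unitMap h𝒢 hs hW Y w) := by
  have hl := Chart.lift_isConst h
  have ha : W.restr a w = (z : ℂ) • W.restr (hl.along T hν) w := by
    refine hW.restr_eq (a := a) (b := hl.along T hν) rfl ?_ z (fun x => ?_) w
    · change a.arr = (a.arr ≫ E.sec) ≫ E.j
      rw [Category.assoc, E.sec_j, Category.comp_id]
    · rw [h.phase_eq]
      exact (mul_one z).symm
  refine IsotypicSec.ext fun v => tensorSec_ext h𝒢 hs hW fun k l => ?_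
  rw [IsotypicSec.push_apply, _root_.map_smul]
  change tmul (U := X.toChart) (i := X.idx) (W.restr a w) v k l = (z : ℂ) •
    tensorSecEquiv h𝒢 hs hW X.toChart ((tensorModules h𝒢 hs hW).restr (DualChart.Hom.lift a) _) k l
  rw [tensorModules_restr h𝒢 hs hW hl, unitMap_apply, push_tmul hl hν, _root_.map_one, ha]
  change _ = (z : ℂ) • tmul (U := X.toChart) (i := X.idx) _
    ((T.into ν hν).symm (T.into ν hν v)) k l
  rw [LinearEquiv.symm_apply_apply]
  exact congrArg (fun s : TensorSec W X.toChart => s k l)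
    (smul_tmul (U := X.toChart) (i := X.idx) (algebraMap ℂ (𝒪.at X.dom) z) _ v)

lemma unitMap_bijective (X : DualChart E T) : Function.Bijective (unitMap h𝒢 hs hW X) := by
  obtain ⟨l₀, v₀, h₀⟩ := D.exists_pair X.idx
  constructor
  · intro w w' h
    have h₁ := congrArg (fun f : IsotypicSec (tensorModules h𝒢 hs hW) X =>
      tensorSecEquiv h𝒢 hs hW X.toChart (f.1 v₀) X.idx l₀) h
    have h₂ : ∀ w : W.Sec X,
        tensorSecEquiv h𝒢 hs hW X.toChart ((unitMap h𝒢 hs hW X w).1 v₀) X.idx l₀ = w := fun w => by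
      rw [unitMap_apply]
      refine (tmul_self (U := X.toChart) (i := X.idx) w v₀ l₀).trans ?_
      rw [h₀, one_smul]
    exact (h₂ w).symm.trans (h₁.trans (h₂ w'))
  · intro f
    refine ⟨evalSec h𝒢 hs hW X.toChart X.idx l₀ (f.1 v₀), IsotypicSec.ext fun v =>
      tensorSec_ext h𝒢 hs hW fun k μ => ?_⟩
    -- Schur orthogonality expresses `f v` in terms of `f v₀`.
    have key : D.coeff (gaugeRep (tensorModules h𝒢 hs hW) X.toChart) (f.1 v₀) l₀ v =
        (D.weight X.idx)⁻¹ • f.1 v := by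
      rw [D.coeff_apply_equivariant _ f.1 f.2 l₀ v₀, LinearMap.comp_apply, D.average_self, h₀,
        mul_one, _root_.map_smul]
    let n : Module.Dual ℂ (D.V k) →ₗ[ℂ] W.Sec (X.toChart.toDual T k) :=
      tensorSecEquiv h𝒢 hs hW X.toChart (f.1 v₀) k
    have key₂ : (D.weight X.idx)⁻¹ • evalSec h𝒢 hs hW X.toChart k μ (f.1 v) =
        n (∑ g : G, l₀ (D.rep X.idx g⁻¹ v) • (μ ∘ₗ D.rep k g)) := by
      rw [← _root_.map_smul, ← key, D.coeff_apply, map_sum, map_sum]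
      refine Finset.sum_congr rfl fun g _ => ?_
      rw [_root_.map_smul, _root_.map_smul]
      exact congrArg _ (gaugeRep_tensor h𝒢 hs hW g (f.1 v₀) μ)
    have key₃ : ∀ w, (∑ g : G, l₀ (D.rep X.idx g⁻¹ v) • (μ ∘ₗ D.rep k g)) w =
        μ (D.average l₀ w v) := fun w => by
      rw [D.average_apply, map_sum, LinearMap.sum_apply]
      exact Finset.sum_congr rfl fun g _ => (_root_.map_smul μ _ _).symm
    apply smul_right_injective _ (inv_ne_zero (D.weight_ne_zero X.idx))
    refine Eq.trans ?_ key₂.symm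
    change (D.weight X.idx)⁻¹ • tmul (U := X.toChart) (i := X.idx) _ v k μ = _
    by_cases h : k = X.idx
    · subst h
      rw [tmul_self, show (∑ g : G, l₀ (D.rep X.idx g⁻¹ v) • (μ ∘ₗ D.rep X.idx g)) =
        ((D.weight X.idx)⁻¹ * μ v) • l₀ from LinearMap.ext fun w => by
          rw [key₃, D.average_self, _root_.map_smul, LinearMap.smul_apply, smul_eq_mul,
            smul_eq_mul]
          ring, _root_.map_smul, mul_smul]
      rfl
    · rw [tmul_ne _ _ h, smul_zero, show (∑ g : G, l₀ (D.rep X.idx g⁻¹ v) • (μ ∘ₗ D.rep k g)) = 0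
        from LinearMap.ext fun w => by
          rw [key₃, D.average_eq_zero (Ne.symm h), LinearMap.zero_apply, _root_.map_zero]
          rfl, _root_.map_zero]

end unit
end

/-! ### The equivalence -/

section
universe v u
variable {C : Type u} [Category.{v} C] {𝒢 : Geometry C} {M : C} {G : Type} [Group G] [Finite G]
  {E : GerbeExtension 𝒢 G M} {D : UnitaryDual G} {T : Intertwiners D} {𝒪 : AlgebraPresheaf C}

section
variable (h𝒢 : 𝒢.IsRegular)

/-- Maps on sections commute with all restrictions if they do so for morphisms with constant
data. -/
lemma isotypicModules_natural {F : Modules 𝒪 (Chart.forget E.H)} (hF : IsSheaf 𝒢 F)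
    (W : Modules 𝒪 (DualChart.forget E T)) (φ : ∀ X, W.Sec X → IsotypicSec F X)
    (h : ∀ {X Y : DualChart E T} {a : X ⟶ Y} {ν : MulAut G} {z : Circle}
      (h : DualChart.IsConst a ν z) (hν : T.act ν X.idx = Y.idx) s,
      φ X (W.restr a s) = IsotypicSec.push h hν (φ Y s)) {X Y : DualChart E T} (a : X ⟶ Y)
    (s : W.Sec Y) :
    φ X (W.restr a s) = isotypicSecEquiv T h𝒢 hF X
      ((isotypicModules T h𝒢 hF).restr a ((isotypicSecEquiv T h𝒢 hF Y).symm (φ Y s))) := by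
  refine ((isotypicLocal h𝒢 hF T).extend_eq (i := X.idx) (k := Y.idx)
      (U := ⟨X.dom, X.map, X.etale⟩) (V := ⟨Y.dom, Y.map, Y.etale⟩) (s := φ Y s)
      (t := φ X (W.restr a s)) a ?_).symm
  rintro U' e _ ⟨ν, z, h', hν, rfl⟩
  refine (IsotypicSec.push_ofEtale e _).symm.trans ?_
  refine (h (DualChart.isConst_ofEtale (i := X.idx) e) (DualChart.act_one X.idx) _).symm.trans ?_
  rw [← W.restr_comp]
  exact h h' hν s

section
variable {F F' : Modules 𝒪 (Chart.forget E.H)} (hF : IsSheaf 𝒢 F) (hF' : IsSheaf 𝒢 F')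

/-- The effect of a morphism of sheaves on the gerbe. -/
def IsotypicSec.map (φ : F ⟶ F') (X : DualChart E T) :
    IsotypicSec F X →ₗ[𝒪.at ((DualChart.forget E T).obj X)] IsotypicSec F' X where
  toFun f :=
    { val := ((Modules.homSec φ X.toChart).restrictScalars ℂ) ∘ₗ f.1
      property := fun g v => (congrArg (Modules.homSec φ X.toChart) (f.2 g v)).trans
        (Modules.homSec_restr φ _ _) }
  map_add' _ _ := IsotypicSec.ext fun _ => (Modules.homSec φ X.toChart).map_add _ _
  map_smul' r _ := IsotypicSec.ext fun _ => (Modules.homSec φ X.toChart).map_smul r _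

lemma IsotypicSec.map_push (φ : F ⟶ F') {X Y : DualChart E T} {a : X ⟶ Y} {ν : MulAut G}
    {z : Circle} (h : DualChart.IsConst a ν z) (hν : T.act ν X.idx = Y.idx)
    (f : IsotypicSec F Y) : map φ X (push h hν f) = push h hν (map φ Y f) := by
  refine IsotypicSec.ext fun v => ?_
  refine (((Modules.homSec φ X.toChart).restrictScalars ℂ).map_smul (z : ℂ) _).trans ?_
  exact congrArg ((z : ℂ) • ·) (Modules.homSec_restr φ _ _)

variable (T) in
/-- The functoriality of the twisted sheaf in the sheaf on the gerbe. -/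
def isotypicMap (φ : F ⟶ F') : isotypicModules T h𝒢 hF ⟶ isotypicModules T h𝒢 hF' :=
  Modules.homMk (fun X => (isotypicSecEquiv T h𝒢 hF' X).symm.toLinearMap ∘ₗ IsotypicSec.map φ X ∘ₗ
    (isotypicSecEquiv T h𝒢 hF X).toLinearMap) fun {X Y} a s =>
      isotypicModules_natural h𝒢 hF' _
        (fun X s => IsotypicSec.map φ X (isotypicSecEquiv T h𝒢 hF X s))
        (fun h hν s => by rw [isotypicModules_restr h𝒢 hF h hν, IsotypicSec.map_push]) a s

/-- Fourier inversion: a sheaf on the gerbe is recovered from its isotypic components. -/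
def fourierIso (hs : IsSheaf 𝒢 (isotypicModules T h𝒢 hF))
    (hW : IsTwisted (isotypicModules T h𝒢 hF)) :
    F ≅ tensorModules h𝒢 hs hW :=
  Modules.isoMk (fun U => (LinearEquiv.ofBijective (fourier h𝒢 hF T U)
    (fourier_bijective h𝒢 hF U)).trans (tensorSecEquiv h𝒢 hs hW U).symm) fun {_ _} a s =>
      tensorModules_natural h𝒢 hs hW _ (fun U => fourier h𝒢 hF T U)
        (fun h s => fourier_push h𝒢 hF h s) a s

end

section
variable {W : Modules 𝒪 (DualChart.forget E T)} (hs : IsSheaf 𝒢 W) (hW : IsTwisted W)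

/-- A twisted sheaf is recovered from the corresponding sheaf on the gerbe. -/
def unitIso (hF : IsSheaf 𝒢 (tensorModules h𝒢 hs hW)) :
    W ≅ isotypicModules T h𝒢 hF :=
  Modules.isoMk (fun X => (LinearEquiv.ofBijective (unitMap h𝒢 hs hW X)
    (unitMap_bijective h𝒢 hs hW X)).trans (isotypicSecEquiv T h𝒢 hF X).symm) fun {_ _} a s =>
      isotypicModules_natural h𝒢 hF _ (fun X => unitMap h𝒢 hs hW X)
        (fun h hν s => unitMap_push h𝒢 hs hW h hν s) a s

end

section
variable (E T 𝒪)
variable (P : ∀ {S : Type (max u v)} [Category.{v} S] {π : S ⥤ C}, Modules 𝒪 π → Prop)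

/-- The functor from twisted sheaves to sheaves on the gerbe. -/
abbrev tensorFunctor (hP : ∀ (W : Modules 𝒪 (DualChart.forget E T)) (hs : IsSheaf 𝒢 W)
      (hW : IsTwisted W), P W → P (tensorModules h𝒢 hs hW)) :
    ObjectProperty.FullSubcategory
      (fun W : Modules 𝒪 (DualChart.forget E T) => IsSheaf 𝒢 W ∧ IsTwisted W ∧ P W) ⥤
    ObjectProperty.FullSubcategory
      (fun F : Modules 𝒪 (Chart.forget E.H) => IsSheaf 𝒢 F ∧ P F) where
  obj W := ⟨tensorModules h𝒢 W.2.1 W.2.2.1, tensorModules_isSheaf h𝒢 W.2.1 W.2.2.1,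
    hP W.1 W.2.1 W.2.2.1 W.2.2.2⟩
  map {W W'} φ := ObjectProperty.homMk
    (tensorMap h𝒢 W.2.1 W.2.2.1 W'.2.1 W'.2.2.1 φ.hom)
  map_id _ := rfl
  map_comp _ _ := rfl

/-- The functor from sheaves on the gerbe to twisted sheaves. -/
abbrev isotypicFunctor (hP : ∀ (F : Modules 𝒪 (Chart.forget E.H)) (hF : IsSheaf 𝒢 F), P F →
      P (isotypicModules T h𝒢 hF)) :
    ObjectProperty.FullSubcategory
      (fun F : Modules 𝒪 (Chart.forget E.H) => IsSheaf 𝒢 F ∧ P F) ⥤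
    ObjectProperty.FullSubcategory
      (fun W : Modules 𝒪 (DualChart.forget E T) => IsSheaf 𝒢 W ∧ IsTwisted W ∧ P W) where
  obj F := ⟨isotypicModules T h𝒢 F.2.1, isotypicModules_isSheaf h𝒢 F.2.1,
    isotypicModules_isTwisted h𝒢 F.2.1, hP F.1 F.2.1 F.2.2⟩
  map {F F'} φ := ObjectProperty.homMk (isotypicMap T h𝒢 F.2.1 F'.2.1 φ.hom)
  map_id _ := rfl
  map_comp _ _ := rfl

/-- Twisted sheaves on the dual and sheaves on the gerbe, with a property preserved by the two
constructions, are equivalent. -/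
def dualityEquivalence
    (hP : ∀ (W : Modules 𝒪 (DualChart.forget E T)) (hs : IsSheaf 𝒢 W)
      (hW : IsTwisted W), P W → P (tensorModules h𝒢 hs hW))
    (hP' : ∀ (F : Modules 𝒪 (Chart.forget E.H)) (hF : IsSheaf 𝒢 F), P F →
      P (isotypicModules T h𝒢 hF)) :
    ObjectProperty.FullSubcategory
      (fun W : Modules 𝒪 (DualChart.forget E T) => IsSheaf 𝒢 W ∧ IsTwisted W ∧ P W) ≌
    ObjectProperty.FullSubcategory
      (fun F : Modules 𝒪 (Chart.forget E.H) => IsSheaf 𝒢 F ∧ P F) :=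
  CategoryTheory.Equivalence.mk (tensorFunctor E T 𝒪 h𝒢 P hP) (isotypicFunctor E T 𝒪 h𝒢 P hP')
    (NatIso.ofComponents (fun W => ObjectProperty.isoMk _ (unitIso h𝒢 W.2.1 W.2.2.1 _))
      fun {_ W'} φ => by
        refine ObjectProperty.hom_ext _ (Modules.hom_ext fun X w => IsotypicSec.ext fun v => ?_)
        refine tensorSec_ext h𝒢 W'.2.1 W'.2.2.1 fun k l => ?_
        change tmul (U := X.toChart) (i := X.idx) (Modules.homSec φ.hom X w) v k l =
          Modules.homSec φ.hom (X.toChart.toDual T k)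
            (tmul (U := X.toChart) (i := X.idx) w v k l)
        by_cases h : k = X.idx
        · subst h
          rw [tmul_self, tmul_self]
          exact (((Modules.homSec φ.hom X).restrictScalars ℂ).map_smul (l v) w).symm
        · rw [tmul_ne _ _ h, tmul_ne _ _ h, _root_.map_zero])
    (NatIso.ofComponents (fun F => (ObjectProperty.isoMk _ (fourierIso h𝒢 F.2.1 _ _)).symm)
      fun {F F'} φ => by
        rw [Iso.symm_hom, Iso.symm_hom, Iso.comp_inv_eq, Category.assoc, Iso.eq_inv_comp]
        refine ObjectProperty.hom_ext _ (Modules.hom_ext fun U n => TensorSec.ext fun i l =>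
          IsotypicSec.ext fun v => ?_)
        refine Eq.symm ((D.coeff_apply (gaugeRep F'.obj U) (Modules.homSec φ.hom U n) l v).trans
          (Eq.symm ((congrArg (Modules.homSec φ.hom U)
            (D.coeff_apply (gaugeRep F.obj U) n l v)).trans ?_)))
        rw [map_sum]
        refine Finset.sum_congr rfl fun g _ => ?_
        refine (((Modules.homSec φ.hom U).restrictScalars ℂ).map_smul _ _).trans ?_
        exact congrArg _ (Modules.homSec_restr φ.hom _ _))

end
end
end

/-! ### The summands of the sheaf on the gerbe -/

section
open TensorProduct

/-- The isomorphism from `N ⊗ V` to the space of linear maps from the dual of `V` to `N`. -/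
def tensorEquivHomDual (N V : Type) [AddCommGroup N] [Module ℂ N] [AddCommGroup V] [Module ℂ V]
    [FiniteDimensional ℂ V] : N ⊗[ℂ] V ≃ₗ[ℂ] (Module.Dual ℂ V →ₗ[ℂ] N) :=
  (TensorProduct.comm ℂ N V).trans <|
    (TensorProduct.congr (Module.evalEquiv ℂ V) (LinearEquiv.refl ℂ N)).trans <|
      dualTensorHomEquiv ℂ (Module.Dual ℂ V) N

lemma tensorEquivHomDual_tmul {N V : Type} [AddCommGroup N] [Module ℂ N] [AddCommGroup V]
    [Module ℂ V] [FiniteDimensional ℂ V] (n : N) (v : V) :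
    tensorEquivHomDual N V (n ⊗ₜ v) = (Module.Dual.eval ℂ V v).smulRight n := by
  refine LinearMap.ext fun l => ?_
  simp [tensorEquivHomDual, dualTensorHomEquiv]

open Classical in
lemma toModule_single_bijective {ι : Type} [Finite ι] {A B : ι → Type} [∀ i, AddCommGroup (A i)]
    [∀ i, AddCommGroup (B i)] [∀ i, Module ℂ (A i)] [∀ i, Module ℂ (B i)]
    (e : ∀ i, A i ≃ₗ[ℂ] B i) :
    Function.Bijective (DirectSum.toModule ℂ ι (∀ i, B i)
      fun i => LinearMap.single ℂ B i ∘ₗ (e i).toLinearMap) := by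
  have := Fintype.ofFinite ι
  let f := (DirectSum.linearEquivFunOnFintype ℂ ι A).trans (LinearEquiv.piCongrRight e)
  convert f.bijective
  refine congrArg DFunLike.coe (?_ : _ = f.toLinearMap)
  refine DirectSum.linearMap_ext ℂ fun i => LinearMap.ext fun a => ?_
  rw [LinearMap.comp_apply, DirectSum.toModule_lof]
  funext k
  change Pi.single i (e i a) k = e k (DirectSum.linearEquivFunOnFintype ℂ ι A
    (DirectSum.lof ℂ ι A i a) k)
  rw [DirectSum.linearEquivFunOnFintype_lof]
  by_cases h : k = i
  · subst h; simp
  · simp [h]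

end

section
universe v u
variable {C : Type u} [Category.{v} C] {𝒢 : Geometry C} {M : C} {G : Type} [Group G] [Finite G]
  {E : GerbeExtension 𝒢 G M} {D : UnitaryDual G} {T : Intertwiners D} {𝒪 : AlgebraPresheaf C}
open TensorProduct

open Classical in
/-- The inclusion of the summand `W(U, i) ⊗ V_i`. -/
def tensorInclusion (W : Modules 𝒪 (DualChart.forget E T)) (U : Chart E.H) (i : D.Idx) :
    W.Sec (U.toDual T i) ⊗[ℂ] D.V i →ₗ[ℂ]
      (∀ i, Module.Dual ℂ (D.V i) →ₗ[ℂ] W.Sec (U.toDual T i)) :=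
  LinearMap.single ℂ (fun i => Module.Dual ℂ (D.V i) →ₗ[ℂ] W.Sec (U.toDual T i)) i ∘ₗ
    (tensorEquivHomDual (W.Sec (U.toDual T i)) (D.V i)).toLinearMap

lemma tensorInclusion_tmul {W : Modules 𝒪 (DualChart.forget E T)} {U : Chart E.H} {i : D.Idx}
    (w : W.Sec (U.toDual T i)) (v : D.V i) : tensorInclusion W U i (w ⊗ₜ v) = tmul w v := by
  classical
  refine (congrArg (Pi.single (M := fun i => Module.Dual ℂ (D.V i) →ₗ[ℂ] W.Sec (U.toDual T i)) i)
    (tensorEquivHomDual_tmul w v)).trans ?_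
  unfold tmul
  congr!

lemma map_tmul {W W' : Modules 𝒪 (DualChart.forget E T)} (φ : W ⟶ W') {U : Chart E.H} {i : D.Idx}
    (w : W.Sec (U.toDual T i)) (v : D.V i) :
    TensorSec.map φ U (tmul w v) = tmul (Modules.homSec φ (U.toDual T i) w) v := by
  refine TensorSec.ext fun k l => ?_
  change Modules.homSec φ (U.toDual T k) (tmul w v k l) = _
  by_cases h : k = i
  · subst h
    rw [tmul_self, tmul_self]
    exact ((Modules.homSec φ (U.toDual T k)).restrictScalars ℂ).map_smul (l v) w
  · rw [tmul_ne _ _ h, tmul_ne _ _ h, _root_.map_zero]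

/-- If both constructions preserve the property `P`, then tensoring with the twisted sheaf `V` is an
equivalence between the categories of objects with this property. -/
theorem duality_of_preserves (h𝒢 : 𝒢.IsRegular)
    (P : ∀ {S : Type (max u v)} [Category.{v} S] {π : S ⥤ C}, Modules 𝒪 π → Prop)
    (hP : ∀ (W : Modules 𝒪 (DualChart.forget E T)) (hs : IsSheaf 𝒢 W)
      (hW : IsTwisted W), P W → P (tensorModules h𝒢 hs hW))
    (hP' : ∀ (F : Modules 𝒪 (Chart.forget E.H)) (hF : IsSheaf 𝒢 F), P F →
      P (isotypicModules T h𝒢 hF)) : Duality E T 𝒪 P := by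
  refine ⟨dualityEquivalence E T 𝒪 h𝒢 P hP hP', fun W U i => tensorInclusion W.obj U i,
    fun W U => ?_, fun W U i r w v => ?_, fun W W' φ U i w v => ?_,
    fun W U V a g ν ha hν i w v => ?_⟩
  · exact toModule_single_bijective fun i =>
      tensorEquivHomDual (W.obj.Sec (U.toDual T i)) (D.V i)
  · refine (tensorInclusion_tmul (W := W.obj)
      (W.obj.scale r w : W.obj.Sec (U.toDual T i)) v).trans ?_
    refine (smul_tmul r (w : W.obj.Sec (U.toDual T i)) v).trans ?_
    exact congrArg (fun s : TensorSec W.obj U => r • s)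
      (tensorInclusion_tmul (w : W.obj.Sec (U.toDual T i)) v).symm
  · refine (congrArg (TensorSec.map φ.hom U)
      (tensorInclusion_tmul (w : W.obj.Sec (U.toDual T i)) v)).trans ?_
    refine Eq.trans ?_ (tensorInclusion_tmul (Modules.homSec φ.hom (U.toDual T i) w) v).symm
    exact map_tmul φ.hom _ v
  · have h : Chart.IsConst a g ν := Chart.IsConst.of_arr_eq _ ha hν
    refine (congrArg ((tensorModules h𝒢 W.2.1 W.2.2.1).restr a)
      (tensorInclusion_tmul (w : W.obj.Sec (V.toDual T (T.act ν i))) v)).trans ?_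
    refine (tensorModules_restr h𝒢 W.2.1 W.2.2.1 h _).trans ?_
    refine (push_tmul h rfl (w : W.obj.Sec (V.toDual T (T.act ν i))) v).trans ?_
    exact (tensorInclusion_tmul _ _).symm

end

/-! ### Local homeomorphisms and étale morphisms of schemes -/

lemma topological_isRegular : topological.IsRegular where
  comp f g hf hg := by
    exact IsLocalHomeomorph.comp (g := g) (f := f) hg hf
  of_comp f g hg hfg := by
    exact IsLocalHomeomorph.of_comp (g := g) (f := f) hfg hg f.hom.continuous
  pullback {U V V'} h f hf x hx := by
    -- A local section of `f` near `h x` is defined on an open set whose preimage in `U` suffices.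
    obtain ⟨y, hy : f y = h x⟩ := hx
    obtain ⟨e, he, hfe⟩ := (hf : IsLocalHomeomorph f) y
    have hN : IsOpen (h ⁻¹' e.target) := e.open_target.preimage h.hom.continuous
    refine ⟨TopCat.of (h ⁻¹' e.target), TopCat.ofHom ⟨Subtype.val, continuous_subtype_val⟩,
      TopCat.ofHom ⟨fun u => e.symm (h u), ?_⟩, hN.isOpenEmbedding_subtypeVal.isLocalHomeomorph,
      ?_, ⟨x, ?_⟩, rfl⟩
    · exact e.continuousOn_symm.comp_continuous (h.hom.continuous.comp continuous_subtype_val)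
        fun u => u.2
    · ext u
      change h u = f (e.symm (h u))
      rw [hfe, e.right_inv u.2]
    · change h x ∈ e.target
      rw [← hy, hfe]
      exact e.map_source he

lemma algebraic_isRegular : algebraic.IsRegular where
  comp f g hf hg := by
    have : Etale f.left := hf
    have : Etale g.left := hg
    change Etale (f.left ≫ g.left)
    infer_instance
  of_comp f g hg hfg := by
    have : Etale g.left := hg
    have : Etale (f.left ≫ g.left) := hfg
    exact Etale.of_comp f.left g.left
  pullback {U V V'} h f hf x hx := by
    have : Etale f.left := hf
    obtain ⟨y, hy⟩ := hx
    obtain ⟨z, hz, -⟩ := Scheme.Pullback.exists_preimage_pullback (f := h.left) (g := f.left) x y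
      hy.symm
    refine ⟨Over.mk (Limits.pullback.fst h.left f.left ≫ U.hom),
      Over.homMk (Limits.pullback.fst h.left f.left),
      Over.homMk (Limits.pullback.snd h.left f.left) ?_,
      (inferInstance : Etale (Limits.pullback.fst h.left f.left)), ?_, z, hz⟩
    · rw [← Over.w f, ← Category.assoc, ← Limits.pullback.condition, Category.assoc, Over.w h]
      rfl
    · exact Over.OverMorphism.ext Limits.pullback.condition

/-! ### Base change of modules -/

section
open TensorProduct

section
variable {R R' : Type} [CommRing R] [CommRing R'] [Algebra R R'] {N N' : Type} [AddCommGroup N]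
  [AddCommGroup N'] [Module R N] [Module R' N'] [Module R N'] [IsScalarTower R R' N']

/-- The canonical map from the base change of `N` to `N'`. -/
def baseChangeLift (ℓ : N →ₗ[R] N') : R' ⊗[R] N →ₗ[R'] N' :=
  (TensorProduct.isBaseChange R N R').lift ℓ

lemma baseChangeLift_one_tmul (ℓ : N →ₗ[R] N') (n : N) :
    baseChangeLift ℓ ((1 : R') ⊗ₜ n) = ℓ n :=
  (TensorProduct.isBaseChange R N R').lift_eq ℓ n

lemma isBaseChange_iff_bijective (ℓ : N →ₗ[R] N') :
    IsBaseChange R' ℓ ↔ Function.Bijective (baseChangeLift (R' := R') ℓ) := by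
  constructor
  · intro h
    have : baseChangeLift ℓ = h.equiv.toLinearMap := by
      refine (TensorProduct.isBaseChange R N R').algHom_ext _ _ fun n => ?_
      refine (baseChangeLift_one_tmul ℓ n).trans ?_
      exact ((h.equiv_tmul 1 n).trans (one_smul _ _)).symm
    rw [this]
    exact h.equiv.bijective
  · intro h
    exact IsBaseChange.of_equiv (LinearEquiv.ofBijective _ h) (baseChangeLift_one_tmul ℓ)

/-- A map is base change if it is so after localization at elements generating the unit ideal. -/
lemma isBaseChange_of_span (ℓ : N →ₗ[R] N') (s : Set R') (hs : Ideal.span s = ⊤) (A N'' : s → Type)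
    [∀ r, CommRing (A r)] [∀ r, AddCommGroup (N'' r)] [∀ r, Algebra R' (A r)]
    [∀ r, Algebra R (A r)] [∀ r, IsScalarTower R R' (A r)] [∀ r, Module (A r) (N'' r)]
    [∀ r, Module R' (N'' r)] [∀ r, Module R (N'' r)] [∀ r, IsScalarTower R' (A r) (N'' r)]
    [∀ r, IsScalarTower R (A r) (N'' r)] [∀ r, IsScalarTower R R' (N'' r)]
    [∀ r, IsLocalization.Away r.1 (A r)] (ℓ' : ∀ r, N' →ₗ[R'] N'' r)
    (h : ∀ r, IsBaseChange (A r) (ℓ' r))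
    (h' : ∀ r, IsBaseChange (A r) ((ℓ' r).restrictScalars R ∘ₗ ℓ)) : IsBaseChange R' ℓ := by
  rw [isBaseChange_iff_bijective]
  have h₁ : ∀ r, IsLocalizedModule.Away r.1 (ℓ' r) := fun r =>
    (isLocalizedModule_iff_isBaseChange (.powers r.1) (A r) _).2 (h r)
  have h₂ : ∀ r, IsLocalizedModule.Away r.1 (ℓ' r ∘ₗ baseChangeLift (R' := R') ℓ) := fun r => by
    refine (isLocalizedModule_iff_isBaseChange (.powers r.1) (A r) _).2 ?_
    refine IsBaseChange.of_comp (TensorProduct.isBaseChange R N R') ?_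
    convert h' r using 1
    exact LinearMap.ext fun n => congrArg (ℓ' r) (baseChangeLift_one_tmul ℓ n)
  generalize baseChangeLift (R' := R') ℓ = H at h₂ ⊢
  refine bijective_of_isLocalized_span s hs N'' (fun r => ℓ' r ∘ₗ H) N'' ℓ' H fun r => ?_
  have : IsLocalizedModule.map (.powers r.1) (ℓ' r ∘ₗ H) (ℓ' r) H = LinearMap.id :=
    IsLocalizedModule.linearMap_ext (.powers r.1) (ℓ' r ∘ₗ H) (ℓ' r) (LinearMap.ext fun t =>
      IsLocalizedModule.map_apply (.powers r.1) (ℓ' r ∘ₗ H) (ℓ' r) H t)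
  rw [this]
  exact Function.bijective_id

/-- A map is base change if it is, compatibly, a finite sum of retracts of base changes. -/
lemma isBaseChange_of_retracts {κ : Type} [Fintype κ] {K K' : κ → Type} [∀ k, AddCommGroup (K k)]
    [∀ k, AddCommGroup (K' k)] [∀ k, Module R (K k)] [∀ k, Module R' (K' k)]
    [∀ k, Module R (K' k)] [∀ k, IsScalarTower R R' (K' k)] {ℓ : N →ₗ[R] N'}
    {m : ∀ k, K k →ₗ[R] K' k} (hm : ∀ k, IsBaseChange R' (m k)) (i : ∀ k, K k →ₗ[R] N)
    (p : ∀ k, N →ₗ[R] K k) (i' : ∀ k, K' k →ₗ[R'] N') (p' : ∀ k, N' →ₗ[R'] K' k)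
    (hi : ∀ k x, ℓ (i k x) = i' k (m k x)) (hp : ∀ k x, m k (p k x) = p' k (ℓ x))
    (h : ∀ n, ∑ k, i k (p k n) = n) (h' : ∀ n, ∑ k, i' k (p' k n) = n) :
    IsBaseChange R' ℓ := by
  simp only [isBaseChange_iff_bijective] at hm ⊢
  have hi' : ∀ k t, baseChangeLift ℓ ((i k).baseChange R' t) = i' k (baseChangeLift (m k) t) :=
    fun k => LinearMap.congr_fun ((TensorProduct.isBaseChange R (K k) R').algHom_ext
      (baseChangeLift ℓ ∘ₗ (i k).baseChange R') (i' k ∘ₗ baseChangeLift (m k)) fun x => by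
        change baseChangeLift ℓ ((1 : R') ⊗ₜ i k x) = i' k (baseChangeLift (m k) ((1 : R') ⊗ₜ x))
        rw [baseChangeLift_one_tmul, baseChangeLift_one_tmul, hi])
  have hp' : ∀ k t, baseChangeLift (m k) ((p k).baseChange R' t) = p' k (baseChangeLift ℓ t) :=
    fun k => LinearMap.congr_fun ((TensorProduct.isBaseChange R N R').algHom_ext
      (baseChangeLift (m k) ∘ₗ (p k).baseChange R') (p' k ∘ₗ baseChangeLift ℓ) fun x => by
        change baseChangeLift (m k) ((1 : R') ⊗ₜ p k x) = p' k (baseChangeLift ℓ ((1 : R') ⊗ₜ x))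
        rw [baseChangeLift_one_tmul, baseChangeLift_one_tmul, hp])
  have hs : ∀ t, ∑ k, (i k).baseChange R' ((p k).baseChange R' t) = t := by
    have : ∑ k, (i k).baseChange R' ∘ₗ (p k).baseChange R' = LinearMap.id :=
      (TensorProduct.isBaseChange R N R').algHom_ext _ _ fun x => by
        rw [LinearMap.sum_apply]
        change ∑ k, (1 : R') ⊗ₜ[R] i k (p k x) = (1 : R') ⊗ₜ[R] x
        rw [← TensorProduct.tmul_sum, h]
    intro t
    simpa using LinearMap.congr_fun this t
  constructor
  · rw [injective_iff_map_eq_zero]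
    intro t ht
    rw [← hs t]
    refine Finset.sum_eq_zero fun k _ => ?_
    rw [(injective_iff_map_eq_zero _).1 (hm k).1 ((p k).baseChange R' t)
      (by rw [hp', ht, map_zero]), map_zero]
  · intro n
    choose t ht using fun k => (hm k).2 (p' k n)
    refine ⟨∑ k, (i k).baseChange R' (t k), ?_⟩
    rw [map_sum, ← h' n]
    exact Finset.sum_congr rfl fun k _ => by rw [hi', ht]

end

section
variable {R R' : Type} [CommRing R] [CommRing R'] {φ : R →+* R'} {N N' : Type} [AddCommGroup N]
  [AddCommGroup N'] [Module R N] [Module R' N']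

/-- The canonical map from `R' ⊗_R N` to `N'` defined by a `φ`-semilinear map is bijective. The
algebra structure is confined to the definition, as rings of sections are related by many maps. -/
def IsBaseChangeAlong (ℓ : N →ₛₗ[φ] N') : Prop :=
  letI := φ.toAlgebra
  letI := Module.compHom N' φ
  haveI : IsScalarTower R R' N' := ⟨fun r s n => mul_smul (φ r) s n⟩
  IsBaseChange R' ({ toFun := ℓ, map_add' := ℓ.map_add, map_smul' := ℓ.map_smulₛₗ } : N →ₗ[R] N')

lemma isBaseChangeAlong_of_retracts {κ : Type} [Fintype κ] {K K' : κ → Type}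
    [∀ k, AddCommGroup (K k)] [∀ k, AddCommGroup (K' k)] [∀ k, Module R (K k)]
    [∀ k, Module R' (K' k)] {ℓ : N →ₛₗ[φ] N'}
    {m : ∀ k, K k →ₛₗ[φ] K' k} (hm : ∀ k, IsBaseChangeAlong (m k)) (i : ∀ k, K k →ₗ[R] N)
    (p : ∀ k, N →ₗ[R] K k) (i' : ∀ k, K' k →ₗ[R'] N') (p' : ∀ k, N' →ₗ[R'] K' k)
    (hi : ∀ k x, ℓ (i k x) = i' k (m k x)) (hp : ∀ k x, m k (p k x) = p' k (ℓ x))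
    (h : ∀ n, ∑ k, i k (p k n) = n) (h' : ∀ n, ∑ k, i' k (p' k n) = n) :
    IsBaseChangeAlong ℓ := by
  let := φ.toAlgebra
  let := Module.compHom N' φ
  have : IsScalarTower R R' N' := ⟨fun r s n => mul_smul (φ r) s n⟩
  let := fun k => Module.compHom (K' k) φ
  have : ∀ k, IsScalarTower R R' (K' k) := fun k => ⟨fun r s n => mul_smul (φ r) s n⟩
  exact isBaseChange_of_retracts hm i p i' p' hi hp h h'

lemma isBaseChangeAlong_of_span {J : Type} (ℓ : N →ₛₗ[φ] N') (f : J → R')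
    (hf : Ideal.span (Set.range f) = ⊤) {A N'' : J → Type} [∀ j, CommRing (A j)]
    [∀ j, AddCommGroup (N'' j)] [∀ j, Module (A j) (N'' j)] (ψ : ∀ j, R' →+* A j)
    (hψ : ∀ j, letI := (ψ j).toAlgebra; IsLocalization.Away (f j) (A j))
    (ℓ' : ∀ j, N' →ₛₗ[ψ j] N'' j) (h : ∀ j, IsBaseChangeAlong (ℓ' j))
    {χ : ∀ j, R →+* A j} (hχ : ∀ j, χ j = (ψ j).comp φ) {m : ∀ j, N →ₛₗ[χ j] N'' j}
    (hm : ∀ j n, m j n = ℓ' j (ℓ n)) (h' : ∀ j, IsBaseChangeAlong (m j)) :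
    IsBaseChangeAlong ℓ := by
  obtain rfl : χ = fun j => (ψ j).comp φ := funext hχ
  choose j hj using fun r : Set.range f => r.2
  let := φ.toAlgebra
  let := Module.compHom N' φ
  have : IsScalarTower R R' N' := ⟨fun r s n => mul_smul (φ r) s n⟩
  let := fun r => (ψ (j r)).toAlgebra
  let := fun r => ((ψ (j r)).comp φ).toAlgebra
  let := fun r => Module.compHom (N'' (j r)) (ψ (j r))
  let := fun r => Module.compHom (N'' (j r)) ((ψ (j r)).comp φ)
  have : ∀ r, IsScalarTower R R' (A (j r)) := fun r => IsScalarTower.of_algebraMap_eq fun _ => rfl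
  have : ∀ r, IsScalarTower R' (A (j r)) (N'' (j r)) := fun r =>
    ⟨fun x s n => mul_smul (ψ (j r) x) s n⟩
  have : ∀ r, IsScalarTower R (A (j r)) (N'' (j r)) := fun r =>
    ⟨fun x s n => mul_smul (ψ (j r) (φ x)) s n⟩
  have : ∀ r, IsScalarTower R R' (N'' (j r)) := fun r =>
    ⟨fun x s n => (congrArg (· • n) ((ψ (j r)).map_mul (φ x) s)).trans
      (mul_smul (ψ (j r) (φ x)) (ψ (j r) s) n)⟩
  have : ∀ r : Set.range f, IsLocalization.Away r.1 (A (j r)) := fun r => hj r ▸ hψ (j r)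
  refine isBaseChange_of_span _ (Set.range f) hf (fun r => A (j r)) (fun r => N'' (j r))
    (fun r => { toFun := ℓ' (j r), map_add' := (ℓ' (j r)).map_add,
                map_smul' := (ℓ' (j r)).map_smulₛₗ }) (fun r => h (j r)) fun r => ?_
  refine (congrArg (IsBaseChange (A (j r))) ?_).mp (h' (j r))
  exact LinearMap.ext fun n => hm (j r) n

end
end

/-! ### Coherent modules -/

section
variable {R : Type} [CommRing R]

/-- A finitely generated module which embeds into a product of finitely many coherent modules is
finitely presented. -/
lemma finitePresentation_of_injective_pi {κ : Type} {N : κ → Type} [∀ k, AddCommGroup (N k)]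
    [∀ k, Module R (N k)] (hN : ∀ k, IsCoherentModule R (N k)) (s : Finset κ) :
    ∀ (K : Type) [AddCommGroup K] [Module R K] [Module.Finite R K] (p : ∀ k, K →ₗ[R] N k),
      (∀ x, (∀ k ∈ s, p k x = 0) → x = 0) → Module.FinitePresentation R K := by
  classical
  induction s using Finset.induction_on with
  | empty =>
    intro K _ _ _ p hp
    have : Subsingleton K := ⟨fun x y => (hp x (by simp)).trans (hp y (by simp)).symm⟩
    infer_instance
  | insert a s _ ih =>
    intro K _ _ _ p hp
    -- The image in the factor `a` is finitely presented, so the kernel is finitely generated.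
    have h₁ : Module.FinitePresentation R (LinearMap.range (p a)) :=
      (hN a).2 _ (Module.Finite.iff_fg.1 inferInstance)
    have h₂ : Module.Finite R (LinearMap.ker (p a).rangeRestrict) :=
      Module.Finite.iff_fg.2 (Module.FinitePresentation.fg_ker _ (p a).surjective_rangeRestrict)
    have h₃ : Module.FinitePresentation R (LinearMap.ker (p a).rangeRestrict) := by
      refine ih _ (fun k => p k ∘ₗ (LinearMap.ker (p a).rangeRestrict).subtype) fun x hx => ?_
      refine Subtype.ext (hp x fun k hk => ?_)
      rcases Finset.mem_insert.1 hk with rfl | hk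
      · exact congrArg Subtype.val x.2
      · exact hx k hk
    exact Module.finitePresentation_of_ker _ (p a).surjective_rangeRestrict

/-- A finite sum of retracts of coherent modules is coherent. -/
lemma isCoherentModule_of_retracts {κ : Type} [Fintype κ] {K : Type} [AddCommGroup K] [Module R K]
    {N : κ → Type} [∀ k, AddCommGroup (N k)] [∀ k, Module R (N k)]
    (hN : ∀ k, IsCoherentModule R (N k)) (i : ∀ k, N k →ₗ[R] K) (p : ∀ k, K →ₗ[R] N k)
    (h : ∀ x, ∑ k, i k (p k x) = x) : IsCoherentModule R K := by
  constructor
  · have := fun k => (hN k).1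
    classical
    refine Module.Finite.of_surjective (LinearMap.lsum R N R i) fun x => ⟨fun k => p k x, ?_⟩
    simpa using h x
  · intro L hL
    have := Module.Finite.iff_fg.2 hL
    refine finitePresentation_of_injective_pi hN Finset.univ L (fun k => p k ∘ₗ L.subtype)
      fun x hx => Subtype.ext ?_
    rw [← h x]
    exact Finset.sum_eq_zero fun k hk => by
      rw [show p k x = 0 from hx k hk, map_zero]

end

open TensorProduct in
/-- The two descriptions of the canonical map from the base change agree. -/
lemma isIso_extendRestrictScalars_iff {R R' : Type} [CommRing R] [CommRing R'] (φ : R →+* R')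
    (N : ModuleCat.{0} R) (N' : ModuleCat.{0} R') (f : N ⟶ (ModuleCat.restrictScalars φ).obj N')
    (ℓ : N →ₛₗ[φ] N') (h : ∀ n, ℓ n = f n) :
    IsIso (((ModuleCat.extendRestrictScalarsAdj φ).homEquiv N N').symm f) ↔
      IsBaseChangeAlong ℓ := by
  let := φ.toAlgebra
  let := Module.compHom N' φ
  have : IsScalarTower R R' N' := ⟨fun r s n => mul_smul (φ r) s n⟩
  rw [ConcreteCategory.isIso_iff_bijective]
  let ℓ' : N →ₗ[R] N' := { toFun := ℓ, map_add' := ℓ.map_add, map_smul' := ℓ.map_smulₛₗ }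
  refine Iff.trans ?_ (isBaseChange_iff_bijective (R' := R') ℓ').symm
  refine iff_of_eq (congrArg Function.Bijective (funext fun (t : R' ⊗[R] N) => ?_))
  induction t using TensorProduct.induction_on with
  | zero => exact (map_zero (ModuleCat.Hom.hom _)).trans (map_zero _).symm
  | add a b ha hb =>
    exact ((((ModuleCat.extendRestrictScalarsAdj φ).homEquiv N N').symm f).hom.map_add a b).trans
      ((congrArg₂ _ ha hb).trans (map_add _ a b).symm)
  | tmul r n =>
    have : baseChangeLift (R' := R') ℓ' (r ⊗ₜ n) = r • ℓ n := by
      rw [← mul_one r, ← smul_eq_mul, ← TensorProduct.smul_tmul', _root_.map_smul,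
        baseChangeLift_one_tmul, smul_eq_mul, mul_one]
      rfl
    refine Eq.trans ?_ this.symm
    rw [h]
    rfl

section
universe v u
variable {C : Type u} [Category.{v} C] {𝒪 : AlgebraPresheaf C} {S : Type*} [Category* S] {π : S ⥤ C}

namespace Modules

/-- The restriction map of `F` along `f`, as a semilinear map. -/
def semilinearRestr (F : Modules 𝒪 π) {U V : S} (f : U ⟶ V) :
    F.Sec V →ₛₗ[(𝒪.ring.map (π.map f).op).hom] F.Sec U where
  toFun := F.restr f
  map_add' := (F.restr f).map_add
  map_smul' := F.restr_smul f

/-- The restriction map along `f` is base change. -/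
def IsCartesianAt (F : Modules 𝒪 π) {U V : S} (f : U ⟶ V) : Prop :=
  IsBaseChangeAlong (F.semilinearRestr f)

lemma isCartesianAt_iff (F : Modules 𝒪 π) {U V : S} (f : U ⟶ V) :
    F.IsCartesianAt f ↔ IsIso (((ModuleCat.extendRestrictScalarsAdj
      (𝒪.ring.map (π.map f).op).hom).homEquiv (F.sections V) (F.sections U)).symm (F.map f.op)) :=
  (isIso_extendRestrictScalars_iff _ (F.sections V) (F.sections U) (F.map f.op)
    (F.semilinearRestr f) fun _ => rfl).symm

end Modules

lemma isCartesianOn_iff (P : C → Prop) (F : Modules 𝒪 π) : IsCartesianOn P F ↔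
    ∀ ⦃U V : S⦄ (f : U ⟶ V), P (π.obj U) → P (π.obj V) → F.IsCartesianAt f := by
  simp only [IsCartesianOn, Modules.isCartesianAt_iff]

end

/-! ### Base change and coherence for the two constructions -/

section
universe v u
variable {C : Type u} [Category.{v} C] {𝒪 : AlgebraPresheaf C}

lemma Modules.IsCartesianAt.of_iso {S : Type*} [Category* S] {π : S ⥤ C} {F F' : Modules 𝒪 π}
    (φ : F ≅ F') {U V : S} {f : U ⟶ V} (h : F.IsCartesianAt f) : F'.IsCartesianAt f := by
  have hi : ∀ U s, homSec φ.inv U (homSec φ.hom U s) = s := fun U s =>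
    congrArg (fun ψ => homSec ψ U s) φ.hom_inv_id
  have hh : ∀ U s, homSec φ.hom U (homSec φ.inv U s) = s := fun U s =>
    congrArg (fun ψ => homSec ψ U s) φ.inv_hom_id
  refine isBaseChangeAlong_of_retracts (κ := Unit) (fun _ => h) (fun _ => homSec φ.hom V)
    (fun _ => homSec φ.inv V) (fun _ => homSec φ.hom U) (fun _ => homSec φ.inv U)
    (fun _ s => (homSec_restr φ.hom f s).symm) (fun _ s => (homSec_restr φ.inv f s).symm)
    (fun s => ?_) (fun s => ?_)
  · rw [Fintype.sum_unique, hh]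
  · rw [Fintype.sum_unique, hh]

lemma Modules.isCoherentModule_of_iso {S : Type*} [Category* S] {π : S ⥤ C} {F F' : Modules 𝒪 π}
    (φ : F ≅ F') {U : S} (h : IsCoherentModule (𝒪.at (π.obj U)) (F.Sec U)) :
    IsCoherentModule (𝒪.at (π.obj U)) (F'.Sec U) :=
  isCoherentModule_of_retracts (κ := Unit) (fun _ => h) (fun _ => homSec φ.hom U)
    (fun _ => homSec φ.inv U) fun s => by
      rw [Fintype.sum_unique]
      exact congrArg (fun ψ => homSec ψ U s) φ.inv_hom_id

variable {𝒢 : Geometry C} {M : C} {G : Type} [Group G] [Finite G]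
  {E : GerbeExtension 𝒢 G M} {D : UnitaryDual G} {T : Intertwiners D}

namespace TensorSec
variable {W : Modules 𝒪 (DualChart.forget E T)} {U V : Chart E.H}

variable (W U) in
/-- The map `w ↦ w ⊗ v`. -/
def tmulHom {i : D.Idx} (v : D.V i) : W.Sec (U.toDual T i) →ₗ[𝒪.at U.dom] TensorSec W U where
  toFun w := tmul w v
  map_add' w w' := add_tmul w w' v
  map_smul' r w := smul_tmul r w v

variable (W U) in
/-- The evaluation `s ↦ s_i(l)`. -/
def eval {i : D.Idx} (l : Module.Dual ℂ (D.V i)) :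
    TensorSec W U →ₗ[𝒪.at U.dom] W.Sec (U.toDual T i) where
  toFun s := s i l
  map_add' _ _ := rfl
  map_smul' _ _ := rfl

/-- An element is the sum of the pure tensors formed with bases of the `V_i`. -/
lemma sum_tmul (s : TensorSec W U) {σ : D.Idx → D.Idx} (hσ : Function.Bijective σ)
    {n : D.Idx → ℕ} (c : ∀ i, Module.Basis (Fin (n i)) ℂ (D.V (σ i))) :
    ∑ k : Σ i, Fin (n i), tmul (s (σ k.1) ((c k.1).coord k.2)) (c k.1 k.2) = s := by
  refine TensorSec.ext fun k l => ?_
  obtain ⟨i, rfl⟩ := hσ.2 k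
  have h : ∀ (J : Finset (Σ i, Fin (n i))) (f : (Σ i, Fin (n i)) → TensorSec W U),
      (∑ k ∈ J, f k) (σ i) l = ∑ k ∈ J, f k (σ i) l := fun J f =>
    map_sum (eval W U l) f J
  rw [h, Fintype.sum_sigma, Finset.sum_eq_single i]
  · simp only [tmul_self]
    rw [← (c i).sum_dual_apply_smul_coord l, map_sum]
    refine Finset.sum_congr rfl fun j _ => ?_
    rw [_root_.map_smul, (c i).sum_dual_apply_smul_coord l]
  · exact fun k _ hk => Finset.sum_eq_zero fun j _ => tmul_ne _ _ (fun e => hk (hσ.1 e.symm)) l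
  · exact fun hi => absurd (Finset.mem_univ i) hi

/-- The restriction along a morphism with constant data, as a semilinear map. -/
def pushHom {a : U ⟶ V} {g : G} {ν : MulAut G} (h : Chart.IsConst a g ν) :
    TensorSec W V →ₛₗ[(𝒪.ring.map a.hom.op).hom] TensorSec W U where
  toFun := push h
  map_add' := push_add h
  map_smul' := push_smul h

variable (W) in
/-- The restriction along the morphism of the dual defined by a morphism with constant data, as a
semilinear map. -/
def alongHom {a : U ⟶ V} {g : G} {ν : MulAut G} (h : Chart.IsConst a g ν) {i k : D.Idx}
    (hk : T.act ν i = k) :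
    W.Sec (V.toDual T k) →ₛₗ[(𝒪.ring.map a.hom.op).hom] W.Sec (U.toDual T i) :=
  W.semilinearRestr (h.along T hk)

/-- In suitable bases of the `V_i`, the restriction along a morphism with constant data is a direct
sum of restrictions of the twisted sheaf. -/
lemma isBaseChangeAlong_pushHom {a : U ⟶ V} {g : G} {ν : MulAut G} (h : Chart.IsConst a g ν)
    (hW : ∀ i, IsBaseChangeAlong (alongHom W h (rfl : T.act ν i = _))) :
    IsBaseChangeAlong (pushHom (W := W) h) := by
  let b := fun i => Module.finBasis ℂ (D.V i)
  let ρ : ∀ i, D.V i ≃ₗ[ℂ] D.V i := fun i =>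
    { toLinearMap := D.rep i g
      invFun := D.rep i g⁻¹
      left_inv := fun v => by simp
      right_inv := fun v => by simp }
  -- The basis of the space `V_{ν i}` at the target which the action carries to `b i`.
  let c := fun i => (b i).map ((ρ i).symm.trans (T.into ν rfl))
  have hc : ∀ i j, D.rep i g ((T.into ν rfl).symm (c i j)) = b i j := fun i j => by
    change ρ i ((T.into ν rfl).symm (T.into ν rfl ((ρ i).symm (b i j)))) = _
    rw [LinearEquiv.symm_apply_apply, LinearEquiv.apply_symm_apply]
  have hc' : ∀ i j, (c i).coord j = T.codual g ν rfl ((b i).coord j) := fun i j => rfl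
  have hσ : Function.Bijective (T.act ν) := Finite.injective_iff_bijective.1 (T.act_injective ν)
  refine isBaseChangeAlong_of_retracts (κ := Σ i, Fin (Module.finrank ℂ (D.V i)))
    (fun k => hW k.1) (fun k => tmulHom W V (c k.1 k.2)) (fun k => eval W V ((c k.1).coord k.2))
    (fun k => tmulHom W U (b k.1 k.2)) (fun k => eval W U ((b k.1).coord k.2))
    (fun k w => ?_) (fun k s => ?_) (fun s => sum_tmul s hσ c)
    (fun s => sum_tmul s Function.bijective_id b)
  · exact (push_tmul h rfl w _).trans (congrArg _ (hc k.1 k.2))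
  · rfl

lemma isCoherentModule (hW : ∀ i, IsCoherentModule (𝒪.at U.dom) (W.Sec (U.toDual T i))) :
    IsCoherentModule (𝒪.at U.dom) (TensorSec W U) := by
  let b := fun i => Module.finBasis ℂ (D.V i)
  exact isCoherentModule_of_retracts (κ := Σ i, Fin (Module.finrank ℂ (D.V i)))
    (fun k => hW k.1) (fun k => tmulHom W U (b k.1 k.2)) (fun k => eval W U ((b k.1).coord k.2))
    (fun s => sum_tmul s Function.bijective_id b)

/-- The twisted sheaf is a retract of the corresponding sheaf on the gerbe. -/
lemma isCoherentModule_of_tensorSec {i : D.Idx}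
    (h : IsCoherentModule (𝒪.at U.dom) (TensorSec W U)) :
    IsCoherentModule (𝒪.at U.dom) (W.Sec (U.toDual T i)) := by
  obtain ⟨l₀, v₀, h₀⟩ := D.exists_pair i
  refine isCoherentModule_of_retracts (κ := Unit) (fun _ => h) (fun _ => eval W U l₀)
    (fun _ => tmulHom W U v₀) fun w => ?_
  rw [Fintype.sum_unique]
  exact (tmul_self w v₀ l₀).trans (by rw [h₀, one_smul])

/-- A restriction of the twisted sheaf is a retract of a restriction of the sheaf on the gerbe. -/
lemma isBaseChangeAlong_alongHom {a : U ⟶ V} {ν : MulAut G} (h : Chart.IsConst a 1 ν)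
    (hp : IsBaseChangeAlong (pushHom (W := W) h)) {i k : D.Idx} (hk : T.act ν i = k) :
    IsBaseChangeAlong (alongHom W h hk) := by
  obtain ⟨l₀, v₀, h₀⟩ := D.exists_pair i
  refine isBaseChangeAlong_of_retracts (κ := Unit) (fun _ => hp)
    (fun _ => eval W V (T.codual 1 ν hk l₀)) (fun _ => tmulHom W V (T.into ν hk v₀))
    (fun _ => eval W U l₀) (fun _ => tmulHom W U v₀)
    (fun _ s => (push_apply h s hk l₀).symm) (fun _ w => ?_) (fun w => ?_) (fun w => ?_)
  · refine (push_tmul h hk w _).trans ?_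
    rw [LinearEquiv.symm_apply_apply, _root_.map_one]
    rfl
  · rw [Fintype.sum_unique]
    refine (tmul_self w (T.into ν hk v₀) (T.codual 1 ν hk l₀)).trans ?_
    rw [T.codual_into, _root_.map_one]
    exact (congrArg (· • w) h₀).trans (one_smul ℂ w)
  · rw [Fintype.sum_unique]
    exact (tmul_self w v₀ l₀).trans (by rw [h₀, one_smul])

end TensorSec

/-- A semilinear map is base change if it is a multiple of a base change by a unit. -/
lemma isBaseChangeAlong_smul {R R' : Type} [CommRing R] [CommRing R'] {φ : R →+* R'} {N N' : Type}
    [AddCommGroup N] [AddCommGroup N'] [Module R N] [Module R' N'] {ℓ m : N →ₛₗ[φ] N'} (r : R'ˣ)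
    (h : ∀ n, ℓ n = r • m n) (hm : IsBaseChangeAlong m) : IsBaseChangeAlong ℓ := by
  refine isBaseChangeAlong_of_retracts (κ := Unit) (fun _ => hm) (fun _ => LinearMap.id)
    (fun _ => LinearMap.id) (fun _ => LinearMap.lsmul R' N' r)
    (fun _ => LinearMap.lsmul R' N' (r⁻¹ : R'ˣ)) (fun _ n => h n) (fun _ n => ?_) (fun n => ?_)
    (fun n => ?_)
  · change m n = r⁻¹ • ℓ n
    rw [h, inv_smul_smul]
  · rw [Fintype.sum_unique]
    rfl
  · rw [Fintype.sum_unique]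
    exact smul_inv_smul r n

section
variable (h𝒢 : 𝒢.IsRegular) {W : Modules 𝒪 (DualChart.forget E T)}
  (hs : IsSheaf 𝒢 W) (hW : IsTwisted W)

lemma tensorModules_isCartesianAt_iff {U V : Chart E.H} {a : U ⟶ V} {g : G} {ν : MulAut G}
    (h : Chart.IsConst a g ν) : (tensorModules h𝒢 hs hW).IsCartesianAt a ↔
      IsBaseChangeAlong (TensorSec.pushHom (W := W) h) := by
  have e : ((tensorModules h𝒢 hs hW).semilinearRestr a :
      TensorSec W V →ₛₗ[(𝒪.ring.map a.hom.op).hom] TensorSec W U) = TensorSec.pushHom h :=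
    LinearMap.ext fun s => tensorModules_restr h𝒢 hs hW h s
  rw [← e]
  exact Iff.rfl

lemma tensorModules_isCartesianAt {U V : Chart E.H} {a : U ⟶ V} {g : G} {ν : MulAut G}
    (h : Chart.IsConst a g ν)
    (hc : ∀ i, W.IsCartesianAt (h.along T (rfl : T.act ν i = _))) :
    (tensorModules h𝒢 hs hW).IsCartesianAt a :=
  (tensorModules_isCartesianAt_iff h𝒢 hs hW h).2 (TensorSec.isBaseChangeAlong_pushHom h hc)

include hW in
lemma isCartesianAt_of_tensorModules {X Y : DualChart E T} {a : X ⟶ Y} {ν : MulAut G} {z : Circle}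
    (h : DualChart.IsConst a ν z) (hν : T.act ν X.idx = Y.idx)
    (hc : (tensorModules h𝒢 hs hW).IsCartesianAt (DualChart.Hom.lift a)) :
    W.IsCartesianAt a := by
  have hl := Chart.lift_isConst h
  have hb := TensorSec.isBaseChangeAlong_alongHom hl
    ((tensorModules_isCartesianAt_iff h𝒢 hs hW hl).1 hc) hν
  refine isBaseChangeAlong_smul (m := W.semilinearRestr (hl.along T hν))
    (Units.map (algebraMap ℂ (𝒪.at ((DualChart.forget E T).obj X))).toMonoidHom
      (Units.mk0 (z : ℂ) (Circle.coe_ne_zero z))) (fun w => ?_) hb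
  refine hW.restr_eq (a := a) (b := hl.along T hν) rfl ?_ z (fun x => ?_) w
  · change a.arr = (a.arr ≫ E.sec) ≫ E.j
    rw [Category.assoc, E.sec_j, Category.comp_id]
  · rw [h.phase_eq]
    exact (mul_one z).symm
end

end

/-! ### Quasi-coherent and coherent sheaves -/

section
variable {M : ComplexScheme}

/-- In an affine étale object, points have arbitrarily small basic affine neighbourhoods. -/
lemma EtaleOver.exists_basicOpen (U : EtaleOver algebraic M) (hU : IsAffine U.dom.left)
    (x : algebraic.space.obj U.dom) (N : Set (algebraic.space.obj U.dom)) (hN : IsOpen N)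
    (hx : x ∈ N) :
    ∃ (f : structureAlgebra.at U.dom) (U' : EtaleOver algebraic M) (e : U' ⟶ U),
      x ∈ (U.dom.left.basicOpen f : Set U.dom.left) ∧
      Set.range (algebraic.space.map e.hom) ⊆ N ∧ IsAffine U'.dom.left ∧
      (letI := (structureAlgebra.ring.map e.hom.op).hom.toAlgebra
       IsLocalization.Away f (structureAlgebra.at U'.dom)) := by
  let W : U.dom.left.Opens := ⟨N, hN⟩
  obtain ⟨f, hf, hx⟩ := (isAffineOpen_top U.dom.left).exists_basicOpen_le (V := W) ⟨x, hx⟩ trivial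
  let D := U.dom.left.basicOpen f
  let e : Over.mk (D.ι ≫ U.dom.hom) ⟶ U.dom := Over.homMk D.ι
  have he : algebraic.isEtale e := (inferInstance : Etale D.ι)
  refine ⟨f, ⟨_, e ≫ U.map, algebraic_isRegular.comp _ _ he U.etale⟩, ⟨e, rfl⟩, hx, ?_, ?_, ?_⟩
  · rintro _ ⟨y, rfl⟩
    exact hf y.2
  · exact (isAffineOpen_top U.dom.left).basicOpen f
  · exact Γ_restrict_isLocalization U.dom.left f

/-- Whether restriction along a morphism is base change may be checked on basic open
neighbourhoods in the source. -/
lemma isCartesianAt_of_local {S : Type*} [Category* S] {π : S ⥤ ComplexScheme}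
    (F : Modules structureAlgebra π) {U V : S} (a : U ⟶ V) (hU : IsAffine (π.obj U).left)
    (h : ∀ x : (π.obj U).left, ∃ (f : structureAlgebra.at (π.obj U)) (U' : S) (e : U' ⟶ U),
      x ∈ (π.obj U).left.basicOpen f ∧
      (letI := (structureAlgebra.ring.map (π.map e).op).hom.toAlgebra
       IsLocalization.Away f (structureAlgebra.at (π.obj U'))) ∧
      F.IsCartesianAt e ∧ F.IsCartesianAt (e ≫ a)) : F.IsCartesianAt a := by
  choose f U' e hx hf he hea using h
  refine isBaseChangeAlong_of_span (J := (π.obj U).left) _ f ?_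
    (fun x => (structureAlgebra.ring.map (π.map (e x)).op).hom) hf
    (fun x => F.semilinearRestr (e x)) he (χ := fun x => _) (fun x => ?_)
    (m := fun x => F.semilinearRestr (e x ≫ a)) (fun x s => F.restr_comp (e x) a s) hea
  · refine (isAffineOpen_top (π.obj U).left).self_le_iSup_basicOpen_iff.1 fun x _ => ?_
    exact TopologicalSpace.Opens.mem_iSup.2 ⟨⟨f x, x, rfl⟩, hx x⟩
  · rw [Functor.map_comp, op_comp, Functor.map_comp]
    rfl

end

section
variable {M : ComplexScheme} {G : Type} [Group G] [Finite G] {E : GerbeExtension algebraic G M}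
  {D : UnitaryDual G} {T : Intertwiners D}

lemma isQuasicoherent_iff {S : Type*} [Category* S] {π : S ⥤ ComplexScheme}
    (F : Modules structureAlgebra π) : IsQuasicoherent F ↔
      ∀ ⦃U V : S⦄ (f : U ⟶ V), IsAffine (π.obj U).left → IsAffine (π.obj V).left →
        F.IsCartesianAt f := isCartesianOn_iff _ _

lemma IsQuasicoherent.of_iso {S : Type*} [Category* S] {π : S ⥤ ComplexScheme}
    {F F' : Modules structureAlgebra π} (φ : F ≅ F') (h : IsQuasicoherent F) :
    IsQuasicoherent F' := by
  rw [isQuasicoherent_iff] at h ⊢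
  exact fun U V f hU hV => (h f hU hV).of_iso φ

section
variable {W : Modules structureAlgebra (DualChart.forget E T)} (hs : IsSheaf algebraic W)
  (hW : IsTwisted W)

lemma tensorModules_isQuasicoherent (h : IsQuasicoherent W) :
    IsQuasicoherent (tensorModules algebraic_isRegular hs hW) := by
  rw [isQuasicoherent_iff] at h ⊢
  intro U V a hU hV
  refine isCartesianAt_of_local _ a hU fun x => ?_
  obtain ⟨N, g, ν, hN, hx, hc⟩ := Chart.exists_isConst_nhd
    (U := (⟨U.dom, U.map, U.etale⟩ : EtaleOver algebraic M)) a x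
  obtain ⟨f, U', e, hx, he, hU', hf⟩ :=
    EtaleOver.exists_basicOpen ⟨U.dom, U.map, U.etale⟩ hU x N hN hx
  exact ⟨f, (Chart.ofEtale E.H).obj U', (Chart.ofEtale E.H).map e, hx, hf,
    tensorModules_isCartesianAt _ hs hW (Chart.isConst_ofEtale e) fun i => h _ hU' hU,
    tensorModules_isCartesianAt _ hs hW (hc U' e he) fun i => h _ hU' hV⟩

include hW in
lemma isQuasicoherent_of_tensorModules
    (h : IsQuasicoherent (tensorModules algebraic_isRegular hs hW)) : IsQuasicoherent W := by
  rw [isQuasicoherent_iff] at h ⊢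
  intro X Y a hX hY
  refine isCartesianAt_of_local _ a hX fun x => ?_
  obtain ⟨N, ν, z, hN, hx, hν, hc⟩ := DualChart.exists_isConst_nhd
    (U := (⟨X.dom, X.map, X.etale⟩ : EtaleOver algebraic M)) a x
  obtain ⟨f, U', e, hx, he, hU', hf⟩ :=
    EtaleOver.exists_basicOpen ⟨X.dom, X.map, X.etale⟩ hX x N hN hx
  exact ⟨f, (DualChart.ofEtale E T X.idx).obj U', (DualChart.ofEtale E T X.idx).map e, hx, hf,
    isCartesianAt_of_tensorModules algebraic_isRegular hs hW (DualChart.isConst_ofEtale e)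
      (DualChart.act_one X.idx) (h _ hU' hX),
    isCartesianAt_of_tensorModules algebraic_isRegular hs hW (hc U' e he) hν (h _ hU' hY)⟩

lemma tensorModules_isCoherent (h : IsCoherent W) :
    IsCoherent (tensorModules algebraic_isRegular hs hW) :=
  ⟨tensorModules_isQuasicoherent hs hW h.1, fun U hU =>
    TensorSec.isCoherentModule (U := U) fun i => h.2 (U.toDual T i) hU⟩

include hW in
lemma isCoherent_of_tensorModules
    (h : IsCoherent (tensorModules algebraic_isRegular hs hW)) : IsCoherent W :=
  ⟨isQuasicoherent_of_tensorModules hs hW h.1, fun X hX =>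
    TensorSec.isCoherentModule_of_tensorSec (U := X.toChart) (i := X.idx) (h.2 X.toChart hX)⟩

end

lemma IsCoherent.of_iso {S : Type*} [Category* S] {π : S ⥤ ComplexScheme}
    {F F' : Modules structureAlgebra π} (φ : F ≅ F') (h : IsCoherent F) : IsCoherent F' :=
  ⟨h.1.of_iso φ, fun U hU => Modules.isCoherentModule_of_iso φ (h.2 U hU)⟩

end

end GerbeDuality
end

theorem mainTheorem3 {G : Type} [Group G] [Finite G] (D : UnitaryDual G) (T : Intertwiners D) :
    (∀ (M : TopCat.{0}) (E : GerbeExtension topological G M),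
      Duality E T (constantAlgebra TopCat.{0}) (fun _ => True)) ∧
    (∀ (M : ComplexScheme) (E : GerbeExtension algebraic G M),
      Duality E T (constantAlgebra ComplexScheme) (fun _ => True) ∧
      Duality E T structureAlgebra IsQuasicoherent ∧
      Duality E T structureAlgebra IsCoherent) := by
  refine ⟨fun M E => ?_, fun M E => ⟨?_, ?_, ?_⟩⟩
  · exact duality_of_preserves topological_isRegular (fun _ => True) (fun _ _ _ _ => trivial)
      fun _ _ _ => trivial
  · exact duality_of_preserves algebraic_isRegular (fun _ => True) (fun _ _ _ _ => trivial)
      fun _ _ _ => trivial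
  -- As `F` is recovered from its multiplicity spaces, the property passes from `F` to them.
  · exact duality_of_preserves algebraic_isRegular IsQuasicoherent
      (fun _ hs hW h => tensorModules_isQuasicoherent hs hW h) fun F hF h =>
        isQuasicoherent_of_tensorModules (isotypicModules_isSheaf algebraic_isRegular hF)
          (isotypicModules_isTwisted algebraic_isRegular hF)
          (h.of_iso (fourierIso algebraic_isRegular hF _ _))
  · exact duality_of_preserves algebraic_isRegular IsCoherent
      (fun _ hs hW h => tensorModules_isCoherent hs hW h) fun F hF h =>
        isCoherent_of_tensorModules (isotypicModules_isSheaf algebraic_isRegular hF)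
          (isotypicModules_isTwisted algebraic_isRegular hF)
          (h.of_iso (fourierIso algebraic_isRegular hF _ _))
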